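/- Let $M$ be a smooth 3-manifold and let $(\mathcal F,\bar J)$ be a partial Nijenhuis operator on $M$: $\mathcal F$ is a smooth foliation of rank 2, and $\bar J:T\mathcal F\to TM$ is a smooth fibrewise linear map such that for all local sections $X,Y$ of $T\mathcal F$ the field $[X,Y]_{\bar J}:=[\bar JX,Y]+[X,\bar JY]-\bar J[X,Y]$ is a section of $T\mathcal F$ and $[\bar JX,\bar JY]=\bar J[X,Y]_{\bar J}$. Assume that it is of generic type: near every point there are smooth local frames $v_1,v_2$ of $T\mathcal F$ and $w_0,w_1,w_2$ of $TM$ with $v_i=w_i$ and $\bar Jv_i=w_{i-1}$ for $i=1,2$. Then for every point $x\in M$ and each of the types A, B, C there are an open neighbourhood $U$ of $x$ with smooth coordinates $(x_1,x_2,x_3)$ and a smooth Nijenhuis operator $J:TU\to TU$ (that is, $[JX,JY]=J([JX,Y]+[X,JY]-J[X,Y])$ for all vector fields $X,Y$) with $J|_{T\mathcal F}=\bar J$ on $U$, which is of that type: its matrix in the basis $\partial_{x_1},\partial_{x_2},\partial_{x_3}$ is, respectively, $$ (A)\ \begin{pmatrix}\lambda_1(x_1)&0&0\\0&\lambda_2(x_2)&0\\0&0&\lambda_3(x_3)\end{pmatrix},\quad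 (B)\ \begin{pmatrix}\lambda_2(x_2)&1&0\\0&\lambda_2(x_2)&0\\0&0&\lambda_3(x_3)\end{pmatrix},\quad (C)\ \begin{pmatrix}\lambda_3(x_3)&e^{\lambda_3'(x_3)x_2}&0\\0&\lambda_3(x_3)&1\\0&0&\lambda_3(x_3)\end{pmatrix} $$ for some smooth functions $\lambda_i$ of one variable (constants allowed) with $\lambda_i(x_i)\ne\lambda_j(x_j)$ on $U$ for $i\neq j$. If moreover $M$, $\mathcal F$ and $\bar J$ are real-analytic, the same holds, with real-analytic $J$, coordinates and $\lambda_3$, for the type $$ (D)\ \begin{pmatrix}a&-b&0\\b&a&0\\0&0&\lambda_3(x_3)\end{pmatrix}, $$ where $a+ib=Z(x_1+ix_2)$ for a holomorphic function $Z$ and $b\ne0$ on $U$. In each case $J$ can be chosen so that moreover there is a frame $X_0,X_1,X_2$ of $TU$ (smooth, and real-analytic for type D) with $X_0,X_1\in\Gamma(T\mathcal F)$, $\bar JX_0=X_1$, $\bar JX_1=X_2$, in which $J$ has the matrix $$ F(\phi_1,\phi_2,\phi_3)=\begin{pmatrix}0&0&\phi_1\phi_2\phi_3\\1&0&-\phi_1\phi_2-\phi_1\phi_3-\phi_2\phi_3\\0&1&\phi_1+\phi_2+\phi_3\end{pmatrix},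 $$ where $(\phi_1,\phi_2,\phi_3)$ is $(\lambda_1,\lambda_2,\lambda_3)$, $(\lambda_2,\lambda_2,\lambda_3)$, $(\lambda_3,\lambda_3,\lambda_3)$, $(a+ib,a-ib,\lambda_3)$ for type A, B, C, D respectively, and each $\phi=\phi_i$ is self-propelled: at each point $d\phi$ is a (possibly zero) multiple of $\alpha_0+\phi\,\alpha_1+\phi^2\alpha_2$, where $(\alpha_0,\alpha_1,\alpha_2)$ is the coframe dual to $(X_0,X_1,X_2)$. -/

import Mathlib

open scoped Manifold ContDiff Topology

noncomputable section

namespace PNO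

section General

variable {E : Type*} [NormedAddCommGroup E] [NormedSpace ℝ E]
  {H : Type*} [TopologicalSpace H] (I : ModelWithCorners ℝ E H)
  {M : Type*} [TopologicalSpace M] [ChartedSpace H M]

/-- A (not necessarily continuous) vector field on `M`. -/
abbrev Field := ∀ x : M, TangentSpace I x

/-- A field of tangent subspaces on `M`. -/
abbrev Distribution := ∀ x : M, Submodule ℝ (TangentSpace I x)

/-- A field of endomorphisms of the tangent spaces of `M`. -/
abbrev Operator := ∀ x : M, TangentSpace I x →ₗ[ℝ] TangentSpace I x

variable {I}

/-- A partial operator `D → TM` (fibrewise linear). -/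
abbrev PartialOperator (D : Distribution I (M := M)) := ∀ x : M, D x →ₗ[ℝ] TangentSpace I x

/-- The vector field `J X`. -/
def Operator.app (J : Operator I (M := M)) (X : Field I (M := M)) : Field I (M := M) :=
  fun x => J x (X x)

open Classical in
/-- The vector field `J X` for a section `X` of `D` (it is `0` at points where `X` is not
in `D`). -/
def PartialOperator.app {D : Distribution I (M := M)} (J : PartialOperator D)
    (X : Field I (M := M)) : Field I (M := M) :=
  fun x => if h : X x ∈ D x then J x ⟨X x, h⟩ else 0

variable [IsManifold I 1 M]

/-- `X` is of class `C^n` on `U`. -/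
def FieldOn (n : WithTop ℕ∞) (X : Field I (M := M)) (U : Set M) : Prop :=
  ContMDiffOn I I.tangent n (fun x => (⟨x, X x⟩ : TangentBundle I M)) U

/-- `X` is a `C^n` section of `D` over `U`. -/
def SectionOn (n : WithTop ℕ∞) (D : Distribution I (M := M)) (X : Field I (M := M))
    (U : Set M) : Prop :=
  FieldOn n X U ∧ ∀ x ∈ U, X x ∈ D x

/-- `v` is a `C^n` frame of `D` over `U`. -/
def FrameOn (n : WithTop ℕ∞) (D : Distribution I (M := M)) {m : ℕ}
    (v : Fin m → Field I (M := M)) (U : Set M) : Prop :=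
  (∀ i, FieldOn n (v i) U) ∧
    ∀ x ∈ U, LinearIndependent ℝ (fun i => v i x) ∧ Submodule.span ℝ (Set.range fun i => v i x) = D x

/-- `D` is a `C^n` subbundle of `TM` of rank `m`. -/
def IsSubbundle (n : WithTop ℕ∞) (m : ℕ) (D : Distribution I (M := M)) : Prop :=
  ∀ x : M, ∃ U : Set M, IsOpen U ∧ x ∈ U ∧ ∃ v : Fin m → Field I (M := M), FrameOn n D v U

/-- `D` is the tangent distribution `TF` of a smooth foliation `F` of rank `m`:
a smooth involutive subbundle. -/
structure IsFoliation (m : ℕ) (D : Distribution I (M := M)) : Prop where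
  subbundle : IsSubbundle ∞ m D
  involutive : ∀ U : Set M, IsOpen U → ∀ X Y : Field I (M := M), SectionOn ∞ D X U →
    SectionOn ∞ D Y U → ∀ x ∈ U, VectorField.mlieBracket I X Y x ∈ D x

/-- A partial operator is `C^n`: it sends local `C^n` sections of `D` to `C^n` vector fields. -/
def PartialOperator.IsContDiff (n : WithTop ℕ∞) {D : Distribution I (M := M)}
    (J : PartialOperator D) : Prop :=
  ∀ U : Set M, IsOpen U → ∀ X : Field I (M := M), SectionOn n D X U → FieldOn n (J.app X) U

/-- `[X, Y]_J = [JX, Y] + [X, JY] - J[X, Y]` for a partial operator. -/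
def PartialOperator.bracket {D : Distribution I (M := M)} (J : PartialOperator D)
    (X Y : Field I (M := M)) : Field I (M := M) :=
  fun x => VectorField.mlieBracket I (J.app X) Y x + VectorField.mlieBracket I X (J.app Y) x
    - J.app (VectorField.mlieBracket I X Y) x

/-- `(F, J)` is a partial Nijenhuis operator, where `D = TF` has rank `m`. -/
structure IsPNO (m : ℕ) {D : Distribution I (M := M)} (J : PartialOperator D) : Prop where
  foliation : IsFoliation m D
  smooth : J.IsContDiff ∞
  bracket_mem : ∀ U : Set M, IsOpen U → ∀ X Y : Field I (M := M), SectionOn ∞ D X U →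
    SectionOn ∞ D Y U → ∀ x ∈ U, J.bracket X Y x ∈ D x
  nijenhuis : ∀ U : Set M, IsOpen U → ∀ X Y : Field I (M := M), SectionOn ∞ D X U →
    SectionOn ∞ D Y U → ∀ x ∈ U,
      VectorField.mlieBracket I (J.app X) (J.app Y) x - J.app (J.bracket X Y) x = 0

/-- Generic type: near every point there are local frames `v_1, …, v_m` of `D` and
`w_0, …, w_m` of `TM` in which the pair `(J, inclusion)` is a single Kronecker block, i.e.
`J v_i = w_{i-1}` and `v_i = w_i`. -/
def PartialOperator.IsGeneric (m : ℕ) {D : Distribution I (M := M)} (J : PartialOperator D) :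
    Prop :=
  ∀ x : M, ∃ U : Set M, IsOpen U ∧ x ∈ U ∧
    ∃ (v : Fin m → Field I (M := M)) (w : Fin (m + 1) → Field I (M := M)),
      FrameOn ∞ D v U ∧ FrameOn ∞ (fun _ => ⊤) w U ∧
      ∀ y ∈ U, ∀ i : Fin m, J.app (v i) y = w i.castSucc y ∧ v i y = w i.succ y

/-- Real-analyticity of the partial operator `(F, J)`, `D = TF` of rank `m`, together with the
manifold carrying it. -/
structure PartialOperator.IsAnalytic (m : ℕ) {D : Distribution I (M := M)}
    (J : PartialOperator D) : Prop where
  manifold : IsManifold I ω M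
  subbundle : IsSubbundle ω m D
  operator : J.IsContDiff ω

/-- `J` is a `C^n` operator field on `U`. -/
def Operator.IsContDiffOn (n : WithTop ℕ∞) (J : Operator I (M := M)) (U : Set M) : Prop :=
  ∀ V : Set M, IsOpen V → V ⊆ U → ∀ X : Field I (M := M), FieldOn n X V → FieldOn n (J.app X) V

/-- The Nijenhuis tensor
`N_J(X, Y) = [JX, JY] - J([JX, Y] + [X, JY] - J[X, Y])`. -/
def Operator.nijenhuisTensor (J : Operator I (M := M)) (X Y : Field I (M := M)) :
    Field I (M := M) :=
  fun x => VectorField.mlieBracket I (J.app X) (J.app Y) x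
    - J x (VectorField.mlieBracket I (J.app X) Y x + VectorField.mlieBracket I X (J.app Y) x
        - J x (VectorField.mlieBracket I X Y x))

/-- `J` is a Nijenhuis operator of class `C^n` on the open set `U`. -/
structure Operator.IsNijenhuisOn (n : WithTop ℕ∞) (J : Operator I (M := M)) (U : Set M) :
    Prop where
  contDiff : J.IsContDiffOn n U
  nijenhuis : ∀ V : Set M, IsOpen V → V ⊆ U → ∀ X Y : Field I (M := M), FieldOn ∞ X V →
    FieldOn ∞ Y V → ∀ x ∈ V, J.nijenhuisTensor X Y x = 0

end General

/-! ### Dimension three -/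

section Three

variable {M : Type*} [TopologicalSpace M] [ChartedSpace (EuclideanSpace ℝ (Fin 3)) M]

/-- The value `(dx₁(v), dx₂(v), dx₃(v))` of the coordinate differentials of the chart `e`. -/
def dChart (e : OpenPartialHomeomorph M (EuclideanSpace ℝ (Fin 3))) (y : M)
    (v : TangentSpace (𝓡 3) y) : EuclideanSpace ℝ (Fin 3) :=
  mfderiv (𝓡 3) (𝓡 3) e y v

/-- `A y` is the matrix of `J` at `y` in the coordinate basis of the chart `e`:
`dx_i ∘ J = ∑ j, A_ij dx_j`, that is `J ∂_j = ∑ i, A_ij ∂_i`. -/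
def MatrixInChart (e : OpenPartialHomeomorph M (EuclideanSpace ℝ (Fin 3)))
    (J : Operator (𝓡 3) (M := M)) (A : M → Matrix (Fin 3) (Fin 3) ℝ) : Prop :=
  ∀ y ∈ e.source, ∀ (v : TangentSpace (𝓡 3) y) (i : Fin 3),
    dChart e y (J y v) i = ∑ j, A y i j * dChart e y v j

/-- `l` is a `C^n` function of the coordinate `x_i`, on the set of values that this coordinate
takes on the domain of the chart `e`. -/
def FunctionOfCoord (n : WithTop ℕ∞) (e : OpenPartialHomeomorph M (EuclideanSpace ℝ (Fin 3)))
    (i : Fin 3) (l : ℝ → ℝ) : Prop :=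
  ContDiffOn ℝ n l ((fun y => e y i) '' e.source)

/-- Type A (real semi-simple): `J = diag(l₁(x₁), l₂(x₂), l₃(x₃))`, with eigenvalue
functions `φ`, pairwise distinct at each point. -/
def TypeA (n : WithTop ℕ∞) (e : OpenPartialHomeomorph M (EuclideanSpace ℝ (Fin 3)))
    (J : Operator (𝓡 3) (M := M)) (φ : Fin 3 → M → ℂ) : Prop :=
  ∃ l₁ l₂ l₃ : ℝ → ℝ,
    FunctionOfCoord n e 0 l₁ ∧ FunctionOfCoord n e 1 l₂ ∧ FunctionOfCoord n e 2 l₃ ∧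
    (∀ y ∈ e.source, l₁ (e y 0) ≠ l₂ (e y 1) ∧ l₁ (e y 0) ≠ l₃ (e y 2) ∧
      l₂ (e y 1) ≠ l₃ (e y 2)) ∧
    (∀ y ∈ e.source, φ 0 y = l₁ (e y 0) ∧ φ 1 y = l₂ (e y 1) ∧ φ 2 y = l₃ (e y 2)) ∧
    MatrixInChart e J fun y =>
      !![l₁ (e y 0), 0, 0;
         0, l₂ (e y 1), 0;
         0, 0, l₃ (e y 2)]

/-- Type B (a `2 × 2` and a `1 × 1` Jordan block). -/
def TypeB (n : WithTop ℕ∞) (e : OpenPartialHomeomorph M (EuclideanSpace ℝ (Fin 3)))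
    (J : Operator (𝓡 3) (M := M)) (φ : Fin 3 → M → ℂ) : Prop :=
  ∃ l₂ l₃ : ℝ → ℝ,
    FunctionOfCoord n e 1 l₂ ∧ FunctionOfCoord n e 2 l₃ ∧
    (∀ y ∈ e.source, l₂ (e y 1) ≠ l₃ (e y 2)) ∧
    (∀ y ∈ e.source, φ 0 y = l₂ (e y 1) ∧ φ 1 y = l₂ (e y 1) ∧ φ 2 y = l₃ (e y 2)) ∧
    MatrixInChart e J fun y =>
      !![l₂ (e y 1), 1, 0;
         0, l₂ (e y 1), 0;
         0, 0, l₃ (e y 2)]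

/-- Type C (a `3 × 3` Jordan block). -/
def TypeC (n : WithTop ℕ∞) (e : OpenPartialHomeomorph M (EuclideanSpace ℝ (Fin 3)))
    (J : Operator (𝓡 3) (M := M)) (φ : Fin 3 → M → ℂ) : Prop :=
  ∃ l₃ : ℝ → ℝ,
    FunctionOfCoord n e 2 l₃ ∧
    (∀ y ∈ e.source, ∀ i, φ i y = l₃ (e y 2)) ∧
    MatrixInChart e J fun y =>
      !![l₃ (e y 2), Real.exp (deriv l₃ (e y 2) * e y 1), 0;
         0, l₃ (e y 2), 1;
         0, 0, l₃ (e y 2)]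

/-- Type D (complex semi-simple): `Z = a + i b` is a holomorphic function of `x₁ + i x₂`
with `b ≠ 0`; the eigenvalues are `Z`, its conjugate, and `l₃(x₃)`. -/
def TypeD (n : WithTop ℕ∞) (e : OpenPartialHomeomorph M (EuclideanSpace ℝ (Fin 3)))
    (J : Operator (𝓡 3) (M := M)) (φ : Fin 3 → M → ℂ) : Prop :=
  ∃ (Z : ℂ → ℂ) (l₃ : ℝ → ℝ),
    DifferentiableOn ℂ Z ((fun y => (⟨e y 0, e y 1⟩ : ℂ)) '' e.source) ∧
    FunctionOfCoord n e 2 l₃ ∧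
    (∀ y ∈ e.source, (Z ⟨e y 0, e y 1⟩).im ≠ 0) ∧
    (∀ y ∈ e.source, φ 0 y = Z ⟨e y 0, e y 1⟩ ∧
      φ 1 y = (starRingEnd ℂ) (Z ⟨e y 0, e y 1⟩) ∧ φ 2 y = l₃ (e y 2)) ∧
    MatrixInChart e J fun y =>
      !![(Z ⟨e y 0, e y 1⟩).re, -(Z ⟨e y 0, e y 1⟩).im, 0;
         (Z ⟨e y 0, e y 1⟩).im, (Z ⟨e y 0, e y 1⟩).re, 0;
         0, 0, l₃ (e y 2)]

/-- The Frobenius form `F(φ₁, φ₂, φ₃)`. -/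
def frobenius (φ : Fin 3 → ℂ) : Matrix (Fin 3) (Fin 3) ℂ :=
  !![0, 0, φ 0 * φ 1 * φ 2;
     1, 0, -(φ 0 * φ 1) - φ 0 * φ 2 - φ 1 * φ 2;
     0, 1, φ 0 + φ 1 + φ 2]

variable [IsManifold (𝓡 3) 1 M]

/-- `X₀, X₁, X₂` is a `C^n` frame of `TM` over `U` adapted to the partial operator `Jb`:
`X₀, X₁` are sections of `D`, `Jb X₀ = X₁` and `Jb X₁ = X₂`. -/
def AdaptedFrame (n : WithTop ℕ∞) {D : Distribution (𝓡 3) (M := M)} (Jb : PartialOperator D)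
    (X : Fin 3 → Field (𝓡 3) (M := M)) (U : Set M) : Prop :=
  FrameOn n (fun _ => ⊤) X U ∧
    ∀ y ∈ U, X 0 y ∈ D y ∧ X 1 y ∈ D y ∧ Jb.app (X 0) y = X 1 y ∧ Jb.app (X 1) y = X 2 y

/-- A (real or complex valued) `C^n` function `φ` is self-propelled on `U` with respect to a
frame `X` with dual coframe `α`: at each point `dφ` is proportional to
`α₀ + φ α₁ + φ² α₂`, the coefficient being allowed to vanish. Both sides are evaluated
on the frame. -/
def SelfPropelled (n : WithTop ℕ∞) (X : Fin 3 → Field (𝓡 3) (M := M)) (φ : M → ℂ)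
    (U : Set M) : Prop :=
  ContMDiffOn (𝓡 3) 𝓘(ℝ, ℂ) n φ U ∧
    ∀ y ∈ U, ∃ c : ℂ, ∀ i : Fin 3,
      (mfderiv (𝓡 3) 𝓘(ℝ, ℂ) φ y (X i y) : ℂ) = c * φ y ^ (i : ℕ)

/-- `J` has over `U` the (real) matrix `F(φ₁, φ₂, φ₃)` in the frame `X`. -/
def InFrobeniusForm (J : Operator (𝓡 3) (M := M)) (X : Fin 3 → Field (𝓡 3) (M := M))
    (φ : Fin 3 → M → ℂ) (U : Set M) : Prop :=
  ∀ y ∈ U, ∃ A : Matrix (Fin 3) (Fin 3) ℝ,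
    A.map (fun r : ℝ => (r : ℂ)) = frobenius (fun i => φ i y) ∧
    ∀ j, J y (X j y) = ∑ i, A i j • X i y

/-- Near `x` the partial operator `Jb` extends to a `C^n` Nijenhuis operator `J` of the type
`T`: on the domain of some `C^n` chart around `x`, the operator `J` restricts to `Jb` on `D`,
it has the normal form `T` in that chart, and in some adapted frame it has Frobenius form
`F(φ₁, φ₂, φ₃)`, where `φ₁, φ₂, φ₃` are its eigenvalue functions, which are self-propelled. -/
def ExtendsNear (n : WithTop ℕ∞) {D : Distribution (𝓡 3) (M := M)} (Jb : PartialOperator D)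
    (T : OpenPartialHomeomorph M (EuclideanSpace ℝ (Fin 3)) → Operator (𝓡 3) (M := M) →
      (Fin 3 → M → ℂ) → Prop) (x : M) : Prop :=
  ∃ (e : OpenPartialHomeomorph M (EuclideanSpace ℝ (Fin 3))) (J : Operator (𝓡 3) (M := M))
    (φ : Fin 3 → M → ℂ) (X : Fin 3 → Field (𝓡 3) (M := M)),
    e ∈ IsManifold.maximalAtlas (𝓡 3) n M ∧ x ∈ e.source ∧
    J.IsNijenhuisOn n e.source ∧
    (∀ y ∈ e.source, ∀ v : D y, J y (v : TangentSpace (𝓡 3) y) = Jb y v) ∧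
    T e J φ ∧
    AdaptedFrame n Jb X e.source ∧
    (∀ i, SelfPropelled n X (φ i) e.source) ∧
    InFrobeniusForm J X φ e.source

end Three

end PNO

end

/-! ### Maps of class `C^n` near a point -/

/-! The theorem leaves the functions λᵢ free, so it suffices to extend with constant eigenvalues.
Take an adapted frame X₀, X₁ = J̄X₀, X₂ = J̄X₁. An operator whose matrix in some chart is a constant
A extends J̄ exactly when the coordinate differentials satisfy the chain relations dx(X₁) = A dx(X₀)
and dx(X₂) = A dx(X₁). Its Nijenhuis tensor vanishes because A is constant, constant eigenvalues are
trivially self-propelled, and the last column of the Frobenius form is a monic cubic relation for A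
(`isNijenhuisOn_constOperator`, `extendsNear_of_chain`). Everything thus reduces to finding
coordinates with prescribed chain relations.

For A with an eigenvalue l, a coordinate f with df(X₁) = l df(X₀) and df(X₂) = l df(X₁) is a first
integral of the rank 2 distribution spanned by X₁ - lX₀ and X₂ - lX₁. The axioms of a partial
Nijenhuis operator, applied to X₀ and X₁, yield relations among the three brackets of the frame
(`bracketRelations_of_isPNO`) which say precisely enough to make this distribution involutive for
every l (`lieBracket_pencil_mem`). Frobenius then gives f, normalized by df(X₀) = 1 at the base
point, and applied with l as an extra variable it gives a family f(·, l) smooth in l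
(`exists_firstIntegral_family`).

Type A uses l = 0, 1, 2, with independence from a Vandermonde determinant. Types B and C use
derivatives of f in l at l = 0: differentiating the eigenvalue relation produces Jordan chains. Type
D needs l = i. The frame is then complexified, which requires analyticity, the holomorphic Frobenius
theorem is applied, and the real and imaginary parts of f serve as coordinates
(`exists_complex_eigenfunction`). An analytic adapted frame exists because the line of X₀ is
intrinsic: it consists of the v in TF with J̄v in TF (`exists_analytic_adaptedFrame`).

Frobenius is proved over ℝ and ℂ at once, for the classes ∞ and ω (`exists_common_firstIntegral`).
It rests on a local flow of the same class as the field, obtained from the implicit function theorem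
in a space of paths (`exists_flow`). -/

namespace PNO

section Near

variable {𝕜 : Type*} [RCLike 𝕜] {E F G : Type*} [NormedAddCommGroup E] [NormedSpace 𝕜 E]
  [NormedAddCommGroup F] [NormedSpace 𝕜 F] [NormedAddCommGroup G] [NormedSpace 𝕜 G]
  {n : WithTop ℕ∞} {a : E}

variable (𝕜) in
/-- `f` is `C^n` on a neighbourhood of `a`; for `n = ∞` this is stronger than `ContDiffAt`. -/
def ContDiffNear (n : WithTop ℕ∞) (f : E → F) (a : E) : Prop :=
  ∀ᶠ p in 𝓝 a, ContDiffAt 𝕜 n f p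

lemma ContDiff.near {f : E → F} (hf : ContDiff 𝕜 n f) : ContDiffNear 𝕜 n f a :=
  Filter.Eventually.of_forall fun _ => hf.contDiffAt

lemma near_of_contDiffAt_omega [CompleteSpace F] {f : E → F} (hf : ContDiffAt 𝕜 ω f a) :
    ContDiffNear 𝕜 ω f a :=
  hf.eventually (by simp)

namespace ContDiffNear

lemma contDiffAt {f : E → F} (hf : ContDiffNear 𝕜 n f a) : ContDiffAt 𝕜 n f a :=
  hf.self_of_nhds

lemma continuousAt {f : E → F} (hf : ContDiffNear 𝕜 n f a) : ContinuousAt f a :=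
  hf.contDiffAt.continuousAt

lemma differentiableAt {f : E → F} (hf : ContDiffNear 𝕜 n f a) (hn : n ≠ 0) :
    ∀ᶠ p in 𝓝 a, DifferentiableAt 𝕜 f p :=
  hf.mono fun _ h => h.differentiableAt hn

lemma comp {g : F → G} {f : E → F} {b : F} (hg : ContDiffNear 𝕜 n g b)
    (hf : ContDiffNear 𝕜 n f a) (hb : f a = b) : ContDiffNear 𝕜 n (fun p => g (f p)) a := by
  subst hb
  filter_upwards [hf, hf.continuousAt.eventually hg] with p h1 h2
  exact ContDiffAt.comp (g := g) p h2 h1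

lemma sub {f g : E → F} (hf : ContDiffNear 𝕜 n f a) (hg : ContDiffNear 𝕜 n g a) :
    ContDiffNear 𝕜 n (fun p => f p - g p) a := by
  filter_upwards [hf, hg] with p h1 h2 using h1.sub h2

lemma smul {c : E → 𝕜} {f : E → F} (hc : ContDiffNear 𝕜 n c a) (hf : ContDiffNear 𝕜 n f a) :
    ContDiffNear 𝕜 n (fun p => c p • f p) a := by
  filter_upwards [hc, hf] with p h1 h2 using h1.smul h2

lemma prodMk {f : E → F} {g : E → G} (hf : ContDiffNear 𝕜 n f a) (hg : ContDiffNear 𝕜 n g a) :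
    ContDiffNear 𝕜 n (fun p => (f p, g p)) a := by
  filter_upwards [hf, hg] with p h1 h2 using h1.prodMk h2

lemma clm_apply {A : E → F →L[𝕜] G} {f : E → F} (hA : ContDiffNear 𝕜 n A a)
    (hf : ContDiffNear 𝕜 n f a) : ContDiffNear 𝕜 n (fun p => A p (f p)) a := by
  filter_upwards [hA, hf] with p h1 h2 using h1.clm_apply h2

lemma fderiv {f : E → F} (hf : ContDiffNear 𝕜 n f a) (hn : n + 1 ≤ n) :
    ContDiffNear 𝕜 n (fderiv 𝕜 f) a := by
  filter_upwards [hf] with p h1 using h1.fderiv_right hn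

end ContDiffNear

/-- Local diffeomorphisms from the inverse function theorem, with control of the source. -/
lemma exists_local_diffeomorph [CompleteSpace E] (hn : 1 ≤ n) {f : E → F} {f' : E ≃L[𝕜] F}
    (hf : ContDiffNear 𝕜 n f a) (hf' : HasFDerivAt f (f' : E →L[𝕜] F) a) {S : Set E}
    (hS : S ∈ 𝓝 a) :
    ∃ g : OpenPartialHomeomorph E F, a ∈ g.source ∧ g.source ⊆ S ∧ (∀ p, g p = f p) ∧
      (∀ p ∈ g.source, ContDiffAt 𝕜 n f p) ∧ ∀ q ∈ g.target, ContDiffAt 𝕜 n g.symm q := by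
  have hn0 : n ≠ 0 := by rintro rfl; simp at hn
  -- Invertibility of the derivative is an open condition. After shrinking, it holds on the whole
  -- source, which makes the inverse `C^n` on the whole target and not only at the image of `a`.
  have hinv : ∀ᶠ p in 𝓝 a, ∃ A : E ≃L[𝕜] F, (A : E →L[𝕜] F) = _root_.fderiv 𝕜 f p := by
    have h1 : ContinuousAt (_root_.fderiv 𝕜 f) a :=
      (hf.contDiffAt.fderiv_right (m := 0) (by simpa using hn)).continuousAt
    have h2 : ∀ᶠ B in 𝓝 (_root_.fderiv 𝕜 f a), ∃ A : E ≃L[𝕜] F, (A : E →L[𝕜] F) = B := by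
      rw [hf'.fderiv]
      exact ContinuousLinearEquiv.nhds f'
    exact h1.eventually h2
  obtain ⟨S', hS', hS'o, haS'⟩ := eventually_nhds_iff.1 (hf.and (hinv.and hS))
  let g₀ := hf.contDiffAt.toOpenPartialHomeomorph f hf' hn0
  have hg₀ : a ∈ g₀.source := hf.contDiffAt.mem_toOpenPartialHomeomorph_source hf' hn0
  let g := g₀.restrOpen S' hS'o
  have hgs : ∀ p ∈ g.source, p ∈ S' := fun p hp => hp.2
  refine ⟨g, ⟨hg₀, haS'⟩, fun p hp => (hS' p (hgs p hp)).2.2, fun _ => rfl,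
    fun p hp => (hS' p (hgs p hp)).1, fun q hq => ?_⟩
  obtain ⟨h1, ⟨A, hA⟩, -⟩ := hS' _ (hgs _ (g.map_target hq))
  refine g.contDiffAt_symm (f₀' := A) hq ?_ h1
  rw [hA]
  exact (h1.differentiableAt hn0).hasFDerivAt

/-- The implicit function is `C^n` on a neighbourhood. -/
lemma near_implicitFunction [CompleteSpace E] [CompleteSpace F] [CompleteSpace G] (hn : 1 ≤ n)
    {f : E × F → G} {u : E × F} (hf : ContDiffNear 𝕜 n f u) (hn0 : n ≠ 0)
    (hinv : (_root_.fderiv 𝕜 f u ∘L .inr 𝕜 E F).IsInvertible) :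
    ContDiffNear 𝕜 n (hf.contDiffAt.implicitFunction hn0 hinv) u.1 := by
  set U := hf.contDiffAt.implicitFunction hn0 hinv
  have hU : ContDiffAt 𝕜 n U u.1 := hf.contDiffAt.contDiffAt_implicitFunction hn0 hinv
  have hU0 : U u.1 = u.2 := hf.contDiffAt.implicitFunction_apply_self hn0 hinv
  have hUf : ∀ᶠ x in 𝓝 u.1, f (x, U x) = f u :=
    hf.contDiffAt.eventually_apply_implicitFunction hn0 hinv
  have hT : Filter.Tendsto (fun x => (x, U x)) (𝓝 u.1) (𝓝 u) := by
    have : ContinuousAt (fun x => (x, U x)) u.1 := continuousAt_id.prodMk hU.continuousAt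
    have h := this.tendsto
    rwa [hU0] at h
  have hinv' : ∀ᶠ v in 𝓝 u, (_root_.fderiv 𝕜 f v ∘L .inr 𝕜 E F).IsInvertible := by
    have h1 : ContinuousAt (_root_.fderiv 𝕜 f) u :=
      (hf.contDiffAt.fderiv_right (m := 0) (by simpa using hn)).continuousAt
    have h2 : ContinuousAt (fun v => _root_.fderiv 𝕜 f v ∘L .inr 𝕜 E F) u :=
      h1.clm_comp continuousAt_const
    have h3 : ∀ᶠ B in 𝓝 (_root_.fderiv 𝕜 f u ∘L .inr 𝕜 E F), B.IsInvertible := by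
      obtain ⟨A, hA⟩ := hinv
      rw [← hA]
      exact ContinuousLinearEquiv.nhds A
    exact h2.eventually h3
  filter_upwards [hT.eventually hf, hT.eventually hinv', hUf.eventually_nhds, hUf,
    (hU.of_le hn).eventually (by simp)] with x h1 h2 h3 h4 h5
  -- The equation also has an implicit function based at `(x, U x)`, of class `C^n` at `x`. By local
  -- uniqueness it coincides with `U` near `x`.
  have h6 := h1.eventually_apply_eq_iff_implicitFunction hn0 h2
  refine (h1.contDiffAt_implicitFunction hn0 h2).congr_of_eventuallyEq ?_
  have hT' : Filter.Tendsto (fun y => (y, U y)) (𝓝 x) (𝓝 (x, U x)) :=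
    continuousAt_id.prodMk h5.continuousAt
  filter_upwards [hT'.eventually h6, h3] with y h7 h8
  exact (h7.1 (h8.trans h4.symm)).symm

end Near

end PNO

/-! ### Superposition operators on spaces of continuous maps -/

namespace PNO

noncomputable section Superposition

universe u

variable {𝕜 : Type*} [RCLike 𝕜] {K : Type*} [TopologicalSpace K] [CompactSpace K]
  {E F : Type u} [NormedAddCommGroup E] [NormedSpace 𝕜 E] [NormedAddCommGroup F] [NormedSpace 𝕜 F]

open Classical in
/-- The superposition operator `u ↦ f ∘ u` (with value `0` where `f ∘ u` is not continuous). -/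
def superpose (f : E → F) (u : C(K, E)) : C(K, F) :=
  if h : Continuous fun t => f (u t) then ⟨fun t => f (u t), h⟩ else 0

lemma superpose_apply_of_continuousOn {f : E → F} {O : Set E} (hf : ContinuousOn f O) {u : C(K, E)}
    (hu : ∀ t, u t ∈ O) (t : K) : superpose f u t = f (u t) := by
  have h : Continuous fun t => f (u t) := hf.comp_continuous u.continuous hu
  simp [superpose, h]

lemma isOpen_forall_mem {O : Set E} (hO : IsOpen O) : IsOpen {u : C(K, E) | ∀ t, u t ∈ O} := by
  have := ContinuousMap.isOpen_setOfPred_mapsTo (X := K) isCompact_univ hO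
  simpa [Set.MapsTo] using this

/-- Compactness of the image of `u` gives one `δ` valid for all times `t`. This turns pointwise
continuity into continuity in the sup norm. -/
lemma exists_uniform_close {g : E → F} {O : Set E} (hO : IsOpen O) (hg : ContinuousOn g O)
    {u : C(K, E)} (hu : ∀ t, u t ∈ O) {ε : ℝ} (hε : 0 < ε) :
    ∃ δ > 0, ∀ t z, dist z (u t) < δ → z ∈ O ∧ dist (g z) (g (u t)) < ε := by
  have hc : IsCompact (Set.range u) := isCompact_range u.continuous
  have h1 := hc.uniformContinuousAt_of_continuousAt g
    (by rintro _ ⟨t, rfl⟩; exact hg.continuousAt (hO.mem_nhds (hu t))) (Metric.dist_mem_uniformity hε)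
  obtain ⟨δ₁, h₁, hδ₁⟩ := Metric.mem_uniformity_dist.1 h1
  obtain ⟨δ₂, h₂, hδ₂⟩ := hc.exists_thickening_subset_open hO
    (by rintro _ ⟨t, rfl⟩; exact hu t)
  refine ⟨min δ₁ δ₂, lt_min h₁ h₂, fun t z hz => ⟨hδ₂ ?_, ?_⟩⟩
  · exact Metric.mem_thickening_iff.2 ⟨u t, ⟨t, rfl⟩, hz.trans_le (min_le_right _ _)⟩
  · have := hδ₁ (a := u t) (b := z) (by rw [dist_comm]; exact hz.trans_le (min_le_left _ _)) ⟨t, rfl⟩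
    rw [dist_comm]; exact this

lemma continuousOn_superpose {g : E → F} {O : Set E} (hO : IsOpen O) (hg : ContinuousOn g O) :
    ContinuousOn (superpose g) {u : C(K, E) | ∀ t, u t ∈ O} := by
  intro u hu
  refine ContinuousAt.continuousWithinAt (Metric.continuousAt_iff.2 fun ε hε => ?_)
  obtain ⟨δ, hδ, h⟩ := exists_uniform_close hO hg hu hε
  refine ⟨δ, hδ, fun {w} hw => ?_⟩
  have hw' := (ContinuousMap.dist_lt_iff hδ).1 hw
  rw [ContinuousMap.dist_lt_iff hε]
  intro t
  rw [superpose_apply_of_continuousOn hg (fun s => (h s _ (hw' s)).1),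
    superpose_apply_of_continuousOn hg hu]
  exact (h t _ (hw' t)).2

variable (𝕜 K E F) in
/-- Pointwise application of a continuous family of continuous linear maps. -/
def pointwiseApply : C(K, E →L[𝕜] F) →L[𝕜] C(K, E) →L[𝕜] C(K, F) :=
  LinearMap.mkContinuous₂
    (LinearMap.mk₂ 𝕜 (fun (A : C(K, E →L[𝕜] F)) (v : C(K, E)) =>
      (⟨fun t => A t (v t), A.continuous.clm_apply v.continuous⟩ : C(K, F)))
      (by intros; ext; simp) (by intros; ext; simp) (by intros; ext; simp) (by intros; ext; simp))
    1 (fun A v => by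
      rw [one_mul, ContinuousMap.norm_le _ (by positivity)]
      exact fun t => (A t).le_of_opNorm_le_of_le (A.norm_coe_le_norm t) (v.norm_coe_le_norm t))

lemma pointwiseApply_apply (A : C(K, E →L[𝕜] F)) (v : C(K, E)) (t : K) :
    pointwiseApply 𝕜 K E F A v t = A t (v t) := rfl

/-- The mean value inequality on the ball around `u t`, where `fderiv 𝕜 f` varies by at most `ε`,
bounds the remainder by `ε ‖v‖` uniformly in `t`. The derivative is again pointwise application of a
superposition operator. -/
lemma hasFDerivAt_superpose {f : E → F} {O : Set E} (hO : IsOpen O) (hf : ContDiffOn 𝕜 1 f O)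
    {u : C(K, E)} (hu : ∀ t, u t ∈ O) :
    HasFDerivAt (superpose f) (pointwiseApply 𝕜 K E F (superpose (fderiv 𝕜 f) u)) u := by
  let : NormedSpace ℝ E := NormedSpace.restrictScalars ℝ 𝕜 E
  have hf' : ContinuousOn (fderiv 𝕜 f) O := hf.continuousOn_fderiv_of_isOpen hO le_rfl
  rw [hasFDerivAt_iff_isLittleO_nhds_zero, Asymptotics.isLittleO_iff]
  intro ε hε
  obtain ⟨δ, hδ, h⟩ := exists_uniform_close hO hf' hu hε
  filter_upwards [Metric.ball_mem_nhds 0 hδ] with v hv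
  have hv' : ∀ t, ‖v t‖ < δ := (ContinuousMap.norm_lt_iff v hδ).1 (by simpa using hv)
  rw [ContinuousMap.norm_le _ (by positivity)]
  intro t
  have huv : ∀ t, (u + v) t ∈ O := fun t => (h t _ (by simpa [dist_eq_norm] using hv' t)).1
  rw [ContinuousMap.sub_apply, ContinuousMap.sub_apply, pointwiseApply_apply,
    superpose_apply_of_continuousOn hf.continuousOn huv,
    superpose_apply_of_continuousOn hf.continuousOn hu, superpose_apply_of_continuousOn hf' hu]
  have key := Convex.norm_image_sub_le_of_norm_fderiv_le' (𝕜 := 𝕜) (f := f)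
    (s := Metric.ball (u t) δ) (x := u t) (y := u t + v t) (φ := fderiv 𝕜 f (u t)) (C := ε)
    (fun z hz => (hf.differentiableOn (by simp)).differentiableAt (hO.mem_nhds (h t z hz).1))
    (fun z hz => by rw [← dist_eq_norm]; exact (h t z hz).2.le) (convex_ball _ _)
    (Metric.mem_ball_self hδ) (by simpa [dist_eq_norm] using hv' t)
  rw [add_sub_cancel_left] at key
  refine key.trans ?_
  gcongr
  exact v.norm_coe_le_norm t

/-- Induction on the order, since the derivative of superposition by `f` is built from superposition
by `fderiv 𝕜 f`. The latter takes values in `E →L[𝕜] F`, so the target space must vary in the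
induction. -/
lemma contDiffOn_superpose_nat (m : ℕ) : ∀ {F : Type u} [NormedAddCommGroup F] [NormedSpace 𝕜 F]
    {f : E → F} {O : Set E}, IsOpen O → ContDiffOn 𝕜 m f O →
    ContDiffOn 𝕜 m (superpose f) {u : C(K, E) | ∀ t, u t ∈ O} := by
  induction m with
  | zero =>
    intro F _ _ f O hO hf
    simp only [Nat.cast_zero, contDiffOn_zero] at hf ⊢
    exact continuousOn_superpose hO hf
  | succ m ih =>
    intro F _ _ f O hO hf
    have h1 : ContDiffOn 𝕜 1 f O := hf.of_le (by simp)
    have hd := fun u hu => hasFDerivAt_superpose (K := K) hO h1 (u := u) hu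
    push_cast at hf ⊢
    rw [contDiffOn_succ_iff_fderiv_of_isOpen hO] at hf
    rw [contDiffOn_succ_iff_fderiv_of_isOpen (isOpen_forall_mem hO)]
    refine ⟨fun u hu => (hd u hu).differentiableAt.differentiableWithinAt, by simp, ?_⟩
    refine ((pointwiseApply 𝕜 K E F).contDiff.comp_contDiffOn (ih hO hf.2.2)).congr ?_
    intro u hu
    exact (hd u hu).fderiv

/-- Pointwise application of a continuous multilinear map. -/
def pointwiseMultilinear {n : ℕ} (p : E [×n]→L[𝕜] F) : C(K, E) [×n]→L[𝕜] C(K, F) :=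
  MultilinearMap.mkContinuous
    { toFun := fun v => ⟨fun t => p fun i => v i t,
        p.cont.comp (continuous_pi fun i => (v i).continuous)⟩
      map_update_add' := by
        intro _ v i x y
        ext t
        have (w : C(K, E)) : (fun j => Function.update v i w j t) =
            Function.update (fun j => v j t) i (w t) := by
          ext j; by_cases h : j = i
          · subst h; simp
          · simp [h]
        simp [this]
      map_update_smul' := by
        intro _ v i c x
        ext t
        have (w : C(K, E)) : (fun j => Function.update v i w j t) =
            Function.update (fun j => v j t) i (w t) := by
          ext j; by_cases h : j = i
          · subst h; simp
          · simp [h]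
        simp [this] }
    ‖p‖ (fun v => by
      rw [ContinuousMap.norm_le _ (by positivity)]
      intro t
      refine (p.le_opNorm _).trans ?_
      gcongr with i
      exact (v i).norm_coe_le_norm t)

lemma norm_pointwiseMultilinear_le {n : ℕ} (p : E [×n]→L[𝕜] F) :
    ‖pointwiseMultilinear (K := K) p‖ ≤ ‖p‖ :=
  MultilinearMap.mkContinuous_norm_le _ (norm_nonneg _) _

/-- At a constant path the Taylor coefficients of `f` at the single point `x₀` act pointwise with no
larger norm, so the power series converges in the sup norm on a ball of the same radius. -/
lemma analyticAt_superpose [CompleteSpace F] {f : E → F} {x₀ : E} (hf : AnalyticAt 𝕜 f x₀) :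
    AnalyticAt 𝕜 (superpose f) (ContinuousMap.const K x₀) := by
  obtain ⟨p, r, hp⟩ := hf
  let q : FormalMultilinearSeries 𝕜 C(K, E) C(K, F) := fun n => pointwiseMultilinear (p n)
  refine ⟨q, r, ?_, hp.r_pos, ?_⟩
  · refine hp.r_le.trans (ENNReal.le_of_forall_nnreal_lt fun s hs => ?_)
    refine q.le_radius_of_summable_norm ((p.summable_norm_mul_pow hs).of_nonneg_of_le
      (fun n => by positivity) fun n => ?_)
    gcongr
    exact norm_pointwiseMultilinear_le _
  · intro v hv
    have hv' : ∀ t, v t ∈ Metric.eball (0 : E) r := by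
      intro t
      rw [Metric.mem_eball, edist_zero_right] at hv ⊢
      refine lt_of_le_of_lt ?_ hv
      rw [enorm_le_iff_norm_le]
      exact v.norm_coe_le_norm t
    have hsum : Summable fun n => q n fun _ => v := by
      have : ((‖v‖₊ : NNReal) : ENNReal) < p.radius := by
        refine lt_of_lt_of_le ?_ hp.r_le
        simpa [Metric.mem_eball, edist_zero_right, enorm] using hv
      refine Summable.of_norm_bounded (p.summable_norm_mul_pow this) fun n => ?_
      refine ((q n).le_opNorm _).trans ?_
      simp only [Finset.prod_const, Finset.card_univ, Fintype.card_fin, coe_nnnorm]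
      gcongr
      exact norm_pointwiseMultilinear_le _
    have hval : ∀ t, HasSum (fun n => (q n fun _ => v) t) ((∑' n, q n fun _ => v) t) := fun t =>
      hsum.hasSum.map (ContinuousMap.evalCLM 𝕜 t : C(K, F) →L[𝕜] F) (ContinuousMap.evalCLM 𝕜 t).cont
    have hsup : superpose f (ContinuousMap.const K x₀ + v) = ∑' n, q n fun _ => v := by
      ext t
      rw [superpose_apply_of_continuousOn hp.continuousOn]
      · exact (hp.hasSum (hv' t)).unique (hval t)
      · intro t
        have := hv' t
        simpa [Metric.mem_eball, edist_eq_enorm_sub] using this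
    rw [hsup]
    exact hsum.hasSum

theorem ContDiffNear.superpose [CompleteSpace F] {n : WithTop ℕ∞} {f : E → F} {x₀ : E}
    (hf : ContDiffNear 𝕜 n f x₀) :
    ContDiffNear 𝕜 n (PNO.superpose f) (ContinuousMap.const K x₀) := by
  obtain ⟨O, hfO, hO, hxO⟩ := eventually_nhds_iff.1 hf
  have key : ∀ m : ℕ, (∀ p ∈ O, ContDiffAt 𝕜 m f p) → ∀ u ∈ {u : C(K, E) | ∀ t, u t ∈ O},
      ContDiffAt 𝕜 m (PNO.superpose f) u := fun m hm u hu =>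
    (contDiffOn_superpose_nat m hO fun p hp => (hm p hp).contDiffWithinAt).contDiffAt
      ((isOpen_forall_mem hO).mem_nhds hu)
  have hnhds : {u : C(K, E) | ∀ t, u t ∈ O} ∈ 𝓝 (ContinuousMap.const K x₀) :=
    (isOpen_forall_mem hO).mem_nhds fun _ => hxO
  match n with
  | ω => exact near_of_contDiffAt_omega (analyticAt_superpose hf.contDiffAt.analyticAt).contDiffAt
  | ∞ =>
    filter_upwards [hnhds] with u hu
    exact contDiffAt_infty.2 fun m => key m (fun p hp => contDiffAt_infty.1 (hfO p hp) m) u hu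
  | (m : ℕ) =>
    filter_upwards [hnhds] with u hu
    exact key m hfO u hu

end Superposition

end PNO

/-! ### Local flows depending `C^n` on time and initial value -/

namespace PNO

noncomputable section Flow

open unitInterval

variable {𝕜 : Type*} [RCLike 𝕜] {E : Type*} [NormedAddCommGroup E] [NormedSpace 𝕜 E]

/-- A continuous map on the unit interval, extended to the line by constants. -/
def extendLine (u : C(I, E)) : ℝ → E := Set.IccExtend zero_le_one u

lemma continuous_extendLine (u : C(I, E)) : Continuous (extendLine u) :=
  u.continuous.Icc_extend' (h := zero_le_one)

lemma extendLine_coe (u : C(I, E)) (t : I) : extendLine u t = u t :=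
  Set.IccExtend_val _ _ _

lemma norm_extendLine_le (u : C(I, E)) (t : ℝ) : ‖extendLine u t‖ ≤ ‖u‖ :=
  u.norm_coe_le_norm _

section Volterra

variable [NormedSpace ℝ E] [IsScalarTower ℝ 𝕜 E]

variable (𝕜 E) in
/-- The Volterra operator `u ↦ ∫₀ᵗ u`. -/
def volterra : C(I, E) →L[𝕜] C(I, E) :=
  LinearMap.mkContinuous
    { toFun := fun u => ⟨fun t => ∫ τ in (0 : ℝ)..t, extendLine u τ,
        (intervalIntegral.continuous_primitive (fun _ _ =>
          (continuous_extendLine u).intervalIntegrable _ _) 0).comp continuous_subtype_val⟩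
      map_add' := by
        intro u v
        ext t
        exact intervalIntegral.integral_add ((continuous_extendLine u).intervalIntegrable _ _)
          ((continuous_extendLine v).intervalIntegrable _ _)
      map_smul' := by
        intro c u
        ext t
        exact intervalIntegral.integral_smul c (extendLine u) }
    1 (fun u => by
      rw [one_mul, ContinuousMap.norm_le _ (norm_nonneg _)]
      intro t
      have := intervalIntegral.norm_integral_le_of_norm_le_const (a := 0) (b := (t : ℝ))
        (fun τ _ => norm_extendLine_le u τ)
      refine this.trans (mul_le_of_le_one_right (norm_nonneg _) ?_)
      rw [sub_zero, abs_of_nonneg t.2.1]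
      exact t.2.2)

lemma volterra_apply (u : C(I, E)) (t : I) :
    volterra 𝕜 E u t = ∫ τ in (0 : ℝ)..t, extendLine u τ := rfl

end Volterra

variable (𝕜 E) in
/-- Constant maps, as a continuous linear map. -/
def constPath : E →L[𝕜] C(I, E) :=
  LinearMap.mkContinuous
    { toFun := fun x => ContinuousMap.const I x
      map_add' := fun _ _ => rfl
      map_smul' := fun _ _ => rfl } 1
    (fun x => by
      rw [one_mul, ContinuousMap.norm_le _ (norm_nonneg _)]
      exact fun _ => le_rfl)

lemma constPath_apply (x : E) : constPath 𝕜 E x = ContinuousMap.const I x := rfl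

/-- Change of variables in the integral: if `u` solves the integral equation with factor `s`, the
slowed path `τ ↦ u (t τ)` solves it with factor `t s`. -/
lemma smul_integral_comp_mul_eq [NormedSpace ℝ E] [IsScalarTower ℝ 𝕜 E] {V : E → E} {O : Set E}
    (hV : ContinuousOn V O) {u w : C(I, E)} (hu : ∀ t, u t ∈ O) {t : I} (hw : ∀ τ, w τ = u (t * τ))
    (τ : I) : (t : ℝ) • volterra 𝕜 E (superpose V w) τ = volterra 𝕜 E (superpose V u) (t * τ) := by
  have hwO : ∀ τ, w τ ∈ O := fun τ => by rw [hw]; exact hu _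
  rw [volterra_apply, volterra_apply]
  have h := intervalIntegral.smul_integral_comp_mul_left (a := 0) (b := τ)
    (extendLine (superpose V u)) (t : ℝ)
  rw [mul_zero] at h
  refine Eq.trans ?_ h
  congr 1
  refine intervalIntegral.integral_congr fun ρ hρ => ?_
  rw [Set.uIcc_of_le τ.2.1] at hρ
  have hρ' : ρ ∈ I := ⟨hρ.1, hρ.2.trans τ.2.2⟩
  have e1 := extendLine_coe (superpose V w) ⟨ρ, hρ'⟩
  have e2 := extendLine_coe (superpose V u) (t * ⟨ρ, hρ'⟩)
  change extendLine (superpose V w) ρ = _ at e1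
  change extendLine (superpose V u) ((t : ℝ) * ρ) = _ at e2
  change extendLine (superpose V w) ρ = extendLine (superpose V u) ((t : ℝ) * ρ)
  rw [e1, e2, superpose_apply_of_continuousOn hV hwO, superpose_apply_of_continuousOn hV hu, hw]

/-- A radially scaled family `t ↦ Φ (t s, x)` of integral curves of `s V` has the right
derivative. -/
lemma smul_fderiv_eq_of_path [CompleteSpace E] [NormedSpace ℝ E] [IsScalarTower ℝ 𝕜 E]
    {Φ : 𝕜 × E → E} {s : 𝕜}
    {x : E} (hΦ : DifferentiableAt 𝕜 Φ (s, x)) {g : C(I, E)}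
    (h : ∀ t : I, Φ ((t : ℝ) • s, x) = x + s • volterra 𝕜 E g t) :
    s • fderiv 𝕜 Φ (s, x) (1, 0) = s • g 1 := by
  -- The derivative at `t = 1` is computed twice, by the fundamental theorem of calculus and by the
  -- chain rule. The formula is known only for `t ≤ 1`, hence derivatives within `[0, 1]`.
  have h1 : HasDerivWithinAt (fun t : ℝ => Φ (t • s, x)) (s • g 1) (Set.Icc 0 1) 1 := by
    have hd : HasDerivAt (fun t : ℝ => ∫ τ in (0 : ℝ)..t, extendLine g τ) (g 1) 1 := by
      have := intervalIntegral.integral_hasDerivAt_right (a := 0) (b := 1) (f := extendLine g)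
        ((continuous_extendLine g).intervalIntegrable _ _)
        ((continuous_extendLine g).stronglyMeasurableAtFilter _ _)
        (continuous_extendLine g).continuousAt
      have e := extendLine_coe g 1
      rw [show ((1 : I) : ℝ) = 1 from rfl] at e
      rwa [e] at this
    refine (((hd.const_smul s).const_add x).hasDerivWithinAt).congr ?_ ?_
    · exact fun t ht => h ⟨t, ht⟩
    · exact h 1
  have h2 : HasDerivWithinAt (fun t : ℝ => Φ (t • s, x)) (fderiv 𝕜 Φ (s, x) (s, 0))
      (Set.Icc 0 1) 1 := by
    have hp : HasDerivAt (fun t : ℝ => ((t • s, x) : 𝕜 × E)) (s, 0) 1 := by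
      have := (hasDerivAt_id (1 : ℝ)).smul_const s
      rw [one_smul] at this
      exact this.prodMk (hasDerivAt_const _ _)
    have hΦ' := hΦ.hasFDerivAt.restrictScalars ℝ
    have hΦ'' : HasFDerivAt Φ ((fderiv 𝕜 Φ (s, x)).restrictScalars ℝ) ((1 : ℝ) • s, x) := by
      rwa [one_smul]
    exact (hΦ''.comp_hasDerivAt (1 : ℝ) hp).hasDerivWithinAt
  have h3 := (uniqueDiffOn_Icc (zero_lt_one' ℝ) 1 (by simp)).eq_deriv _ h1 h2
  rw [h3, ← map_smul]
  simp

/-- Existence of the local flow of a `C^n` vector field, as a `C^n` map. -/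
theorem exists_flow [CompleteSpace E] {n : WithTop ℕ∞} (hn : 1 ≤ n) {V : E → E} {x₀ : E}
    (hV : ContDiffNear 𝕜 n V x₀) :
    ∃ Φ : 𝕜 × E → E, ContDiffNear 𝕜 n Φ (0, x₀) ∧ (∀ᶠ x in 𝓝 x₀, Φ (0, x) = x) ∧
      ∀ᶠ q in 𝓝 ((0 : 𝕜), x₀), fderiv 𝕜 Φ q (1, 0) = V (Φ q) := by
  let : NormedSpace ℝ E := NormedSpace.restrictScalars ℝ 𝕜 E
  have hn0 : n ≠ 0 := by rintro rfl; simp at hn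
  let c₀ : C(I, E) := ContinuousMap.const I x₀
  -- A zero of `G` is a solution of `u = x + s ∫ V(u)`, that is, an integral curve of `s V` from
  -- `x`. Time enters as the factor `s`, so the path space is fixed and `s` may be complex. The flow
  -- is the value of `u` at `1`.
  let G : (𝕜 × E) × C(I, E) → C(I, E) := fun q =>
    q.2 - constPath 𝕜 E q.1.2 - q.1.1 • volterra 𝕜 E (superpose V q.2)
  let p₀ : (𝕜 × E) × C(I, E) := ((0, x₀), c₀)
  have hGn : ContDiffNear 𝕜 n G p₀ := by
    have h2 : ContDiffNear 𝕜 n (fun q : (𝕜 × E) × C(I, E) => superpose V q.2) p₀ :=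
      hV.superpose.comp (ContDiff.near contDiff_snd) rfl
    have h3 : ContDiffNear 𝕜 n (fun q : (𝕜 × E) × C(I, E) => volterra 𝕜 E (superpose V q.2)) p₀ :=
      (ContDiff.near (volterra 𝕜 E).contDiff).comp h2 rfl
    have h4 : ContDiffNear 𝕜 n (fun q : (𝕜 × E) × C(I, E) => constPath 𝕜 E q.1.2) p₀ :=
      ContDiff.near ((constPath 𝕜 E).contDiff.comp (by fun_prop))
    exact ((ContDiff.near contDiff_snd).sub h4).sub ((ContDiff.near (by fun_prop)).smul h3)
  have hG := hGn.contDiffAt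
  have hG0 : G p₀ = 0 := by simp [G, p₀, c₀, constPath_apply]
  -- The integral term carries the factor `s`, which is zero at `p₀`, so the partial derivative in
  -- the path is the identity.
  have hinv : (fderiv 𝕜 G p₀ ∘L .inr 𝕜 (𝕜 × E) C(I, E)).IsInvertible := by
    have h1 : HasFDerivAt (fun w : C(I, E) => G ((0, x₀), w))
        (fderiv 𝕜 G p₀ ∘L .inr 𝕜 (𝕜 × E) C(I, E)) c₀ :=
      HasFDerivAt.comp (g := G) (f := fun w => ((0, x₀), w)) c₀
        (hG.differentiableAt hn0).hasFDerivAt (hasFDerivAt_prodMk_right _ _)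
    have h2 : HasFDerivAt (fun w : C(I, E) => G ((0, x₀), w)) (.id 𝕜 C(I, E)) c₀ := by
      have : (fun w : C(I, E) => G ((0, x₀), w)) = fun w => w - constPath 𝕜 E x₀ := by
        ext w; simp [G]
      rw [this]
      exact (hasFDerivAt_id _).sub_const _
    rw [h1.unique h2]
    exact ⟨.refl 𝕜 _, rfl⟩
  let U := hG.implicitFunction hn0 hinv
  have hUn : ContDiffNear 𝕜 n U (0, x₀) := near_implicitFunction hn hGn hn0 hinv
  have hU := hUn.contDiffAt
  have hU0 : U (0, x₀) = c₀ := hG.implicitFunction_apply_self hn0 hinv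
  have hUG : ∀ᶠ q in 𝓝 ((0 : 𝕜), x₀), G (q, U q) = 0 := by
    simpa only [hG0] using hG.eventually_apply_implicitFunction hn0 hinv
  have hiff : ∀ᶠ v in 𝓝 p₀, G v = 0 ↔ U v.1 = v.2 := by
    simpa only [hG0] using hG.eventually_apply_eq_iff_implicitFunction hn0 hinv
  let Φ : 𝕜 × E → E := fun q => U q 1
  have hΦn : ContDiffNear 𝕜 n Φ (0, x₀) :=
    (ContDiff.near (ContinuousMap.evalCLM 𝕜 (1 : I) : C(I, E) →L[𝕜] E).contDiff).comp hUn rfl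
  have hΦ := hΦn.contDiffAt
  obtain ⟨O', hO', hVO'⟩ := (hV.contDiffAt.of_le hn).contDiffOn le_rfl (by simp)
  obtain ⟨O, hOO', hO, hxO⟩ := mem_nhds_iff.1 hO'
  have hVO : ContinuousOn V O := (hVO'.mono hOO').continuousOn
  have hUO : ∀ᶠ q in 𝓝 ((0 : 𝕜), x₀), ∀ t, U q t ∈ O :=
    hU.continuousAt.eventually_mem ((isOpen_forall_mem hO).mem_nhds (by
      rw [hU0]; exact fun _ => hxO))
  have hfix : ∀ᶠ q in 𝓝 ((0 : 𝕜), x₀), ∀ t : I, U q t = q.2 + q.1 • volterra 𝕜 E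
      (superpose V (U q)) t := by
    filter_upwards [hUG] with q hq t
    have := congrArg (fun w : C(I, E) => w t) hq
    simp only [G, ContinuousMap.sub_apply, constPath_apply,
      ContinuousMap.zero_apply, sub_sub, sub_eq_zero] at this
    exact this
  obtain ⟨ε, hε, hball⟩ := Metric.eventually_nhds_iff_ball.1 hiff
  have hnear : ∀ᶠ q in 𝓝 ((0 : 𝕜), x₀), dist (U q) c₀ < ε := by
    have := hU.continuousAt.eventually_mem (Metric.ball_mem_nhds (U (0, x₀)) hε)
    rwa [hU0] at this
  -- The rescaled path solves the equation for `t s` and stays near the constant path, so local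
  -- uniqueness identifies it with the implicit solution there. Hence the path `U (s, x)` is itself
  -- the flow along the segment from `0` to `s`.
  have hrad : ∀ᶠ q in 𝓝 ((0 : 𝕜), x₀), ∀ t : I, Φ ((t : ℝ) • q.1, q.2) = U q t := by
    filter_upwards [hfix, hUO, hnear, Metric.ball_mem_nhds _ hε] with q hq hqO hqc hqε t
    let w : C(I, E) := ⟨fun τ => U q (t * τ), (U q).continuous.comp (by fun_prop)⟩
    have hwc : dist w c₀ < ε := (ContinuousMap.dist_lt_iff hε).2 fun τ =>
      (ContinuousMap.dist_lt_iff hε).1 hqc (t * τ)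
    have hmem : (((t : ℝ) • q.1, q.2), w) ∈ Metric.ball p₀ ε := by
      rw [Metric.mem_ball, Prod.dist_eq] at hqε ⊢
      rw [max_lt_iff] at hqε
      rw [Prod.dist_eq]
      refine max_lt (max_lt (lt_of_le_of_lt ?_ hqε.1) hqε.2) hwc
      simp only [dist_zero_right, p₀, norm_smul, Real.norm_eq_abs, abs_of_nonneg t.2.1]
      exact mul_le_of_le_one_left (norm_nonneg _) t.2.2
    have hGw : G (((t : ℝ) • q.1, q.2), w) = 0 := by
      ext τ
      have h1 := smul_integral_comp_mul_eq (𝕜 := 𝕜) hVO hqO (w := w) (t := t) (fun _ => rfl) τ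
      simp only [G, ContinuousMap.sub_apply, ContinuousMap.smul_apply, constPath_apply,
        ContinuousMap.const_apply, ContinuousMap.zero_apply]
      rw [smul_assoc, smul_comm, h1, show w τ = U q (t * τ) from rfl, hq]
      abel
    have := (hball _ hmem).1 hGw
    change U ((t : ℝ) • q.1, q.2) 1 = _
    rw [this]
    change U q (t * 1) = _
    rw [mul_one]
  have hderiv : ∀ᶠ q in 𝓝 ((0 : 𝕜), x₀),
      q.1 • fderiv 𝕜 Φ q (1, 0) = q.1 • V (Φ q) := by
    have hd : ∀ᶠ q in 𝓝 ((0 : 𝕜), x₀), DifferentiableAt 𝕜 Φ q :=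
      ((hΦ.of_le hn).eventually (by simp)).mono fun q hq => hq.differentiableAt (by simp)
    filter_upwards [hd, hrad, hfix, hUO] with q hq hr hf hO'
    have := smul_fderiv_eq_of_path (s := q.1) (x := q.2) hq (g := superpose V (U q))
      (fun t => by rw [hr, hf])
    rw [superpose_apply_of_continuousOn hVO hO'] at this
    exact this
  refine ⟨Φ, hΦn, ?_, ?_⟩
  · have := (Continuous.prodMk_right (0 : 𝕜)).continuousAt (x := x₀) |>.eventually hfix
    filter_upwards [this] with x hx
    simpa [Φ] using hx 1
  -- The flow equation is known only after multiplication by `s`. It holds for `s ≠ 0` by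
  -- cancellation and at `s = 0` by continuity.
  · have hc : ∀ᶠ q in 𝓝 ((0 : 𝕜), x₀), ContinuousAt (fun q => fderiv 𝕜 Φ q (1, 0) - V (Φ q)) q := by
      have hV1 : ∀ᶠ q in 𝓝 ((0 : 𝕜), x₀), ContinuousAt V (Φ q) := by
        have h0 : Φ (0, x₀) = x₀ := by simp [Φ, hU0, c₀]
        have h1 : ∀ᶠ y in 𝓝 (Φ (0, x₀)), ContinuousAt V y := by
          rw [h0]
          exact ((hV.contDiffAt.of_le hn).eventually (by simp)).mono fun q hq => hq.continuousAt
        exact hΦ.continuousAt.eventually h1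
      filter_upwards [(hΦ.of_le hn).eventually (by simp), hV1] with q hq hVq
      have h1 : ContinuousAt (fderiv 𝕜 Φ) q := (hq.fderiv_right (m := 0) (by simp)).continuousAt
      exact (h1.clm_apply continuousAt_const).sub
        (ContinuousAt.comp (f := Φ) (g := V) hVq hq.continuousAt)
    obtain ⟨W, hW, hWo, hW0⟩ := eventually_nhds_iff.1 (hc.and hderiv)
    refine eventually_nhds_iff.2 ⟨W, fun q hq => ?_, hWo, hW0⟩
    by_cases hs : q.1 = 0
    · have hcq := (hW q hq).1
      have h1 : Filter.Tendsto (fun s : 𝕜 => (s, q.2)) (𝓝[≠] 0) (𝓝 q) := by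
        have : Continuous fun s : 𝕜 => (s, q.2) := by fun_prop
        have h := this.tendsto 0
        rw [← hs] at h
        exact h.mono_left (by rw [hs]; exact nhdsWithin_le_nhds)
      have h2 := hcq.tendsto.comp h1
      have h3 : Filter.Tendsto ((fun q => fderiv 𝕜 Φ q (1, 0) - V (Φ q)) ∘ fun s : 𝕜 => (s, q.2))
          (𝓝[≠] 0) (𝓝 0) := by
        refine tendsto_const_nhds.congr' ?_
        filter_upwards [h1.eventually (hWo.mem_nhds hq), self_mem_nhdsWithin] with s hsW hs0
        have := (hW _ hsW).2
        exact (sub_eq_zero.2 (smul_right_injective E hs0 this)).symm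
      exact sub_eq_zero.1 (tendsto_nhds_unique h2 h3)
    · exact smul_right_injective E hs (hW q hq).2

end Flow

end PNO

/-! ### Straightening a vector field and the Frobenius theorem for two vector fields -/

namespace PNO

noncomputable section Frobenius

open VectorField

variable {𝕜 : Type*} [RCLike 𝕜] {E : Type*} [NormedAddCommGroup E] [NormedSpace 𝕜 E]
  [CompleteSpace E] {n : WithTop ℕ∞}

lemma two_le_of_infty_le (hn : ∞ ≤ n) : 2 ≤ n :=
  le_trans (WithTop.coe_le_coe.2 (le_top (a := (2 : ℕ∞)))) hn

lemma add_one_le_of_infty_le (hn : ∞ ≤ n) : n + 1 ≤ n := by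
  match n, hn with
  | ω, _ => exact le_rfl
  | ∞, _ => exact le_rfl
  | (m : ℕ), h => exact absurd h (not_le.2 (WithTop.coe_lt_coe.2 (ENat.natCast_lt_top m)))

/-- Asking for identity derivatives on both sides lets a covector at the base point be used
unchanged in the new coordinates. -/
lemma exists_localInverse_of_hasFDerivAt_id (hn : 1 ≤ n) {Φ : E → E} {a : E}
    (hΦ : ContDiffNear 𝕜 n Φ a) (hd : HasFDerivAt Φ (.id 𝕜 E) a) :
    ∃ Ψ : E → E, ContDiffNear 𝕜 n Ψ (Φ a) ∧ Ψ (Φ a) = a ∧ HasFDerivAt Ψ (.id 𝕜 E) (Φ a) ∧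
      (∀ᶠ p in 𝓝 (Φ a), Φ (Ψ p) = p) ∧ ∀ᶠ v in 𝓝 a, Ψ (Φ v) = v := by
  have hd' : HasFDerivAt Φ ((ContinuousLinearEquiv.refl 𝕜 E : E ≃L[𝕜] E) : E →L[𝕜] E) a := hd
  obtain ⟨g, hag, -, hg, -, hgs⟩ := exists_local_diffeomorph hn hΦ hd' Filter.univ_mem
  have ht : ∀ᶠ p in 𝓝 (Φ a), p ∈ g.target := by
    rw [← hg]
    exact g.open_target.mem_nhds (g.map_source hag)
  have hga : g.symm (Φ a) = a := by rw [← hg, g.left_inv hag]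
  refine ⟨g.symm, ht.mono hgs, hga, ?_, ?_, ?_⟩
  · have := g.hasFDerivAt_symm (f' := ContinuousLinearEquiv.refl 𝕜 E) ht.self_of_nhds (by
      rw [hga]
      exact hd'.congr_of_eventuallyEq (Filter.Eventually.of_forall hg))
    exact this
  · filter_upwards [ht] with p hp
    rw [← hg, g.right_inv hp]
  · filter_upwards [g.open_source.mem_nhds hag] with v hv
    rw [← hg, g.left_inv hv]

/-- A nonvanishing vector field is constant in suitable coordinates. -/
lemma exists_straightening (hn : 1 ≤ n) {V : E → E} {p₀ : E} (hV : ContDiffNear 𝕜 n V p₀)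
    (η : E →L[𝕜] 𝕜) (hη : η (V p₀) = 1) :
    ∃ Φ : E → E, ContDiffNear 𝕜 n Φ 0 ∧ Φ 0 = p₀ ∧ HasFDerivAt Φ (.id 𝕜 E) 0 ∧
      ∀ᶠ v in 𝓝 0, fderiv 𝕜 Φ v (V p₀) = V (Φ v) := by
  have hn0 : n ≠ 0 := by rintro rfl; simp at hn
  obtain ⟨Φ, hΦn, hΦ0, hΦd⟩ := exists_flow hn hV
  have hΦ := hΦn.contDiffAt
  -- The vector `v` is split into a time `η v` and a point of the slice `ker η`. Flowing that point
  -- for that time turns the direction `V p₀` into the time direction.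
  let L : E →L[𝕜] 𝕜 × E := η.prod (.id 𝕜 E - η.smulRight (V p₀))
  let θ : E → 𝕜 × E := fun v => (0, p₀) + L v
  have hθ : ∀ v, HasFDerivAt θ L v := fun v => L.hasFDerivAt.const_add _
  have hθc : ContDiff 𝕜 n θ := contDiff_const.add L.contDiff
  have hθ0 : θ 0 = (0, p₀) := by simp [θ]
  have hLV : L (V p₀) = (1, 0) := by simp [L, hη]
  have hΦ' : ContDiffAt 𝕜 n Φ (θ 0) := by rwa [hθ0]
  refine ⟨Φ ∘ θ, hΦn.comp (ContDiff.near hθc) hθ0, ?_, ?_, ?_⟩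
  · rw [Function.comp_apply, hθ0]
    exact hΦ0.self_of_nhds
  · have h1 := (hΦ'.differentiableAt hn0).hasFDerivAt.comp 0 (hθ 0)
    convert h1 using 1
    rw [hθ0]
    ext v
    have h2 : fderiv 𝕜 Φ (0, p₀) (1, 0) = V p₀ := by
      rw [hΦd.self_of_nhds, hΦ0.self_of_nhds]
    have h3 : ∀ w, fderiv 𝕜 Φ (0, p₀) (0, w) = w := by
      intro w
      have e1 : HasFDerivAt (fun x => Φ (0, x)) (fderiv 𝕜 Φ (0, p₀) ∘L .inr 𝕜 𝕜 E) p₀ :=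
        HasFDerivAt.comp (g := Φ) (f := fun x => ((0 : 𝕜), x)) p₀
          (hΦ.differentiableAt hn0).hasFDerivAt (hasFDerivAt_prodMk_right _ _)
      have e2 : HasFDerivAt (fun x => Φ (0, x)) (.id 𝕜 E) p₀ :=
        (hasFDerivAt_id p₀).congr_of_eventuallyEq hΦ0
      have := congrArg (fun A : E →L[𝕜] E => A w) (e1.unique e2)
      simpa using this
    have h4 : L v = η v • ((1 : 𝕜), (0 : E)) + (0, v - η v • V p₀) := by simp [L]
    rw [ContinuousLinearMap.comp_apply, h4, map_add, map_smul, h2, h3]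
    simp
  · have hev : ∀ᶠ v in 𝓝 (0 : E), fderiv 𝕜 Φ (θ v) (1, 0) = V (Φ (θ v)) := by
      have : Filter.Tendsto θ (𝓝 0) (𝓝 (0, p₀)) := by
        have := hθc.continuous.tendsto 0
        rwa [hθ0] at this
      exact this.eventually hΦd
    have hdiff : ∀ᶠ v in 𝓝 (0 : E), DifferentiableAt 𝕜 Φ (θ v) := by
      have h : ∀ᶠ q in 𝓝 (θ 0), DifferentiableAt 𝕜 Φ q :=
        ((hΦ'.of_le hn).eventually (by simp)).mono fun q hq => hq.differentiableAt (by simp)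
      exact hθc.continuous.continuousAt.eventually h
    filter_upwards [hev, hdiff] with v hv hdv
    rw [(hdv.hasFDerivAt.comp v (hθ v)).fderiv, ContinuousLinearMap.comp_apply, hLV, hv]
    rfl

/-- A covector annihilating `V p₀ ≠ 0` is the differential at `p₀` of a first integral of `V`. -/
lemma exists_firstIntegral (hn : 1 ≤ n) {V : E → E} {p₀ : E} (hV : ContDiffNear 𝕜 n V p₀)
    (hV0 : V p₀ ≠ 0) (ℓ : E →L[𝕜] 𝕜) (hℓ : ℓ (V p₀) = 0) :
    ∃ f : E → 𝕜, ContDiffNear 𝕜 n f p₀ ∧ fderiv 𝕜 f p₀ = ℓ ∧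
      ∀ᶠ p in 𝓝 p₀, fderiv 𝕜 f p (V p) = 0 := by
  have hn0 : n ≠ 0 := by rintro rfl; simp at hn
  obtain ⟨η, hη⟩ := SeparatingDual.exists_eq_one (R := 𝕜) hV0
  obtain ⟨Φ, hΦ, hΦ0, hΦid, hΦV⟩ := exists_straightening hn hV η hη
  obtain ⟨Ψ, hΨ, hΨ0, hΨid, hΦΨ, hΨΦ⟩ := exists_localInverse_of_hasFDerivAt_id hn hΦ hΦid
  rw [hΦ0] at hΨ hΨ0 hΨid hΦΨ
  -- In the coordinates `Ψ` the field is the constant vector `V p₀`, which the linear function `ℓ`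
  -- annihilates.
  refine ⟨fun p => ℓ (Ψ p), (ContDiff.near ℓ.contDiff).comp hΨ rfl, ?_, ?_⟩
  · exact (ℓ.hasFDerivAt.comp p₀ hΨid).fderiv
  · have hdΨ : ∀ᶠ p in 𝓝 p₀, DifferentiableAt 𝕜 Ψ p :=
      hΨ.differentiableAt hn0
    have hdΦ : ∀ᶠ v in 𝓝 (0 : E), DifferentiableAt 𝕜 Φ v :=
      hΦ.differentiableAt hn0
    have hT : Filter.Tendsto Ψ (𝓝 p₀) (𝓝 0) := by
      have := hΨ.continuousAt.tendsto
      rwa [hΨ0] at this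
    filter_upwards [hdΨ, hT.eventually hdΦ, hT.eventually hΦV, hT.eventually hΨΦ.eventually_nhds,
      hΦΨ] with p h1 h2 h3 h4 h5
    have hc := (h5.symm ▸ h1 : DifferentiableAt 𝕜 Ψ (Φ (Ψ p))).hasFDerivAt.comp (Ψ p) h2.hasFDerivAt
    have hid : HasFDerivAt (Ψ ∘ Φ) (.id 𝕜 E) (Ψ p) := (hasFDerivAt_id _).congr_of_eventuallyEq h4
    have he := congrArg (fun A : E →L[𝕜] E => A (V p₀)) (hc.unique hid)
    simp only [ContinuousLinearMap.comp_apply, h3, h5, ContinuousLinearMap.id_apply] at he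
    have hfd : fderiv 𝕜 (fun p => ℓ (Ψ p)) p = ℓ ∘L fderiv 𝕜 Ψ p :=
      (ℓ.hasFDerivAt.comp p h1.hasFDerivAt).fderiv
    rw [hfd, ContinuousLinearMap.comp_apply, he, hℓ]

/-- If `P W` satisfies a linear homogeneous equation along the lines in the direction `e = V p₀`,
then a functional vanishing on `P W` at one point of such a segment vanishes at the other end. -/
lemma eq_zero_along_segment {W : E → E} {S : Set E} {a v e : E} {s : 𝕜} {m : E →L[𝕜] 𝕜} {K : ℝ}
    (hv : v = a + s • e) (hS : ∀ t ∈ Set.Icc (0 : ℝ) 1, a + ((t : 𝕜) * s) • e ∈ S)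
    (hW : ∀ q ∈ S, DifferentiableAt 𝕜 W q)
    (hb : ∀ q ∈ S, ∃ b : 𝕜, ‖b‖ ≤ K ∧ m (fderiv 𝕜 W q e) = b * m (W q))
    (h0 : m (W a) = 0) : m (W v) = 0 := by
  let γ : ℝ → E := fun t => a + ((t : 𝕜) * s) • e
  let g : 𝕜 → 𝕜 := fun c => m (W (a + (c * s) • e))
  have hg : ∀ t ∈ Set.Icc (0 : ℝ) 1, HasDerivAt (fun t : ℝ => g (t : 𝕜))
      (s * m (fderiv 𝕜 W (γ t) e)) t := by
    intro t ht
    have h1 : HasDerivAt (fun c : 𝕜 => a + (c * s) • e) (s • e) (t : 𝕜) := by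
      have := (((hasDerivAt_id (t : 𝕜)).mul_const s).smul_const e).const_add a
      simpa using this
    have h2 : HasDerivAt g (m (fderiv 𝕜 W (γ t) (s • e))) (t : 𝕜) :=
      m.hasFDerivAt.comp_hasDerivAt (t : 𝕜)
        ((hW _ (hS t ht)).hasFDerivAt.comp_hasDerivAt (t : 𝕜) h1)
    rw [map_smul, map_smul, smul_eq_mul] at h2
    have h3 : HasDerivAt (fun t : ℝ => (t : 𝕜)) 1 t := by
      simpa using (RCLike.ofRealCLM (K := 𝕜)).hasDerivAt (x := t)
    have h4 := HasDerivAt.scomp (𝕜 := ℝ) (𝕜' := 𝕜) t h2 h3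
    rw [one_smul] at h4
    exact h4
  -- Grönwall: the function along the segment starts at zero and its derivative is bounded by a
  -- constant times its value. Only a bound on `b` is needed, not continuity.
  have := eq_zero_of_abs_deriv_le_mul_abs_self_of_eq_zero_right (a := 0) (b := 1)
    (f := fun t : ℝ => g (t : 𝕜)) (f' := fun t => s * m (fderiv 𝕜 W (γ t) e)) (K := ‖s‖ * K)
    (fun t ht => (hg t ht).continuousAt.continuousWithinAt)
    (fun t ht => (hg t ⟨ht.1, ht.2.le⟩).hasDerivWithinAt)
    (by simpa [g] using h0)
    (fun t ht => by
      obtain ⟨b, hbK, hbe⟩ := hb _ (hS t ⟨ht.1, ht.2.le⟩)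
      change ‖s * m (fderiv 𝕜 W (γ t) e)‖ ≤ ‖s‖ * K * ‖m (W (γ t))‖
      rw [hbe, norm_mul, norm_mul, mul_assoc]
      gcongr) 1 (by simp)
  simpa [g, hv] using this

/-- **Frobenius theorem** for two vector fields: a covector annihilating both at `p₀` is the
differential of a common first integral. -/
theorem exists_common_firstIntegral (hn : ∞ ≤ n) {Y Z : E → E} {p₀ : E}
    (hY : ContDiffNear 𝕜 n Y p₀) (hZ : ContDiffNear 𝕜 n Z p₀)
    (hind : LinearIndependent 𝕜 ![Y p₀, Z p₀])
    (hinv : ∀ᶠ p in 𝓝 p₀, ∃ a b : 𝕜, lieBracket 𝕜 Y Z p = a • Y p + b • Z p)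
    (ℓ : E →L[𝕜] 𝕜) (hℓY : ℓ (Y p₀) = 0) (hℓZ : ℓ (Z p₀) = 0) :
    ∃ f : E → 𝕜, ContDiffNear 𝕜 n f p₀ ∧ fderiv 𝕜 f p₀ = ℓ ∧
      ∀ᶠ p in 𝓝 p₀, fderiv 𝕜 f p (Y p) = 0 ∧ fderiv 𝕜 f p (Z p) = 0 := by
  have hn2 : 2 ≤ n := two_le_of_infty_le hn
  have hn1 : 1 ≤ n := le_trans (by norm_num) hn2
  have hnn : n + 1 ≤ n := add_one_le_of_infty_le hn
  have hn0 : n ≠ 0 := by rintro rfl; simp at hn1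
  rw [LinearIndependent.pair_iff] at hind
  have hY0 : Y p₀ ≠ 0 := fun h => by simpa using (hind 1 0 (by simp [h])).1
  obtain ⟨η, hη⟩ := SeparatingDual.exists_eq_one (R := 𝕜) hY0
  obtain ⟨Φ, hΦ, hΦ0, hΦid, hΦY⟩ := exists_straightening hn1 hY η hη
  obtain ⟨Ψ, hΨ, hΨ0, hΨid, hΦΨ, hΨΦ⟩ := exists_localInverse_of_hasFDerivAt_id hn1 hΦ hΦid
  rw [hΦ0] at hΨ hΨ0 hΨid hΦΨ
  set e := Y p₀ with he
  -- `P` is the projection onto the slice `ker η` along `e`, the constant value of the straightened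
  -- field `Y`.
  let P : E →L[𝕜] E := .id 𝕜 E - η.smulRight e
  have hP : ∀ v, P v = v - η v • e := fun v => rfl
  have hPe : P e = 0 := by simp [hP, hη]
  have hPP : ∀ v, P (P v) = P v := by
    intro v
    rw [hP v, map_sub, map_smul, hPe, smul_zero, sub_zero, hP]
  -- the second field in the straightened coordinates
  let Zt : E → E := pullback 𝕜 Φ Z
  have hZt0 : Zt 0 = Z p₀ := by
    simp only [Zt, pullback, hΦid.fderiv, hΦ0]
    simp
  have hT : Filter.Tendsto Φ (𝓝 0) (𝓝 p₀) := by
    have := hΦ.continuousAt.tendsto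
    rwa [hΦ0] at this
  have hinvert : ∀ᶠ v in 𝓝 (0 : E), (fderiv 𝕜 Φ v).IsInvertible := by
    have h1 : ContinuousAt (fderiv 𝕜 Φ) 0 :=
      (hΦ.contDiffAt.fderiv_right (m := 0) (by simpa using hn1)).continuousAt
    have h2 : ∀ᶠ B in 𝓝 (fderiv 𝕜 Φ 0), B.IsInvertible := by
      rw [hΦid.fderiv]
      exact ContinuousLinearEquiv.nhds (ContinuousLinearEquiv.refl 𝕜 E)
    exact h1.eventually h2
  have hZt : ContDiffNear 𝕜 n Zt 0 := by
    have h1 : ContDiffNear 𝕜 n (fun v => (fderiv 𝕜 Φ v).inverse) 0 := by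
      filter_upwards [hΦ, hinvert] with v h1 h2
      exact h2.contDiffAt_map_inverse.comp v (h1.fderiv_right hnn)
    exact h1.clm_apply (hZ.comp hΦ hΦ0)
  have hYt : ∀ᶠ v in 𝓝 (0 : E), pullback 𝕜 Φ Y v = e := by
    filter_upwards [hinvert, hΦY] with v ⟨A, hA⟩ h2
    rw [pullback_eq_of_fderiv_eq hA, ← h2, ← hA]
    simp
  -- The bracket with the constant field `e` is the derivative in that direction. Involutivity
  -- therefore says that `P Zt` obeys a homogeneous linear equation along lines parallel to `e`, so
  -- its direction does not change along them.
  have hbr : ∀ᶠ v in 𝓝 (0 : E), ∃ a b : 𝕜, fderiv 𝕜 Zt v e = a • e + b • Zt v := by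
    have hdY : ∀ᶠ p in 𝓝 p₀, DifferentiableAt 𝕜 Y p :=
      hY.differentiableAt hn0
    have hdZ : ∀ᶠ p in 𝓝 p₀, DifferentiableAt 𝕜 Z p :=
      hZ.differentiableAt hn0
    filter_upwards [hT.eventually hinv, hYt.eventually_nhds, hT.eventually hdY,
      hT.eventually hdZ, hΦ.mono fun _ h => h.of_le hn2] with v hv hYv hy hz hΦv
    obtain ⟨a, b, hab⟩ := hv
    refine ⟨a, b, ?_⟩
    have h1 := pullback_lieBracket (n := 2) (by simp) hΦv hy hz
    have h2 : lieBracket 𝕜 (pullback 𝕜 Φ Y) (pullback 𝕜 Φ Z) v = fderiv 𝕜 Zt v e := by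
      rw [Filter.EventuallyEq.lieBracket_vectorField_eq (V := fun _ => e) (W := Zt) hYv
        Filter.EventuallyEq.rfl]
      simp [lieBracket]
    rw [← h2, ← h1, pullback, hab, map_add, map_smul, map_smul]
    rw [← hYv.self_of_nhds]
    rfl
  -- reduction to the slice
  let W : E → E := fun v => P (Zt (P v))
  have hP0 : P 0 = 0 := map_zero P
  have hW : ContDiffNear 𝕜 n W 0 :=
    (ContDiff.near P.contDiff).comp (hZt.comp (ContDiff.near P.contDiff) hP0) rfl
  have hW0 : W 0 = Z p₀ - η (Z p₀) • e := by simp [W, hZt0, hP]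
  have hW0ne : W 0 ≠ 0 := by
    rw [hW0]
    intro h
    have := (hind (-η (Z p₀)) 1 (by rw [← h]; module)).2
    simp at this
  obtain ⟨F, hF, hFd, hFW⟩ := exists_firstIntegral hn1 hW hW0ne ℓ (by
    rw [hW0, map_sub, map_smul, hℓY, hℓZ]; simp)
  have hTP : Filter.Tendsto P (𝓝 0) (𝓝 0) := by
    have := P.continuous.tendsto 0
    rwa [hP0] at this
  have hdZt : ∀ᶠ v in 𝓝 (0 : E), DifferentiableAt 𝕜 Zt v :=
    hZt.differentiableAt hn0
  have hdF : ∀ᶠ v in 𝓝 (0 : E), DifferentiableAt 𝕜 F v :=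
    hF.differentiableAt hn0
  have hPZt0 : P (Zt 0) ≠ 0 := by
    have : W 0 = P (Zt 0) := by simp [W]
    rwa [← this]
  -- The coefficient `b` in the involutivity relation is only known to exist pointwise. It is
  -- bounded by `C / c`, because `b • P Zt` equals the bounded vector `P (fderiv 𝕜 Zt v e)` while `P
  -- Zt` stays away from zero.
  let c := ‖P (Zt 0)‖ / 2
  have hc : 0 < c := half_pos (norm_pos_iff.2 hPZt0)
  have hlow : ∀ᶠ v in 𝓝 (0 : E), c < ‖P (Zt v)‖ := by
    have : ContinuousAt (fun v => ‖P (Zt v)‖) 0 :=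
      (ContinuousAt.comp (f := Zt) P.continuous.continuousAt hZt.continuousAt).norm
    exact this.eventually (lt_mem_nhds (half_lt_self (norm_pos_iff.2 hPZt0)))
  obtain ⟨C, hC0, hC⟩ : ∃ C > 0, ∀ᶠ v in 𝓝 (0 : E), ‖P (fderiv 𝕜 Zt v e)‖ < C := by
    refine ⟨‖P (fderiv 𝕜 Zt 0 e)‖ + 1, by positivity, ?_⟩
    have h1 : ContinuousAt (fderiv 𝕜 Zt) 0 :=
      (hZt.contDiffAt.fderiv_right (m := 0) (by simpa using hn1)).continuousAt
    have : ContinuousAt (fun v => ‖P (fderiv 𝕜 Zt v e)‖) 0 :=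
      (ContinuousAt.comp (f := fun v => fderiv 𝕜 Zt v e) P.continuous.continuousAt
        (h1.clm_apply continuousAt_const)).norm
    exact this.eventually (gt_mem_nhds (lt_add_one _))
  obtain ⟨r, hr, hball⟩ := Metric.eventually_nhds_iff_ball.1 (hbr.and (hdZt.and (hlow.and hC)))
  have hmain : ∀ᶠ v in 𝓝 (0 : E), fderiv 𝕜 F (P v) (P (Zt v)) = 0 := by
    filter_upwards [Metric.ball_mem_nhds _ hr, hTP.eventually (Metric.ball_mem_nhds _ hr),
      hTP.eventually hFW] with v hv hPv hFv
    -- The covector is frozen at the foot `P v` of the segment. It kills `Zt` at the foot, where `F`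
    -- is a first integral of `W`, hence also at `v`.
    let m : E →L[𝕜] 𝕜 := fderiv 𝕜 F (P v) ∘L P
    refine eq_zero_along_segment (W := Zt) (S := Metric.ball 0 r) (a := P v) (e := e) (s := η v)
      (m := m) (K := C / c) (by rw [hP]; abel) ?_ (fun q hq => (hball q hq).2.1) ?_ ?_
    · intro t ht
      let : NormedSpace ℝ E := NormedSpace.restrictScalars ℝ 𝕜 E
      have hconv := (convex_ball (0 : E) r) hPv hv (sub_nonneg.2 ht.2) ht.1 (sub_add_cancel 1 t)
      convert hconv using 1
      rw [RCLike.real_smul_eq_coe_smul (K := 𝕜), RCLike.real_smul_eq_coe_smul (K := 𝕜), hP]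
      push_cast
      module
    · intro q hq
      obtain ⟨⟨a, b, hab⟩, -, hl, hu⟩ := hball q hq
      have hPq : P (fderiv 𝕜 Zt q e) = b • P (Zt q) := by
        rw [hab, map_add, map_smul, map_smul, hPe, smul_zero, zero_add]
      refine ⟨b, ?_, ?_⟩
      · rw [hPq, norm_smul] at hu
        rw [le_div_iff₀ hc]
        exact (mul_le_mul_of_nonneg_left hl.le (norm_nonneg b)).trans hu.le
      · simp only [m, ContinuousLinearMap.comp_apply]
        rw [hPq, map_smul, smul_eq_mul]
    · have : W (P v) = P (Zt (P v)) := by simp only [W]; rw [hPP]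
      rw [this] at hFv
      exact hFv
  have hTΨ : Filter.Tendsto Ψ (𝓝 p₀) (𝓝 0) := by
    have := hΨ.continuousAt.tendsto
    rwa [hΨ0] at this
  have hPΨ : ContDiffNear 𝕜 n (fun p => P (Ψ p)) p₀ := (ContDiff.near P.contDiff).comp hΨ rfl
  have hPΨ0 : P (Ψ p₀) = 0 := by rw [hΨ0, hP0]
  -- Composing with `P` makes the function constant along `Y`. It is constant along `Z` by `hmain`.
  refine ⟨fun p => F (P (Ψ p)), ?_, ?_, ?_⟩
  · exact hF.comp hPΨ hPΨ0
  · have h1 : HasFDerivAt (fun p => P (Ψ p)) (P ∘L .id 𝕜 E) p₀ := P.hasFDerivAt.comp p₀ hΨid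
    have h2 : HasFDerivAt F ℓ (P (Ψ p₀)) := by
      rw [hPΨ0, ← hFd]
      exact (hF.differentiableAt hn0).self_of_nhds.hasFDerivAt
    have hfd := (HasFDerivAt.comp (f := fun p => P (Ψ p)) p₀ h2 h1).fderiv
    change fderiv 𝕜 (fun p => F (P (Ψ p))) p₀ = _ at hfd
    rw [hfd]
    ext v
    simp only [ContinuousLinearMap.comp_apply, ContinuousLinearMap.id_apply, hP, map_sub, map_smul,
      hℓY, smul_zero, sub_zero]
  · have hdΨ : ∀ᶠ p in 𝓝 p₀, DifferentiableAt 𝕜 Ψ p :=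
      hΨ.differentiableAt hn0
    have hdΦ : ∀ᶠ v in 𝓝 (0 : E), DifferentiableAt 𝕜 Φ v :=
      hΦ.differentiableAt hn0
    filter_upwards [hdΨ, hTΨ.eventually (hdΦ.and (hΦY.and (hmain.and (hTP.eventually hdF)))),
      hTΨ.eventually hΨΦ.eventually_nhds, hΦΨ, hTΨ.eventually hinvert] with
      p h1 ⟨h2, h3, hm, hdFp⟩ h4 h5 hiv
    have hcmp := (h5.symm ▸ h1 : DifferentiableAt 𝕜 Ψ (Φ (Ψ p))).hasFDerivAt.comp (Ψ p)
      h2.hasFDerivAt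
    have hid : HasFDerivAt (Ψ ∘ Φ) (.id 𝕜 E) (Ψ p) := (hasFDerivAt_id _).congr_of_eventuallyEq h4
    have hinvΨ : ∀ w, fderiv 𝕜 Ψ p (fderiv 𝕜 Φ (Ψ p) w) = w := by
      intro w
      have := congrArg (fun A : E →L[𝕜] E => A w) (hcmp.unique hid)
      simpa only [ContinuousLinearMap.comp_apply, h5, ContinuousLinearMap.id_apply] using this
    have hYp : fderiv 𝕜 Ψ p (Y p) = e := by
      have := hinvΨ e
      rwa [h3, h5] at this
    have hZp : fderiv 𝕜 Ψ p (Z p) = Zt (Ψ p) := by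
      have := hinvΨ (Zt (Ψ p))
      rwa [fderiv_pullback _ _ _ hiv, h5] at this
    have hfd := (HasFDerivAt.comp (f := fun p => P (Ψ p)) p hdFp.hasFDerivAt
      (P.hasFDerivAt.comp p h1.hasFDerivAt)).fderiv
    change fderiv 𝕜 (fun p => F (P (Ψ p))) p = _ at hfd
    rw [hfd]
    simp only [ContinuousLinearMap.comp_apply, hYp, hZp, hPe, map_zero, true_and]
    exact hm

end Frobenius

end PNO

/-! ### First integrals of the pencil spanned by a frame -/

namespace PNO

noncomputable section Pencil

open VectorField

section General

variable {𝕜 : Type*} [RCLike 𝕜] {E : Type*} [NormedAddCommGroup E] [NormedSpace 𝕜 E]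

/-- The bracket relations, at the point `p`, of a frame adapted to a partial Nijenhuis operator. -/
def BracketRelations (X : Fin 3 → E → E) (p : E) : Prop :=
  ∃ a b c d : 𝕜, lieBracket 𝕜 (X 0) (X 1) p = a • X 0 p + b • X 1 p ∧
    lieBracket 𝕜 (X 0) (X 2) p = c • X 0 p + (d + a) • X 1 p + b • X 2 p ∧
    lieBracket 𝕜 (X 1) (X 2) p = c • X 1 p + d • X 2 p

lemma lieBracket_pencil {X : Fin 3 → E → E} {p : E} (hX : ∀ i, DifferentiableAt 𝕜 (X i) p)
    (l : 𝕜) :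
    lieBracket 𝕜 (fun p => X 1 p - l • X 0 p) (fun p => X 2 p - l • X 1 p) p =
      lieBracket 𝕜 (X 1) (X 2) p - l • lieBracket 𝕜 (X 0) (X 2) p
        + l ^ 2 • lieBracket 𝕜 (X 0) (X 1) p := by
  have h (i j : Fin 3) : fderiv 𝕜 (fun p => X i p - l • X j p) p =
      fderiv 𝕜 (X i) p - l • fderiv 𝕜 (X j) p :=
    ((hX i).hasFDerivAt.sub ((hX j).hasFDerivAt.const_smul l)).fderiv
  simp only [lieBracket, h, sub_apply, smul_apply, map_sub,
    map_smul]
  module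

/-- This is where the shape of the bracket relations matters: the quadratic polynomial in `l` given
by the bracket factors through the two generators, with coefficients affine in `l`. -/
lemma lieBracket_pencil_mem {X : Fin 3 → E → E} {p : E} (hX : ∀ i, DifferentiableAt 𝕜 (X i) p)
    (h : BracketRelations (𝕜 := 𝕜) X p) (l : 𝕜) :
    ∃ a b : 𝕜, lieBracket 𝕜 (fun p => X 1 p - l • X 0 p) (fun p => X 2 p - l • X 1 p) p =
      a • (X 1 p - l • X 0 p) + b • (X 2 p - l • X 1 p) := by
  obtain ⟨a, b, c, d, h01, h02, h12⟩ := h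
  refine ⟨c - l * a, d - l * b, ?_⟩
  rw [lieBracket_pencil hX, h01, h02, h12]
  module

lemma linearIndependent_pencil {x : Fin 3 → E} (hx : LinearIndependent 𝕜 x) (l : 𝕜) :
    LinearIndependent 𝕜 ![x 1 - l • x 0, x 2 - l • x 1] := by
  rw [LinearIndependent.pair_iff]
  intro s t hst
  have h := Fintype.linearIndependent_iff.1 hx ![-(s * l), s - t * l, t] (by
    simp only [Fin.sum_univ_three, Matrix.cons_val_zero, Matrix.cons_val_one, Matrix.cons_val]
    rw [← hst]; module)
  have h2 : t = 0 := h 2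
  have h1 : s - t * l = 0 := h 1
  refine ⟨by simpa [h2] using h1, h2⟩

/-- The values `1, l, l ^ 2` on the frame are those of a covector annihilating both generators of
the pencil; it is the initial value for Frobenius. -/
lemma exists_dual_pencil [FiniteDimensional 𝕜 E] (hE : Module.finrank 𝕜 E = 3) {x : Fin 3 → E}
    (hx : LinearIndependent 𝕜 x) (l : 𝕜) :
    ∃ ℓ : E →L[𝕜] 𝕜, ℓ (x 0) = 1 ∧ ℓ (x 1) = l ∧ ℓ (x 2) = l ^ 2 := by
  let b := basisOfLinearIndependentOfCardEqFinrank hx (by simp [hE])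
  have hb : ∀ i, b i = x i := fun i => by simp [b]
  let ℓ := LinearMap.toContinuousLinearMap (b.constr 𝕜 ![1, l, l ^ 2])
  have hℓ : ∀ i, ℓ (x i) = ![1, l, l ^ 2] i := fun i => by
    rw [← hb]; exact b.constr_basis _ _ _
  exact ⟨ℓ, hℓ 0, hℓ 1, hℓ 2⟩

/-- First integrals of the pencil, depending on the parameter of the pencil. -/
theorem exists_firstIntegral_family [FiniteDimensional 𝕜 E] (hE : Module.finrank 𝕜 E = 3)
    {n : WithTop ℕ∞} (hn : ∞ ≤ n) {X : Fin 3 → E → E} {p₀ : E}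
    (hX : ∀ i, ContDiffNear 𝕜 n (X i) p₀) (hind : LinearIndependent 𝕜 fun i => X i p₀)
    (hrel : ∀ᶠ p in 𝓝 p₀, BracketRelations (𝕜 := 𝕜) X p) (l₀ : 𝕜) :
    ∃ f : E × 𝕜 → 𝕜, ContDiffNear 𝕜 n f (p₀, l₀) ∧ fderiv 𝕜 f (p₀, l₀) (X 0 p₀, 0) = 1 ∧
      ∀ᶠ q in 𝓝 (p₀, l₀),
        fderiv 𝕜 f q (X 1 q.1, 0) = q.2 * fderiv 𝕜 f q (X 0 q.1, 0) ∧
        fderiv 𝕜 f q (X 2 q.1, 0) = q.2 * fderiv 𝕜 f q (X 1 q.1, 0) := by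
  have hn0 : n ≠ 0 := by rintro rfl; simp at hn
  have : CompleteSpace E := FiniteDimensional.complete 𝕜 E
  -- Frobenius is applied on `E × 𝕜` to fields without component in the parameter, so that the first
  -- integral is jointly `C^n` in the point and in `l`.
  let W : Fin 3 → Fin 3 → E × 𝕜 → E × 𝕜 := fun i j q => (X i q.1 - q.2 • X j q.1, 0)
  have hW : ∀ i j, ContDiffNear 𝕜 n (W i j) (p₀, l₀) := by
    intro i j
    have h (i : Fin 3) : ContDiffNear 𝕜 n (fun q : E × 𝕜 => X i q.1) (p₀, l₀) :=
      (hX i).comp (ContDiff.near contDiff_fst) rfl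
    exact ((h i).sub (ContDiffNear.smul (ContDiff.near contDiff_snd) (h j))).prodMk
      (ContDiff.near contDiff_const)
  have hWd : ∀ (p : E) (l : 𝕜) (v : E), (∀ i, DifferentiableAt 𝕜 (X i) p) → ∀ i j,
      fderiv 𝕜 (W i j) (p, l) (v, 0) = (fderiv 𝕜 (fun p => X i p - l • X j p) p v, 0) := by
    intro p l v hp i j
    have h (i : Fin 3) : HasFDerivAt (fun q : E × 𝕜 => X i q.1)
        (fderiv 𝕜 (X i) p ∘L .fst 𝕜 E 𝕜) (p, l) :=
      HasFDerivAt.comp (g := X i) (p, l) (hp i).hasFDerivAt hasFDerivAt_fst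
    have h1 : HasFDerivAt (W i j) _ (p, l) :=
      (((h i).sub (HasFDerivAt.fun_smul (hasFDerivAt_snd (p := (p, l))) (h j))).prodMk
        (hasFDerivAt_const (0 : 𝕜) (p, l)))
    have h2 : fderiv 𝕜 (fun p => X i p - l • X j p) p =
        fderiv 𝕜 (X i) p - l • fderiv 𝕜 (X j) p :=
      ((hp i).hasFDerivAt.sub ((hp j).hasFDerivAt.const_smul l)).fderiv
    rw [h1.fderiv, h2]
    simp
  obtain ⟨ℓ, hℓ0, hℓ1, hℓ2⟩ := exists_dual_pencil hE hind l₀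
  have hdX : ∀ᶠ p in 𝓝 p₀, ∀ i, DifferentiableAt 𝕜 (X i) p :=
    Filter.eventually_all.2 fun i => (hX i).differentiableAt hn0
  have hfst : Filter.Tendsto (Prod.fst : E × 𝕜 → E) (𝓝 (p₀, l₀)) (𝓝 p₀) :=
    continuous_fst.tendsto _
  obtain ⟨f, hf, hfd, hfW⟩ := exists_common_firstIntegral hn (hW 1 0) (hW 2 1)
    (by
      have := linearIndependent_pencil hind l₀
      rw [LinearIndependent.pair_iff] at this ⊢
      exact fun s t hst => this s t (by simpa [W] using congrArg Prod.fst hst))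
    (by
      filter_upwards [hfst.eventually hrel, hfst.eventually hdX] with q hq hd
      obtain ⟨a, b, hab⟩ := lieBracket_pencil_mem hd hq q.2
      refine ⟨a, b, ?_⟩
      have e1 := hWd q.1 q.2 (X 1 q.1 - q.2 • X 0 q.1) hd 2 1
      have e2 := hWd q.1 q.2 (X 2 q.1 - q.2 • X 1 q.1) hd 1 0
      simp only [lieBracket] at hab ⊢
      change fderiv 𝕜 (W 2 1) (q.1, q.2) (X 1 q.1 - q.2 • X 0 q.1, 0) -
        fderiv 𝕜 (W 1 0) (q.1, q.2) (X 2 q.1 - q.2 • X 1 q.1, 0) = _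
      rw [e1, e2]
      simp only [W, Prod.mk_sub_mk, hab, Prod.smul_mk, Prod.mk_add_mk]
      simp)
    (ℓ ∘L .fst 𝕜 E 𝕜) (by simp [W, hℓ0, hℓ1]) (by simp [W, hℓ1, hℓ2]; ring)
  refine ⟨f, hf, by simp [hfd, hℓ0], ?_⟩
  filter_upwards [hfW] with q hq
  have h (i j : Fin 3) : fderiv 𝕜 f q (W i j q) =
      fderiv 𝕜 f q (X i q.1, 0) - q.2 * fderiv 𝕜 f q (X j q.1, 0) := by
    have : W i j q = (X i q.1, 0) - q.2 • (X j q.1, (0 : 𝕜)) := by simp [W]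
    rw [this, map_sub, map_smul, smul_eq_mul]
  rw [h, h, sub_eq_zero, sub_eq_zero] at hq
  exact hq

lemma fderiv_slice {F : Type*} [NormedAddCommGroup F] [NormedSpace 𝕜 F] {f : E × 𝕜 → F} {p : E}
    {l : 𝕜} (hf : DifferentiableAt 𝕜 f (p, l)) (v : E) :
    fderiv 𝕜 (fun p => f (p, l)) p v = fderiv 𝕜 f (p, l) (v, 0) := by
  have : HasFDerivAt (fun p => f (p, l)) (fderiv 𝕜 f (p, l) ∘L .inl 𝕜 E 𝕜) p :=
    HasFDerivAt.comp (g := f) (f := fun p => (p, l)) p hf.hasFDerivAt (hasFDerivAt_prodMk_left _ _)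
  rw [this.fderiv]
  simp

end General

/-! ### Differentiating first integrals in the parameter of the pencil. -/

section Parameter

variable {E : Type*} [NormedAddCommGroup E] [NormedSpace ℝ E]

/-- The derivative in the parameter. -/
def paramDeriv (f : E × ℝ → ℝ) (q : E × ℝ) : ℝ := fderiv ℝ f q (0, 1)

lemma contDiffNear_paramDeriv {f : E × ℝ → ℝ} {q : E × ℝ} (hf : ContDiffNear ℝ ∞ f q) :
    ContDiffNear ℝ ∞ (paramDeriv f) q :=
  (hf.fderiv le_rfl).clm_apply (ContDiff.near contDiff_const)

/-- Symmetry of the second derivative: differentiation in the parameter commutes with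
differentiation along `v`. -/
lemma hasDerivAt_fderiv_param {f : E × ℝ → ℝ} {p : E} {l : ℝ} (hf : ContDiffAt ℝ 2 f (p, l))
    (v : E) : HasDerivAt (fun s => fderiv ℝ f (p, s) (v, 0))
      (fderiv ℝ (paramDeriv f) (p, l) (v, 0)) l := by
  have h1 : HasFDerivAt (fderiv ℝ f) (fderiv ℝ (fderiv ℝ f) (p, l)) (p, l) :=
    ((hf.fderiv_right (m := 1) (by norm_num)).differentiableAt (by simp)).hasFDerivAt
  have h2 : HasDerivAt (fun s : ℝ => (p, s)) ((0 : E), (1 : ℝ)) l :=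
    (hasDerivAt_const _ _).prodMk (hasDerivAt_id _)
  have h3 := (h1.comp_hasDerivAt l h2).clm_apply (hasDerivAt_const l (v, (0 : ℝ)))
  have hsymm : IsSymmSndFDerivAt ℝ f (p, l) := hf.isSymmSndFDerivAt (by simp)
  have h4 : fderiv ℝ (paramDeriv f) (p, l) (v, 0) =
      fderiv ℝ (fderiv ℝ f) (p, l) (v, 0) (0, 1) := by
    have := (h1.clm_apply (hasFDerivAt_const ((0 : E), (1 : ℝ)) (p, l))).fderiv
    change fderiv ℝ (paramDeriv f) (p, l) = _ at this
    rw [this]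
    simp
  rw [h4, hsymm.eq]
  simpa using h3

/-- Differentiating the chain relation between `f` and `h` in the parameter. -/
lemma eventually_paramDeriv_chain {f h : E × ℝ → ℝ} {A B : E → E} {q₀ : E × ℝ}
    (hf : ContDiffNear ℝ ∞ f q₀) (hh : ContDiffNear ℝ ∞ h q₀)
    (hrel : ∀ᶠ q in 𝓝 q₀, fderiv ℝ f q (B q.1, 0) =
      q.2 * fderiv ℝ f q (A q.1, 0) + fderiv ℝ h q (A q.1, 0)) :
    ∀ᶠ q in 𝓝 q₀, fderiv ℝ (paramDeriv f) q (B q.1, 0) =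
      q.2 * fderiv ℝ (paramDeriv f) q (A q.1, 0) +
        (fderiv ℝ f q (A q.1, 0) + fderiv ℝ (paramDeriv h) q (A q.1, 0)) := by
  have h2 : (2 : WithTop ℕ∞) ≤ ∞ := two_le_of_infty_le le_rfl
  filter_upwards [hrel.eventually_nhds, hf.mono fun _ h => h.of_le h2,
    hh.mono fun _ h => h.of_le h2] with q hq hfq hhq
  have hT : Filter.Tendsto (fun s : ℝ => (q.1, s)) (𝓝 q.2) (𝓝 q) :=
    (Continuous.prodMk_right q.1).tendsto q.2
  have e1 := hasDerivAt_fderiv_param (p := q.1) (l := q.2) hfq (B q.1)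
  have e2 := hasDerivAt_fderiv_param (p := q.1) (l := q.2) hfq (A q.1)
  have e3 := hasDerivAt_fderiv_param (p := q.1) (l := q.2) hhq (A q.1)
  have e4 := ((hasDerivAt_id q.2).mul e2).add e3
  have e5 := e1.unique (e4.congr_of_eventuallyEq (hT.eventually hq))
  simp only [Prod.mk.eta, id, one_mul] at e5
  rw [e5]
  ring

end Parameter

end Pencil

end PNO

/-! ### Normal forms of a frame in real coordinates -/

namespace PNO

noncomputable section RealNormalForm

open VectorField

/-- `G` is a local coordinate system at `p₀` in which an operator with `X 0 ↦ X 1 ↦ X 2` has the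
constant matrix `A`. -/
structure IsNormalizing (n : WithTop ℕ∞)
    (X : Fin 3 → EuclideanSpace ℝ (Fin 3) → EuclideanSpace ℝ (Fin 3))
    (A : Matrix (Fin 3) (Fin 3) ℝ) (p₀ : EuclideanSpace ℝ (Fin 3))
    (G : EuclideanSpace ℝ (Fin 3) → EuclideanSpace ℝ (Fin 3)) : Prop where
  contDiffNear : ContDiffNear ℝ n G p₀
  eventually_chain : ∀ᶠ p in 𝓝 p₀, ∀ k : Fin 2, ∀ i,
    fderiv ℝ G p (X k.succ p) i = ∑ j, A i j * fderiv ℝ G p (X k.castSucc p) j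
  linearIndependent : LinearIndependent ℝ fun k => fderiv ℝ G p₀ (X k p₀)

/-- The map with coordinates `g`. -/
def ofCoords {E : Type*} (g : Fin 3 → E → ℝ) (p : E) : EuclideanSpace ℝ (Fin 3) :=
  WithLp.toLp 2 fun i => g i p

variable {n : WithTop ℕ∞} {X : Fin 3 → EuclideanSpace ℝ (Fin 3) → EuclideanSpace ℝ (Fin 3)}
  {p₀ : EuclideanSpace ℝ (Fin 3)}

lemma fderiv_ofCoords {g : Fin 3 → EuclideanSpace ℝ (Fin 3) → ℝ} {p : EuclideanSpace ℝ (Fin 3)}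
    (hg : ∀ i, DifferentiableAt ℝ (g i) p) (v : EuclideanSpace ℝ (Fin 3)) (i : Fin 3) :
    fderiv ℝ (ofCoords g) p v i = fderiv ℝ (g i) p v := by
  have h : DifferentiableAt ℝ (ofCoords g) p := differentiableAt_euclidean.2 hg
  have := ((EuclideanSpace.proj i : EuclideanSpace ℝ (Fin 3) →L[ℝ] ℝ).hasFDerivAt.comp p
    h.hasFDerivAt).fderiv
  change fderiv ℝ (g i) p = _ at this
  rw [this]
  rfl

/-- Coordinates whose differentials form chains with respect to a cyclic vector are normalizing. -/
lemma isNormalizing_ofCoords (hn0 : n ≠ 0) {A : Matrix (Fin 3) (Fin 3) ℝ}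
    {g : Fin 3 → EuclideanSpace ℝ (Fin 3) → ℝ} (hg : ∀ i, ContDiffNear ℝ n (g i) p₀)
    (hchain : ∀ᶠ p in 𝓝 p₀, ∀ k : Fin 2, ∀ i,
      fderiv ℝ (g i) p (X k.succ p) = ∑ j, A i j * fderiv ℝ (g j) p (X k.castSucc p))
    {x : Fin 3 → ℝ} (hx : ∀ i, fderiv ℝ (g i) p₀ (X 0 p₀) = x i)
    (hdet : (Matrix.of ![x, A.mulVec x, A.mulVec (A.mulVec x)]).det ≠ 0) :
    IsNormalizing n X A p₀ (ofCoords g) := by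
  have hd : ∀ᶠ p in 𝓝 p₀, ∀ i, DifferentiableAt ℝ (g i) p :=
    Filter.eventually_all.2 fun i => (hg i).differentiableAt hn0
  refine ⟨(Filter.eventually_all.2 hg).mono fun p hp => contDiffAt_euclidean.2 hp, ?_, ?_⟩
  · filter_upwards [hchain, hd] with p hp hdp k i
    simp only [fderiv_ofCoords hdp]
    exact hp k i
  · have hd₀ := hd.self_of_nhds
    have hc := hchain.self_of_nhds
    have h0 : (fun i => fderiv ℝ (g i) p₀ (X 0 p₀)) = x := funext hx
    have h1 : (fun i => fderiv ℝ (g i) p₀ (X 1 p₀)) = A.mulVec x := by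
      ext i
      have := hc 0 i
      simpa [hx, Matrix.mulVec, dotProduct] using this
    have h2 : (fun i => fderiv ℝ (g i) p₀ (X 2 p₀)) = A.mulVec (A.mulVec x) := by
      ext i
      have := hc 1 i
      rw [← h1]
      simpa [Matrix.mulVec, dotProduct] using this
    let T := (EuclideanSpace.equiv (Fin 3) ℝ).toLinearEquiv.toLinearMap
    -- By the chain relations the images of the frame vectors are `x`, `A x`, `A² x`, so
    -- independence means that `x` is a cyclic vector for `A`.
    refine LinearIndependent.of_comp T ?_
    have hrows := Matrix.linearIndependent_rows_iff_isUnit.2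
      ((Matrix.isUnit_iff_isUnit_det _).2 (isUnit_iff_ne_zero.2 hdet))
    have hT : ∀ k, T (fderiv ℝ (ofCoords g) p₀ (X k p₀)) =
        fun i => fderiv ℝ (g i) p₀ (X k p₀) := fun k => funext fun i => fderiv_ofCoords hd₀ _ i
    have hfun : (T ∘ fun k => fderiv ℝ (ofCoords g) p₀ (X k p₀)) =
        (Matrix.of ![x, A.mulVec x, A.mulVec (A.mulVec x)]).row := by
      funext k
      simp only [Function.comp_apply, hT, Matrix.row_def]
      fin_cases k
      · exact h0
      · exact h1
      · exact h2
    rw [hfun]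
    exact hrows

lemma contDiffNear_slice {f : EuclideanSpace ℝ (Fin 3) × ℝ → ℝ} {l : ℝ}
    (hf : ContDiffNear ℝ n f (p₀, l)) : ContDiffNear ℝ n (fun p => f (p, l)) p₀ :=
  hf.comp (ContDiff.near (contDiff_id.prodMk contDiff_const)) rfl

lemma paramDeriv_zero : paramDeriv (fun _ : EuclideanSpace ℝ (Fin 3) × ℝ => (0 : ℝ)) =
    fun _ => 0 := by
  ext q
  simp [paramDeriv]

/-- A chain relation in the parameter space restricts to slices. -/
lemma eventually_slice {f h : EuclideanSpace ℝ (Fin 3) × ℝ → ℝ} {l : ℝ}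
    {A B : EuclideanSpace ℝ (Fin 3) → EuclideanSpace ℝ (Fin 3)}
    (hf : ContDiffNear ℝ ∞ f (p₀, l)) (hh : ContDiffNear ℝ ∞ h (p₀, l))
    (hrel : ∀ᶠ q in 𝓝 (p₀, l), fderiv ℝ f q (B q.1, 0) =
      q.2 * fderiv ℝ f q (A q.1, 0) + fderiv ℝ h q (A q.1, 0)) :
    ∀ᶠ p in 𝓝 p₀, fderiv ℝ (fun p => f (p, l)) p (B p) =
      l * fderiv ℝ (fun p => f (p, l)) p (A p) + fderiv ℝ (fun p => h (p, l)) p (A p) := by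
  have hT : Filter.Tendsto (fun p => (p, l)) (𝓝 p₀) (𝓝 (p₀, l)) :=
    (Continuous.prodMk_left l).tendsto p₀
  filter_upwards [hT.eventually hrel, hT.eventually hf, hT.eventually hh] with p hp hfp hhp
  rw [fderiv_slice (hfp.differentiableAt (by simp)), fderiv_slice (hfp.differentiableAt (by simp)),
    fderiv_slice (hhp.differentiableAt (by simp))]
  exact hp

/-- First integrals for the parameter values near `l`, with the chain relations in the form needed
for differentiation in the parameter. -/
lemma exists_eigenfunction_family (hX : ∀ i, ContDiffNear ℝ ∞ (X i) p₀)
    (hind : LinearIndependent ℝ fun i => X i p₀)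
    (hrel : ∀ᶠ p in 𝓝 p₀, BracketRelations (𝕜 := ℝ) X p)
    (l : ℝ) :
    ∃ f : EuclideanSpace ℝ (Fin 3) × ℝ → ℝ, ContDiffNear ℝ ∞ f (p₀, l) ∧
      fderiv ℝ (fun p => f (p, l)) p₀ (X 0 p₀) = 1 ∧
      ∀ k : Fin 2, ∀ᶠ q in 𝓝 (p₀, l), fderiv ℝ f q (X k.succ q.1, 0) =
        q.2 * fderiv ℝ f q (X k.castSucc q.1, 0) +
          fderiv ℝ (fun _ : EuclideanSpace ℝ (Fin 3) × ℝ => (0 : ℝ)) q (X k.castSucc q.1, 0) := by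
  obtain ⟨f, hf, hf0, hfX⟩ := exists_firstIntegral_family (by simp) le_rfl hX hind hrel l
  refine ⟨f, hf, ?_, fun k => ?_⟩
  · rw [fderiv_slice (hf.contDiffAt.differentiableAt (by simp)), hf0]
  · filter_upwards [hfX] with q hq
    fin_cases k
    · simpa using hq.1
    · simpa using hq.2

lemma exists_eigenfunction (hX : ∀ i, ContDiffNear ℝ ∞ (X i) p₀)
    (hind : LinearIndependent ℝ fun i => X i p₀)
    (hrel : ∀ᶠ p in 𝓝 p₀, BracketRelations (𝕜 := ℝ) X p)
    (l : ℝ) :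
    ∃ f : EuclideanSpace ℝ (Fin 3) → ℝ, ContDiffNear ℝ ∞ f p₀ ∧ fderiv ℝ f p₀ (X 0 p₀) = 1 ∧
      ∀ k : Fin 2, ∀ᶠ p in 𝓝 p₀, fderiv ℝ f p (X k.succ p) = l * fderiv ℝ f p (X k.castSucc p) := by
  obtain ⟨f, hf, hf0, hfX⟩ := exists_eigenfunction_family hX hind hrel l
  refine ⟨_, contDiffNear_slice hf, hf0, fun k => ?_⟩
  filter_upwards [eventually_slice hf (ContDiff.near contDiff_const) (hfX k)] with p hp
  simpa using hp

/-- Three distinct eigenvalues give three first integrals, and the determinant is the Vandermonde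
determinant of `0, 1, 2`. -/
theorem exists_isNormalizing_diagonal (hX : ∀ i, ContDiffNear ℝ ∞ (X i) p₀)
    (hind : LinearIndependent ℝ fun i => X i p₀)
    (hrel : ∀ᶠ p in 𝓝 p₀, BracketRelations (𝕜 := ℝ) X p) :
    ∃ G, IsNormalizing ∞ X !![0, 0, 0; 0, 1, 0; 0, 0, 2] p₀ G := by
  obtain ⟨f, hf, hf0, hfX⟩ := exists_eigenfunction hX hind hrel 0
  obtain ⟨g, hg, hg0, hgX⟩ := exists_eigenfunction hX hind hrel 1
  obtain ⟨h, hh, hh0, hhX⟩ := exists_eigenfunction hX hind hrel 2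
  refine ⟨ofCoords ![f, g, h], isNormalizing_ofCoords
    (by simp) ?_ ?_ (x := ![1, 1, 1]) ?_ ?_⟩
  · intro i; fin_cases i <;> assumption
  · filter_upwards [Filter.eventually_all.2 hfX, Filter.eventually_all.2 hgX,
      Filter.eventually_all.2 hhX] with p h1 h2 h3 k i
    fin_cases i
    · simpa [Fin.sum_univ_three] using h1 k
    · simpa [Fin.sum_univ_three] using h2 k
    · simpa [Fin.sum_univ_three] using h3 k
  · intro i; fin_cases i <;> assumption
  · rw [Matrix.det_fin_three]
    simp [dotProduct, Fin.sum_univ_three]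
    norm_num

/-- Differentiating `df(X_{k+1}) = l df(X_k)` in `l` at `0` shows that `∂f/∂l` and `f` form a Jordan
chain. The unknown value of `d(∂f/∂l)(X₀)` does not enter the determinant. -/
theorem exists_isNormalizing_jordanTwo (hX : ∀ i, ContDiffNear ℝ ∞ (X i) p₀)
    (hind : LinearIndependent ℝ fun i => X i p₀)
    (hrel : ∀ᶠ p in 𝓝 p₀, BracketRelations (𝕜 := ℝ) X p) :
    ∃ G, IsNormalizing ∞ X !![0, 1, 0; 0, 0, 0; 0, 0, 1] p₀ G := by
  obtain ⟨f, hf, hf0, hfX⟩ := exists_eigenfunction_family hX hind hrel 0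
  obtain ⟨g, hg, hg0, hgX⟩ := exists_eigenfunction hX hind hrel 1
  have hf' := contDiffNear_paramDeriv hf
  have hfX0 : ∀ k : Fin 2, _ := fun k => eventually_slice hf (ContDiff.near contDiff_const) (hfX k)
  have hfX1 : ∀ k : Fin 2, _ := fun k => eventually_slice (h := f) (A := X k.castSucc)
    (B := X k.succ) hf' hf (by
    filter_upwards [eventually_paramDeriv_chain hf (ContDiff.near contDiff_const) (hfX k)] with q hq
    simpa [paramDeriv_zero] using hq)
  refine ⟨ofCoords ![fun p => paramDeriv f (p, 0), fun p => f (p, 0), g], isNormalizing_ofCoords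
    (by simp) ?_ ?_
    (x := ![fderiv ℝ (fun p => paramDeriv f (p, 0)) p₀ (X 0 p₀), 1, 1]) ?_ ?_⟩
  · intro i
    fin_cases i
    · exact contDiffNear_slice hf'
    · exact contDiffNear_slice hf
    · exact hg
  · filter_upwards [Filter.eventually_all.2 hfX0, Filter.eventually_all.2 hfX1,
      Filter.eventually_all.2 hgX] with p h1 h2 h3 k i
    fin_cases i
    · simpa [Fin.sum_univ_three] using h2 k
    · simpa [Fin.sum_univ_three] using h1 k
    · simpa [Fin.sum_univ_three] using h3 k
  · intro i
    fin_cases i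
    · rfl
    · exact hf0
    · exact hg0
  · rw [Matrix.det_fin_three]
    simp [dotProduct, Fin.sum_univ_three]

theorem exists_isNormalizing_jordanThree (hX : ∀ i, ContDiffNear ℝ ∞ (X i) p₀)
    (hind : LinearIndependent ℝ fun i => X i p₀)
    (hrel : ∀ᶠ p in 𝓝 p₀, BracketRelations (𝕜 := ℝ) X p) :
    ∃ G, IsNormalizing ∞ X !![0, 1, 0; 0, 0, 1; 0, 0, 0] p₀ G := by
  obtain ⟨f, hf, hf0, hfX⟩ := exists_eigenfunction_family hX hind hrel 0
  have hf' := contDiffNear_paramDeriv hf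
  have hf'' := contDiffNear_paramDeriv hf'
  have hfX0 : ∀ k : Fin 2, _ := fun k => eventually_slice hf (ContDiff.near contDiff_const) (hfX k)
  have hrel1 : ∀ k : Fin 2, ∀ᶠ q in 𝓝 (p₀, (0 : ℝ)), fderiv ℝ (paramDeriv f) q (X k.succ q.1, 0) =
      q.2 * fderiv ℝ (paramDeriv f) q (X k.castSucc q.1, 0) +
        fderiv ℝ f q (X k.castSucc q.1, 0) := fun k => by
    filter_upwards [eventually_paramDeriv_chain hf (ContDiff.near contDiff_const) (hfX k)] with q hq
    simpa [paramDeriv_zero] using hq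
  have hfX1 : ∀ k : Fin 2, _ := fun k => eventually_slice hf' hf (hrel1 k)
  -- The second derivative of the eigenvalue relation has the term `2 d(∂f/∂l)`; the Taylor
  -- coefficient with the factor `1 / 2` removes the two.
  have hfX2 : ∀ k : Fin 2, ∀ᶠ p in 𝓝 p₀,
      fderiv ℝ (fun p => (1 / 2 : ℝ) * paramDeriv (paramDeriv f) (p, 0)) p (X k.succ p) =
        fderiv ℝ (fun p => paramDeriv f (p, 0)) p (X k.castSucc p) := fun k => by
    have h2f : ContDiffNear ℝ ∞ (fun q => 2 * paramDeriv f q) (p₀, (0 : ℝ)) :=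
      ContDiffNear.smul (ContDiff.near contDiff_const) hf'
    filter_upwards [eventually_slice (A := X k.castSucc) (B := X k.succ) hf'' h2f (by
      filter_upwards [eventually_paramDeriv_chain hf' hf (hrel1 k), hf'] with q hq hd
      have e : fderiv ℝ (fun q => 2 * paramDeriv f q) q = (2 : ℝ) • fderiv ℝ (paramDeriv f) q :=
        ((hd.differentiableAt (by simp)).hasFDerivAt.const_mul 2).fderiv
      rw [hq, e, smul_apply, smul_eq_mul]
      ring), contDiffNear_slice hf', contDiffNear_slice hf''] with p hp h1 h2
    have e1 := ((h2.differentiableAt (by simp)).hasFDerivAt.const_mul (1 / 2 : ℝ)).fderiv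
    have e2 := ((h1.differentiableAt (by simp)).hasFDerivAt.const_mul (2 : ℝ)).fderiv
    rw [e2] at hp
    rw [e1, smul_apply, hp]
    simp
  refine ⟨ofCoords ![fun p => (1 / 2 : ℝ) * paramDeriv (paramDeriv f) (p, 0),
    fun p => paramDeriv f (p, 0), fun p => f (p, 0)], isNormalizing_ofCoords
    (by simp) ?_ ?_
    (x := ![fderiv ℝ (fun p => (1 / 2 : ℝ) * paramDeriv (paramDeriv f) (p, 0)) p₀ (X 0 p₀),
      fderiv ℝ (fun p => paramDeriv f (p, 0)) p₀ (X 0 p₀), 1]) ?_ ?_⟩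
  · intro i
    fin_cases i
    · exact ContDiffNear.smul (ContDiff.near contDiff_const) (contDiffNear_slice hf'')
    · exact contDiffNear_slice hf'
    · exact contDiffNear_slice hf
  · filter_upwards [Filter.eventually_all.2 hfX0, Filter.eventually_all.2 hfX1,
      Filter.eventually_all.2 hfX2] with p h1 h2 h3 k i
    fin_cases i
    · simpa [Fin.sum_univ_three] using h3 k
    · simpa [Fin.sum_univ_three] using h2 k
    · simpa [Fin.sum_univ_three] using h1 k
  · intro i
    fin_cases i
    · rfl
    · rfl
    · exact hf0
  · rw [Matrix.det_fin_three]
    simp [dotProduct, Fin.sum_univ_three]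

end RealNormalForm

end PNO

/-! ### Complexification of real-analytic maps and the complex normal form -/

namespace PNO

noncomputable section Complexification

open VectorField

local notation "ℝ³" => EuclideanSpace ℝ (Fin 3)

/-- The inclusion of `ℝ³` into `ℂ³`. -/
def toComplex : ℝ³ →L[ℝ] (Fin 3 → ℂ) :=
  ContinuousLinearMap.pi fun i => Complex.ofRealCLM ∘L EuclideanSpace.proj i

/-- The real part of a vector in `ℂ³`. -/
def rePart : (Fin 3 → ℂ) →L[ℝ] ℝ³ :=
  ((EuclideanSpace.equiv (Fin 3) ℝ).symm : (Fin 3 → ℝ) →L[ℝ] ℝ³) ∘L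
    ContinuousLinearMap.pi fun i => Complex.reCLM ∘L ContinuousLinearMap.proj i

/-- The imaginary part of a vector in `ℂ³`. -/
def imPart : (Fin 3 → ℂ) →L[ℝ] ℝ³ :=
  ((EuclideanSpace.equiv (Fin 3) ℝ).symm : (Fin 3 → ℝ) →L[ℝ] ℝ³) ∘L
    ContinuousLinearMap.pi fun i => Complex.imCLM ∘L ContinuousLinearMap.proj i

lemma toComplex_apply (p : ℝ³) (i : Fin 3) : toComplex p i = (p i : ℂ) := rfl

lemma rePart_apply (z : Fin 3 → ℂ) (i : Fin 3) : rePart z i = (z i).re := rfl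

lemma imPart_apply (z : Fin 3 → ℂ) (i : Fin 3) : imPart z i = (z i).im := rfl

lemma rePart_toComplex (p : ℝ³) : rePart (toComplex p) = p := by
  ext i; simp [rePart_apply, toComplex_apply]

lemma toComplex_rePart_add (z : Fin 3 → ℂ) :
    toComplex (rePart z) + Complex.I • toComplex (imPart z) = z := by
  ext i
  simp only [Pi.add_apply, Pi.smul_apply, toComplex_apply, rePart_apply, imPart_apply, smul_eq_mul]
  rw [mul_comm, Complex.re_add_im]

/-- The complex multilinear extension of a real multilinear map on `ℝ³`. -/
def complexifyMultilinear {n : ℕ} (p : ℝ³ [×n]→L[ℝ] ℂ) : (Fin 3 → ℂ) [×n]→L[ℂ] ℂ :=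
  ∑ s : Fin n → Fin 3, p (fun i => EuclideanSpace.single (s i) 1) •
    (ContinuousMultilinearMap.mkPiAlgebra ℂ (Fin n) ℂ).compContinuousLinearMap
      fun i => ContinuousLinearMap.proj (s i)

lemma complexifyMultilinear_apply {n : ℕ} (p : ℝ³ [×n]→L[ℝ] ℂ) (v : Fin n → Fin 3 → ℂ) :
    complexifyMultilinear p v =
      ∑ s : Fin n → Fin 3, p (fun i => EuclideanSpace.single (s i) 1) * ∏ i, v i (s i) := by
  simp [complexifyMultilinear]

lemma complexifyMultilinear_toComplex {n : ℕ} (p : ℝ³ [×n]→L[ℝ] ℂ) (v : Fin n → ℝ³) :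
    complexifyMultilinear p (fun i => toComplex (v i)) = p v := by
  have hv : v = fun i => ∑ j : Fin 3, v i j • EuclideanSpace.single j (1 : ℝ) := by
    funext i
    ext k
    simp [Finset.sum_apply, Pi.single_apply]
  rw [complexifyMultilinear_apply]
  conv_rhs => rw [hv]
  rw [p.map_sum]
  refine Finset.sum_congr rfl fun s _ => ?_
  rw [p.map_smul_univ]
  simp [toComplex_apply, mul_comm]

lemma norm_complexifyMultilinear_le {n : ℕ} (p : ℝ³ [×n]→L[ℝ] ℂ) :
    ‖complexifyMultilinear p‖ ≤ 3 ^ n * ‖p‖ := by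
  refine ContinuousMultilinearMap.opNorm_le_bound (by positivity) fun v => ?_
  rw [complexifyMultilinear_apply]
  refine (norm_sum_le _ _).trans ?_
  have : ∀ s ∈ (Finset.univ : Finset (Fin n → Fin 3)),
      ‖p (fun i => EuclideanSpace.single (s i) 1) * ∏ i, v i (s i)‖ ≤ ‖p‖ * ∏ i, ‖v i‖ := by
    intro s _
    rw [norm_mul, norm_prod]
    gcongr with i
    · refine (p.le_opNorm _).trans ?_
      simp
    · exact norm_le_pi_norm (v i) (s i)
  refine (Finset.sum_le_sum this).trans ?_
  simp [mul_assoc]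

/-- A real-analytic function extends to a holomorphic one. -/
lemma exists_complexification {g : ℝ³ → ℂ} {p₀ : ℝ³} (hg : AnalyticAt ℝ g p₀) :
    ∃ G : (Fin 3 → ℂ) → ℂ, AnalyticAt ℂ G (toComplex p₀) ∧ ∀ᶠ p in 𝓝 p₀, G (toComplex p) = g p := by
  obtain ⟨p, r, hp⟩ := hg
  let P : FormalMultilinearSeries ℂ (Fin 3 → ℂ) ℂ := fun n => complexifyMultilinear (p n)
  have hrad : 0 < P.radius := by
    obtain ⟨s, hs0, hs⟩ : ∃ s : NNReal, 0 < s ∧ (s : ENNReal) < p.radius := by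
      obtain ⟨s, h1, h2⟩ := ENNReal.lt_iff_exists_nnreal_btwn.1 (hp.r_pos.trans_le hp.r_le)
      exact ⟨s, by exact_mod_cast h1, h2⟩
    -- Expanding in the three basis vectors costs a factor `3 ^ n` in the `n`-th coefficient, so the
    -- radius shrinks by at most the factor `3`.
    have h3 : ((s / 3 : NNReal) : ENNReal) ≤ P.radius := by
      refine P.le_radius_of_summable_norm ((p.summable_norm_mul_pow hs).of_nonneg_of_le
        (fun n => by positivity) fun n => ?_)
      calc ‖P n‖ * ((s / 3 : NNReal) : ℝ) ^ n
          ≤ (3 ^ n * ‖p n‖) * ((s / 3 : NNReal) : ℝ) ^ n := by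
            gcongr
            exact norm_complexifyMultilinear_le _
        _ = ‖p n‖ * (s : ℝ) ^ n := by
            push_cast
            rw [div_pow]
            field_simp
    exact lt_of_lt_of_le (by exact_mod_cast div_pos hs0 (by norm_num)) h3
  refine ⟨fun z => P.sum (z - toComplex p₀), ?_, ?_⟩
  · have h := (P.hasFPowerSeriesOnBall hrad).comp_sub (toComplex p₀)
    rw [zero_add] at h
    exact h.analyticAt
  · filter_upwards [Metric.eball_mem_nhds p₀ hp.r_pos] with q hq
    have h1 : HasSum (fun n => p n fun _ => q - p₀) (g q) := by
      have := hp.hasSum (y := q - p₀) (by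
        rw [Metric.mem_eball, edist_zero_right, ← edist_eq_enorm_sub]
        exact hq)
      simpa using this
    rw [← map_sub]
    rw [← h1.tsum_eq]
    exact tsum_congr fun n => complexifyMultilinear_toComplex _ _

/-- A holomorphic function vanishing at the real points near `p₀` vanishes near `p₀`. -/
lemma eventually_eq_zero_of_real {h : (Fin 3 → ℂ) → ℂ} {p₀ : ℝ³}
    (hh : AnalyticAt ℂ h (toComplex p₀)) (h0 : ∀ᶠ p in 𝓝 p₀, h (toComplex p) = 0) :
    ∀ᶠ z in 𝓝 (toComplex p₀), h z = 0 := by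
  have hT : Filter.Tendsto rePart (𝓝 (toComplex p₀)) (𝓝 p₀) := by
    have := rePart.continuous.tendsto (toComplex p₀)
    rwa [rePart_toComplex] at this
  obtain ⟨r, hr, hball⟩ := Metric.eventually_nhds_iff_ball.1
    (hh.eventually_analyticAt.and (hT.eventually h0))
  filter_upwards [Metric.ball_mem_nhds _ hr] with z hz
  -- The complex line through the real part of `z` in the direction of its imaginary part takes real
  -- points at real `ζ` and passes through `z` at `ζ = i`. The identity theorem in one variable then
  -- gives the vanishing at `z`.
  let θ : ℂ → Fin 3 → ℂ := fun ζ => toComplex (rePart z) + ζ • toComplex (imPart z)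
  have hθ : AnalyticOnNhd ℂ θ Set.univ := fun ζ _ =>
    analyticAt_const.add (analyticAt_id.smul analyticAt_const)
  let S : Set ℂ := θ ⁻¹' Metric.ball (toComplex p₀) r
  have hSconv : Convex ℝ S := by
    have hl : IsLinearMap ℝ fun ζ : ℂ => ζ • toComplex (imPart z) :=
      ⟨fun a b => add_smul _ _ _, fun c a => smul_assoc _ _ _⟩
    have := ((convex_ball (toComplex p₀) r).translate_preimage_right
      (toComplex (rePart z))).is_linear_preimage hl
    exact this
  have hS0 : (0 : ℂ) ∈ S := by
    change θ 0 ∈ Metric.ball (toComplex p₀) r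
    simp only [θ, zero_smul, add_zero]
    rw [Metric.mem_ball, dist_pi_lt_iff hr] at hz ⊢
    intro i
    refine lt_of_le_of_lt ?_ (hz i)
    rw [toComplex_apply, toComplex_apply, rePart_apply, dist_eq_norm, dist_eq_norm,
      ← Complex.ofReal_sub, Complex.norm_real, Real.norm_eq_abs]
    have := Complex.abs_re_le_norm (z i - (p₀ i : ℂ))
    simpa using this
  have hSI : Complex.I ∈ S := by
    change θ Complex.I ∈ Metric.ball (toComplex p₀) r
    simpa only [θ, toComplex_rePart_add] using hz
  have hg : AnalyticOnNhd ℂ (h ∘ θ) S := fun ζ hζ =>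
    (hball _ hζ).1.comp (hθ ζ trivial)
  have hfreq : ∃ᶠ ζ in 𝓝[≠] (0 : ℂ), (h ∘ θ) ζ = 0 := by
    have ht : Filter.Tendsto (fun t : ℝ => (t : ℂ)) (𝓝[≠] 0) (𝓝[≠] 0) := by
      refine tendsto_nhdsWithin_of_tendsto_nhds_of_eventually_within _ ?_ ?_
      · exact (Complex.continuous_ofReal.tendsto' 0 0 (by simp)).mono_left nhdsWithin_le_nhds
      · filter_upwards [self_mem_nhdsWithin] with t ht
        simpa using ht
    refine ht.frequently (Filter.Eventually.frequently ?_)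
    have hSo : ∀ᶠ t : ℝ in 𝓝[≠] 0, (t : ℂ) ∈ S := by
      have hSop : IsOpen S := Metric.isOpen_ball.preimage
        (by fun_prop : Continuous θ)
      exact (ht.mono_right nhdsWithin_le_nhds).eventually (hSop.mem_nhds hS0)
    filter_upwards [hSo] with t ht
    have hreal : θ (t : ℂ) = toComplex (rePart z + t • imPart z) := by
      simp only [θ, map_add, map_smul]
      congr 1
    have := (hball _ ht).2
    rw [hreal, rePart_toComplex] at this
    rw [Function.comp_apply, hreal]
    exact this
  have := hg.eqOn_zero_of_preconnected_of_frequently_eq_zero hSconv.isPreconnected hS0 hfreq hSI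
  simpa only [Function.comp_apply, θ, toComplex_rePart_add, Pi.zero_apply] using this

variable {X : Fin 3 → ℝ³ → ℝ³} {p₀ : ℝ³}

lemma exists_complexified_frame (hX : ∀ i, ContDiffAt ℝ ω (X i) p₀) :
    ∃ W : Fin 3 → (Fin 3 → ℂ) → (Fin 3 → ℂ), (∀ i, AnalyticAt ℂ (W i) (toComplex p₀)) ∧
      ∀ᶠ p in 𝓝 p₀, ∀ i, W i (toComplex p) = toComplex (X i p) := by
  have h : ∀ i k : Fin 3, ∃ G : (Fin 3 → ℂ) → ℂ, AnalyticAt ℂ G (toComplex p₀) ∧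
      ∀ᶠ p in 𝓝 p₀, G (toComplex p) = (X i p k : ℂ) := fun i k => by
    refine exists_complexification (g := fun p => (X i p k : ℂ)) ?_
    have h1 : ContDiffAt ℝ ω (fun p => X i p k) p₀ := contDiffAt_euclidean.1 (hX i) k
    exact (Complex.ofRealCLM.contDiff.contDiffAt.comp p₀ h1 : ContDiffAt ℝ ω _ p₀).analyticAt
  choose G hG hGX using h
  refine ⟨fun i z k => G i k z, fun i => ?_, ?_⟩
  · exact AnalyticAt.pi fun k => hG i k
  · filter_upwards [Filter.eventually_all.2 fun i => Filter.eventually_all.2 (hGX i)] with p hp i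
    ext k
    exact hp i k

lemma fderiv_comp_toComplex {F : Type*} [NormedAddCommGroup F] [NormedSpace ℂ F]
    {W : (Fin 3 → ℂ) → F} {p : ℝ³} (hW : DifferentiableAt ℂ W (toComplex p)) (v : ℝ³) :
    fderiv ℝ (fun p => W (toComplex p)) p v = fderiv ℂ W (toComplex p) (toComplex v) := by
  have := ((hW.hasFDerivAt.restrictScalars ℝ).comp p toComplex.hasFDerivAt).fderiv
  change fderiv ℝ (fun p => W (toComplex p)) p = _ at this
  rw [this]
  rfl

lemma linearIndependent_toComplex {x : Fin 3 → ℝ³} (hx : LinearIndependent ℝ x) :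
    LinearIndependent ℂ fun i => toComplex (x i) := by
  rw [Fintype.linearIndependent_iff] at hx ⊢
  intro c hc
  have hre := hx (fun i => (c i).re) (by
    have := congrArg rePart hc
    rw [map_sum, map_zero] at this
    rw [← this]
    refine Finset.sum_congr rfl fun i _ => ?_
    ext k
    simp [rePart_apply, toComplex_apply])
  have him := hx (fun i => (c i).im) (by
    have := congrArg imPart hc
    rw [map_sum, map_zero] at this
    rw [← this]
    refine Finset.sum_congr rfl fun i _ => ?_
    ext k
    simp [imPart_apply, toComplex_apply])
  exact fun i => Complex.ext (hre i) (him i)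

/-- Three vectors with vanishing determinant, the first two independent. -/
lemma exists_eq_of_det_eq_zero {u v w : Fin 3 → ℂ} (huv : LinearIndependent ℂ ![u, v])
    (hdet : (Matrix.of ![u, v, w]).det = 0) : ∃ a b : ℂ, w = a • u + b • v := by
  obtain ⟨c, hc0, hc⟩ := Matrix.exists_vecMul_eq_zero_iff.2 hdet
  have hsum : c 0 • u + c 1 • v + c 2 • w = 0 := by
    ext k
    have := congrFun hc k
    simpa [Matrix.vecMul, dotProduct, Fin.sum_univ_three] using this
  rw [LinearIndependent.pair_iff] at huv
  have hc2 : c 2 ≠ 0 := by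
    intro h2
    have := huv (c 0) (c 1) (by simpa [h2] using hsum)
    apply hc0
    ext i
    fin_cases i
    · exact this.1
    · exact this.2
    · exact h2
  refine ⟨-(c 0 / c 2), -(c 1 / c 2), ?_⟩
  have : c 2 • (w - (-(c 0 / c 2) • u + -(c 1 / c 2) • v)) = 0 := by
    rw [← hsum]
    ext k
    simp only [Pi.smul_apply, Pi.sub_apply, Pi.add_apply, smul_eq_mul]
    field_simp
    ring
  exact sub_eq_zero.1 ((smul_eq_zero.1 this).resolve_left hc2)

/-- Complex-valued real-analytic eigenfunctions for complex parameter values. -/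
lemma exists_complex_eigenfunction (hX : ∀ i, ContDiffAt ℝ ω (X i) p₀)
    (hind : LinearIndependent ℝ fun i => X i p₀)
    (hrel : ∀ᶠ p in 𝓝 p₀, BracketRelations (𝕜 := ℝ) X p) (l : ℂ) :
    ∃ f : ℝ³ → ℂ, ContDiffAt ℝ ω f p₀ ∧ fderiv ℝ f p₀ (X 0 p₀) = 1 ∧
      ∀ k : Fin 2, ∀ᶠ p in 𝓝 p₀,
        fderiv ℝ f p (X k.succ p) = l * fderiv ℝ f p (X k.castSucc p) := by
  obtain ⟨W, hW, hWX⟩ := exists_complexified_frame hX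
  have hWc : ∀ i, ContDiffAt ℂ ω (W i) (toComplex p₀) := fun i => (hW i).contDiffAt
  have hWX0 := hWX.self_of_nhds
  have hTC : Filter.Tendsto toComplex (𝓝 p₀) (𝓝 (toComplex p₀)) := toComplex.continuous.tendsto p₀
  have hdW : ∀ᶠ z in 𝓝 (toComplex p₀), ∀ i, DifferentiableAt ℂ (W i) z :=
    Filter.eventually_all.2 fun i => (hW i).eventually_analyticAt.mono fun z hz =>
      hz.differentiableAt
  have hdX : ∀ᶠ p in 𝓝 p₀, ∀ i, DifferentiableAt ℝ (X i) p :=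
    Filter.eventually_all.2 fun i => (hX i).analyticAt.eventually_analyticAt.mono fun z hz =>
      hz.differentiableAt
  have hWind : LinearIndependent ℂ fun i => W i (toComplex p₀) := by
    simp only [hWX0]
    exact linearIndependent_toComplex hind
  -- brackets at real points
  have hbr : ∀ᶠ p in 𝓝 p₀, ∀ i j, lieBracket ℂ (W i) (W j) (toComplex p) =
      toComplex (lieBracket ℝ (X i) (X j) p) := by
    filter_upwards [hTC.eventually hdW, hdX, hWX.eventually_nhds] with p h1 h2 h3 i j
    have hd (i : Fin 3) (v : ℝ³) : fderiv ℂ (W i) (toComplex p) (toComplex v) =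
        toComplex (fderiv ℝ (X i) p v) := by
      rw [← fderiv_comp_toComplex (h1 i)]
      have e : (fun p => W i (toComplex p)) =ᶠ[𝓝 p] fun p => toComplex (X i p) :=
        h3.mono fun q hq => hq i
      rw [e.fderiv_eq]
      have := (toComplex.hasFDerivAt.comp p (h2 i).hasFDerivAt).fderiv
      change fderiv ℝ (fun p => toComplex (X i p)) p = _ at this
      rw [this]
      rfl
    simp only [lieBracket, h3.self_of_nhds, hd, map_sub]
  have hrelC : ∀ᶠ p in 𝓝 p₀, BracketRelations (𝕜 := ℂ) W (toComplex p) := by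
    filter_upwards [hrel, hbr, hWX] with p ⟨a, b, c, d, h01, h02, h12⟩ h2 h3
    refine ⟨a, b, c, d, ?_, ?_, ?_⟩ <;> rw [h2] <;> simp only [h3]
    · rw [h01]; simp only [map_add, map_smul]; rfl
    · rw [h02]; simp only [map_add, map_smul]
      rw [← Complex.ofReal_add]; rfl
    · rw [h12]; simp only [map_add, map_smul]; rfl
  let Y : (Fin 3 → ℂ) → (Fin 3 → ℂ) := fun z => W 1 z - l • W 0 z
  let Z : (Fin 3 → ℂ) → (Fin 3 → ℂ) := fun z => W 2 z - l • W 1 z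
  have hY : ContDiffAt ℂ ω Y (toComplex p₀) := (hWc 1).sub ((hWc 0).const_smul l)
  have hZ : ContDiffAt ℂ ω Z (toComplex p₀) := (hWc 2).sub ((hWc 1).const_smul l)
  have hYZ : LinearIndependent ℂ ![Y (toComplex p₀), Z (toComplex p₀)] :=
    linearIndependent_pencil hWind l
  -- Involutivity is known only at real points, with coefficients of no known regularity. Stated as
  -- the vanishing of this holomorphic determinant, it propagates to complex points.
  let h : (Fin 3 → ℂ) → ℂ := fun z => (Matrix.of ![Y z, Z z, lieBracket ℂ Y Z z]).det
  have hh : AnalyticAt ℂ h (toComplex p₀) := by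
    have hB : ContDiffAt ℂ ω (lieBracket ℂ Y Z) (toComplex p₀) :=
      ((hZ.fderiv_right (m := ω) le_rfl).clm_apply hY).sub
        ((hY.fderiv_right (m := ω) le_rfl).clm_apply hZ)
    have hY' := contDiffAt_pi.1 hY
    have hZ' := contDiffAt_pi.1 hZ
    have hB' := contDiffAt_pi.1 hB
    have : ContDiffAt ℂ ω h (toComplex p₀) := by
      simp only [h, Matrix.det_fin_three, Matrix.of_apply, Matrix.cons_val_zero,
        Matrix.cons_val_one, Matrix.cons_val]
      have m3 {f g k : (Fin 3 → ℂ) → ℂ} (hf : ContDiffAt ℂ ω f (toComplex p₀))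
          (hg : ContDiffAt ℂ ω g (toComplex p₀)) (hk : ContDiffAt ℂ ω k (toComplex p₀)) :
          ContDiffAt ℂ ω (fun z => f z * g z * k z) (toComplex p₀) := (hf.mul hg).mul hk
      exact (((((m3 (hY' 0) (hZ' 1) (hB' 2)).sub (m3 (hY' 0) (hZ' 2) (hB' 1))).sub
        (m3 (hY' 1) (hZ' 0) (hB' 2))).add (m3 (hY' 1) (hZ' 2) (hB' 0))).add
        (m3 (hY' 2) (hZ' 0) (hB' 1))).sub (m3 (hY' 2) (hZ' 1) (hB' 0))
    exact this.analyticAt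
  have hzero : ∀ᶠ z in 𝓝 (toComplex p₀), h z = 0 := by
    refine eventually_eq_zero_of_real hh ?_
    filter_upwards [hrelC, hTC.eventually hdW] with p hp hd
    obtain ⟨a, b, hab⟩ := lieBracket_pencil_mem hd hp l
    refine Matrix.exists_vecMul_eq_zero_iff.1 ⟨![a, b, -1], fun h => ?_, ?_⟩
    · simpa using congrFun h 2
    · ext k
      have := congrFun hab k
      simp only [Pi.add_apply, Pi.smul_apply, smul_eq_mul] at this
      simp only [Matrix.vecMul, dotProduct, Fin.sum_univ_three, Matrix.of_apply,
        Matrix.cons_val_zero, Matrix.cons_val_one, Matrix.cons_val, Pi.zero_apply, Y, Z, this,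
        Pi.sub_apply, Pi.smul_apply, smul_eq_mul]
      ring
  have hindev : ∀ᶠ z in 𝓝 (toComplex p₀), LinearIndependent ℂ ![Y z, Z z] := by
    have hc : ContinuousAt (fun z => ![Y z, Z z]) (toComplex p₀) := by
      refine continuousAt_pi.2 fun i => ?_
      fin_cases i
      · exact hY.continuousAt
      · exact hZ.continuousAt
    exact hc.eventually hYZ.eventually
  obtain ⟨ℓ, hℓ0, hℓ1, hℓ2⟩ := exists_dual_pencil (by simp) hWind l
  obtain ⟨f, hf, hfd, hfYZ⟩ := exists_common_firstIntegral (n := ω) le_top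
    (near_of_contDiffAt_omega hY) (near_of_contDiffAt_omega hZ) hYZ
    (by filter_upwards [hzero, hindev] with z h1 h2 using exists_eq_of_det_eq_zero h2 h1)
    ℓ (by simp [Y, hℓ0, hℓ1]) (by simp [Z, hℓ1, hℓ2]; ring)
  have hdf : ∀ᶠ z in 𝓝 (toComplex p₀), DifferentiableAt ℂ f z :=
    hf.differentiableAt (by simp)
  refine ⟨fun p => f (toComplex p), ?_, ?_, fun k => ?_⟩
  · exact ContDiffAt.comp (g := f) p₀ (hf.contDiffAt.restrict_scalars ℝ) toComplex.contDiff.contDiffAt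
  · rw [fderiv_comp_toComplex hdf.self_of_nhds, hfd, ← hWX0, hℓ0]
  · filter_upwards [hTC.eventually hdf, hTC.eventually hfYZ, hWX] with p h1 h2 h3
    rw [fderiv_comp_toComplex h1, fderiv_comp_toComplex h1, ← h3, ← h3]
    simp only [Y, Z, map_sub, map_smul, smul_eq_mul, sub_eq_zero] at h2
    fin_cases k
    · exact h2.1
    · exact h2.2

/-- The real and imaginary parts of a first integral for `l = i` span the rotation block. For the
real eigenvalue `0` the real part of a complex first integral suffices. -/
theorem exists_isNormalizing_complex (hX : ∀ i, ContDiffNear ℝ ω (X i) p₀)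
    (hind : LinearIndependent ℝ fun i => X i p₀)
    (hrel : ∀ᶠ p in 𝓝 p₀, BracketRelations (𝕜 := ℝ) X p) :
    ∃ G, IsNormalizing ω X !![0, -1, 0; 1, 0, 0; 0, 0, 0] p₀ G := by
  obtain ⟨f, hf, hf0, hfX⟩ := exists_complex_eigenfunction (fun i => (hX i).contDiffAt) hind hrel Complex.I
  obtain ⟨g, hg, hg0, hgX⟩ := exists_complex_eigenfunction (fun i => (hX i).contDiffAt) hind hrel 0
  have hre {f : ℝ³ → ℂ} {p : ℝ³} (hf : DifferentiableAt ℝ f p) (v : ℝ³) :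
      fderiv ℝ (fun p => (f p).re) p v = (fderiv ℝ f p v).re := by
    have := (Complex.reCLM.hasFDerivAt.comp p hf.hasFDerivAt).fderiv
    change fderiv ℝ (fun p => (f p).re) p = _ at this
    rw [this]
    rfl
  have him {f : ℝ³ → ℂ} {p : ℝ³} (hf : DifferentiableAt ℝ f p) (v : ℝ³) :
      fderiv ℝ (fun p => (f p).im) p v = (fderiv ℝ f p v).im := by
    have := (Complex.imCLM.hasFDerivAt.comp p hf.hasFDerivAt).fderiv
    change fderiv ℝ (fun p => (f p).im) p = _ at this
    rw [this]
    rfl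
  have hdf : ∀ᶠ p in 𝓝 p₀, DifferentiableAt ℝ f p :=
    hf.analyticAt.eventually_analyticAt.mono fun z hz => hz.differentiableAt
  have hdg : ∀ᶠ p in 𝓝 p₀, DifferentiableAt ℝ g p :=
    hg.analyticAt.eventually_analyticAt.mono fun z hz => hz.differentiableAt
  refine ⟨ofCoords ![fun p => (f p).re, fun p => (f p).im, fun p => (g p).re],
    isNormalizing_ofCoords (by simp) ?_ ?_ (x := ![1, 0, 1]) ?_ ?_⟩
  · intro i
    refine near_of_contDiffAt_omega ?_
    fin_cases i
    · exact Complex.reCLM.contDiff.contDiffAt.comp p₀ hf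
    · exact Complex.imCLM.contDiff.contDiffAt.comp p₀ hf
    · exact Complex.reCLM.contDiff.contDiffAt.comp p₀ hg
  · filter_upwards [Filter.eventually_all.2 hfX, Filter.eventually_all.2 hgX, hdf, hdg] with
      p h1 h2 h3 h4 k i
    fin_cases i
    · simp [Fin.sum_univ_three, hre h3, him h3, h1 k]
    · simp [Fin.sum_univ_three, hre h3, him h3, h1 k]
    · simp [Fin.sum_univ_three, hre h4, h2 k]
  · intro i
    fin_cases i
    · simp [hre hdf.self_of_nhds, hf0]
    · simp [him hdf.self_of_nhds, hf0]
    · simp [hre hdg.self_of_nhds, hg0]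
  · rw [Matrix.det_fin_three]
    simp [dotProduct, Fin.sum_univ_three]

end Complexification

end PNO

/-! ### Vector fields in a chart of a three-manifold -/

namespace PNO

noncomputable section Transport

open VectorField IsManifold

variable {M : Type*} [TopologicalSpace M] [ChartedSpace (EuclideanSpace ℝ (Fin 3)) M]
  {e : OpenPartialHomeomorph M (EuclideanSpace ℝ (Fin 3))} {n : WithTop ℕ∞}

lemma mdifferentiable_of_mem_maximalAtlas (hn : ∞ ≤ n) (he : e ∈ maximalAtlas (𝓡 3) n M) :
    e.MDifferentiable (𝓡 3) (𝓡 3) := by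
  have hn0 : n ≠ 0 := by rintro rfl; simp at hn
  exact ⟨(contMDiffOn_of_mem_maximalAtlas he).mdifferentiableOn hn0,
    (contMDiffOn_symm_of_mem_maximalAtlas he).mdifferentiableOn hn0⟩

lemma dChart_add (y : M) (v w : TangentSpace (𝓡 3) y) :
    dChart e y (v + w) = dChart e y v + dChart e y w := map_add (mfderiv (𝓡 3) (𝓡 3) e y) v w

lemma dChart_sub (y : M) (v w : TangentSpace (𝓡 3) y) :
    dChart e y (v - w) = dChart e y v - dChart e y w := map_sub (mfderiv (𝓡 3) (𝓡 3) e y) v w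

lemma dChart_smul (y : M) (c : ℝ) (v : TangentSpace (𝓡 3) y) :
    dChart e y (c • v) = c • dChart e y v := map_smul (mfderiv (𝓡 3) (𝓡 3) e y) c v

variable (e) in
/-- The vector field `X` in the coordinates of the chart `e`. -/
def chartField (X : Field (𝓡 3) (M := M)) (p : EuclideanSpace ℝ (Fin 3)) :
    EuclideanSpace ℝ (Fin 3) :=
  dChart e (e.symm p) (X (e.symm p))

lemma chartField_apply (X : Field (𝓡 3) (M := M)) {y : M} (hy : y ∈ e.source) :
    chartField e X (e y) = dChart e y (X y) := by
  rw [chartField, e.left_inv hy]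

lemma dChart_injective (he : e.MDifferentiable (𝓡 3) (𝓡 3)) {y : M} (hy : y ∈ e.source) :
    Function.Injective (dChart e y) := he.mfderiv_injective hy

lemma linearIndependent_dChart (he : e.MDifferentiable (𝓡 3) (𝓡 3)) {y : M} (hy : y ∈ e.source)
    {ι : Type*} {v : ι → TangentSpace (𝓡 3) y} :
    LinearIndependent ℝ (fun i => dChart e y (v i)) ↔ LinearIndependent ℝ v :=
  LinearMap.linearIndependent_iff_of_injOn (mfderiv (𝓡 3) (𝓡 3) e y).toLinearMap
    (dChart_injective he hy).injOn

lemma mpullback_symm_eq_chartField (he : e.MDifferentiable (𝓡 3) (𝓡 3))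
    (X : Field (𝓡 3) (M := M)) {p : EuclideanSpace ℝ (Fin 3)} (hp : p ∈ e.target) :
    mpullback (𝓡 3) (𝓡 3) e.symm X p = chartField e X p := by
  have h : (mfderiv (𝓡 3) (𝓡 3) e.symm p).inverse = mfderiv (𝓡 3) (𝓡 3) e (e.symm p) :=
    ContinuousLinearMap.inverse_eq (by
      have := he.symm_comp_deriv (e.map_target hp)
      rwa [e.right_inv hp] at this) (he.comp_symm_deriv hp)
  rw [mpullback_apply, h]
  rfl

lemma isInvertible_mfderiv_symm (he : e.MDifferentiable (𝓡 3) (𝓡 3))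
    {p : EuclideanSpace ℝ (Fin 3)} (hp : p ∈ e.target) :
    (mfderiv (𝓡 3) (𝓡 3) e.symm p).IsInvertible :=
  ⟨he.symm.mfderiv hp, rfl⟩

lemma isInvertible_mfderiv (he : e.MDifferentiable (𝓡 3) (𝓡 3)) {y : M} (hy : y ∈ e.source) :
    (mfderiv (𝓡 3) (𝓡 3) e y).IsInvertible :=
  ⟨he.mfderiv hy, rfl⟩

lemma mlieBracket_eq_lieBracket {E : Type*} [NormedAddCommGroup E] [NormedSpace ℝ E]
    {V W : ∀ x : E, TangentSpace 𝓘(ℝ, E) x} :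
    mlieBracket 𝓘(ℝ, E) V W = lieBracket ℝ V W := by
  rw [← mlieBracketWithin_univ, mlieBracketWithin_eq_lieBracketWithin]
  exact lieBracketWithin_univ

/-- Naturality of the bracket under pullback by the inverse chart, which transfers the bracket to
flat space. -/
lemma dChart_mlieBracket [IsManifold (𝓡 3) ∞ M] (he : e ∈ maximalAtlas (𝓡 3) ∞ M)
    {X Y : Field (𝓡 3) (M := M)} {y : M} (hy : y ∈ e.source)
    (hX : MDifferentiableAt (𝓡 3) (𝓡 3).tangent (fun x => (⟨x, X x⟩ : TangentBundle (𝓡 3) M)) y)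
    (hY : MDifferentiableAt (𝓡 3) (𝓡 3).tangent (fun x => (⟨x, Y x⟩ : TangentBundle (𝓡 3) M)) y) :
    dChart e y (mlieBracket (𝓡 3) X Y y) =
      lieBracket ℝ (chartField e X) (chartField e Y) (e y) := by
  have hd := mdifferentiable_of_mem_maximalAtlas le_rfl he
  have h2 : minSmoothness ℝ 2 ≤ (∞ : WithTop ℕ∞) := by
    rw [minSmoothness_of_isRCLikeNormedField]
    exact two_le_of_infty_le le_rfl
  have : IsManifold (𝓡 3) (minSmoothness ℝ 2) M := IsManifold.of_le h2
  have hyt := e.map_source hy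
  have hev (X : Field (𝓡 3) (M := M)) :
      mpullback (𝓡 3) (𝓡 3) e.symm X =ᶠ[𝓝 (e y)] chartField e X := by
    filter_upwards [e.open_target.mem_nhds hyt] with p hp
    exact mpullback_symm_eq_chartField hd X hp
  rw [← e.left_inv hy] at hX hY
  have h := mpullback_mlieBracket (f := e.symm) hX hY
    (contMDiffAt_symm_of_mem_maximalAtlas he hyt) h2
  rw [mpullback_symm_eq_chartField hd _ hyt, chartField_apply _ hy,
    Filter.EventuallyEq.mlieBracket_vectorField_eq (hev X) (hev Y)] at h
  exact h.trans (congrFun (mlieBracket_eq_lieBracket (V := chartField e X)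
    (W := chartField e Y)) (e y))

variable [IsManifold (𝓡 3) 1 M]

/-- Smoothness of a vector field can be tested in a chart. -/
lemma contMDiffAt_iff_chartField (hn : ∞ ≤ n) (he : e ∈ maximalAtlas (𝓡 3) n M)
    {X : Field (𝓡 3) (M := M)} {y : M} (hy : y ∈ e.source) :
    ContMDiffAt (𝓡 3) (𝓡 3).tangent n (fun x => (⟨x, X x⟩ : TangentBundle (𝓡 3) M)) y ↔
      ContDiffAt ℝ n (chartField e X) (e y) := by
  have hd := mdifferentiable_of_mem_maximalAtlas hn he
  have hnn := add_one_le_of_infty_le hn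
  refine Iff.trans ?_ (contMDiffAt_vectorSpace_iff_contDiffAt (V := chartField e X))
  constructor
  · intro h
    rw [← e.left_inv hy] at h
    have h1 := ContMDiffAt.mpullback_vectorField_preimage (f := e.symm) h
      (contMDiffAt_symm_of_mem_maximalAtlas he (e.map_source hy))
      (isInvertible_mfderiv_symm hd (e.map_source hy)) hnn
    refine h1.congr_of_eventuallyEq ?_
    filter_upwards [e.open_target.mem_nhds (e.map_source hy)] with p hp
    rw [mpullback_symm_eq_chartField hd X hp]
  · intro h
    have h1 := ContMDiffAt.mpullback_vectorField_preimage (f := e) h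
      (contMDiffAt_of_mem_maximalAtlas he hy) (isInvertible_mfderiv hd hy) hnn
    refine h1.congr_of_eventuallyEq ?_
    filter_upwards [e.open_source.mem_nhds hy] with z hz
    have : mpullback (𝓡 3) (𝓡 3) e (chartField e X) z = X z := by
      change (mfderiv (𝓡 3) (𝓡 3) e z).inverse (chartField e X (e z)) = X z
      rw [chartField_apply X hz]
      exact (isInvertible_mfderiv hd hz).inverse_apply_eq.2 rfl
    rw [this]

lemma fieldOn_iff_chartField (hn : ∞ ≤ n) (he : e ∈ maximalAtlas (𝓡 3) n M)
    {X : Field (𝓡 3) (M := M)} {U : Set M} (hU : IsOpen U) (hUe : U ⊆ e.source) :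
    FieldOn n X U ↔ ∀ y ∈ U, ContDiffAt ℝ n (chartField e X) (e y) := by
  refine forall₂_congr fun y hy => ?_
  rw [← contMDiffAt_iff_chartField hn he (hUe hy)]
  exact ⟨fun h => h.contMDiffAt (hU.mem_nhds hy), fun h => h.contMDiffWithinAt⟩

lemma FieldOn.chartField_contDiffAt (hn : ∞ ≤ n) (he : e ∈ maximalAtlas (𝓡 3) n M)
    {X : Field (𝓡 3) (M := M)} {U : Set M} (hU : IsOpen U) (hX : FieldOn n X U) {y : M}
    (hyU : y ∈ U) (hy : y ∈ e.source) : ContDiffAt ℝ n (chartField e X) (e y) :=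
  (contMDiffAt_iff_chartField hn he hy).1 (hX.contMDiffAt (hU.mem_nhds hyU))

lemma FieldOn.chartField_near (hn : ∞ ≤ n) (he : e ∈ maximalAtlas (𝓡 3) n M)
    {X : Field (𝓡 3) (M := M)} {U : Set M} (hU : IsOpen U) (hX : FieldOn n X U) {y : M}
    (hyU : y ∈ U) (hy : y ∈ e.source) : ContDiffNear ℝ n (chartField e X) (e y) := by
  have h1 : ∀ᶠ p in 𝓝 (e y), e.symm p ∈ U :=
    (e.tendsto_symm hy).eventually (hU.mem_nhds hyU)
  filter_upwards [h1, e.open_target.mem_nhds (e.map_source hy)] with p hp hpt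
  have := FieldOn.chartField_contDiffAt hn he hU hX hp (e.map_target hpt)
  rwa [e.right_inv hpt] at this

end Transport

end PNO

/-! ### Operators with a constant matrix in a chart -/

namespace PNO

noncomputable section ConstantMatrix

open VectorField IsManifold

variable {M : Type*} [TopologicalSpace M] [ChartedSpace (EuclideanSpace ℝ (Fin 3)) M]
  {e : OpenPartialHomeomorph M (EuclideanSpace ℝ (Fin 3))} {n : WithTop ℕ∞}
  {A : Matrix (Fin 3) (Fin 3) ℝ}

variable (e A) in
/-- The operator with the constant matrix `A` in the chart `e`. -/
def constOperator : Operator (𝓡 3) (M := M) := fun y =>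
  (mfderiv (𝓡 3) (𝓡 3) e y).inverse.toLinearMap ∘ₗ A.toEuclideanLin ∘ₗ
    (mfderiv (𝓡 3) (𝓡 3) e y).toLinearMap

lemma dChart_constOperator (he : e.MDifferentiable (𝓡 3) (𝓡 3)) {y : M} (hy : y ∈ e.source)
    (v : TangentSpace (𝓡 3) y) :
    dChart e y (constOperator e A y v) = A.toEuclideanLin (dChart e y v) := by
  have h := (isInvertible_mfderiv he hy).self_comp_inverse
  exact congrArg (fun B => B (A.toEuclideanLin (dChart e y v))) h

lemma matrixInChart_constOperator (he : e.MDifferentiable (𝓡 3) (𝓡 3)) :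
    MatrixInChart e (constOperator e A) fun _ => A := by
  intro y hy v i
  rw [dChart_constOperator he hy]
  rfl

lemma chartField_constOperator (he : e.MDifferentiable (𝓡 3) (𝓡 3)) (X : Field (𝓡 3) (M := M))
    {p : EuclideanSpace ℝ (Fin 3)} (hp : p ∈ e.target) :
    chartField e ((constOperator e A).app X) p =
      A.toEuclideanLin.toContinuousLinearMap (chartField e X p) :=
  dChart_constOperator he (e.map_target hp) _

variable [IsManifold (𝓡 3) ∞ M]

/-- In the chart the operator is a fixed linear map, which commutes with differentiation of fields,
so the terms of the tensor cancel in pairs. -/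
lemma isNijenhuisOn_constOperator (hn : ∞ ≤ n) (he : e ∈ maximalAtlas (𝓡 3) n M) :
    (constOperator e A).IsNijenhuisOn n e.source := by
  have hd := mdifferentiable_of_mem_maximalAtlas hn he
  let L := A.toEuclideanLin.toContinuousLinearMap
  have hJ (X : Field (𝓡 3) (M := M)) {y : M} (hy : y ∈ e.source) :
      chartField e ((constOperator e A).app X) =ᶠ[𝓝 (e y)] fun p => L (chartField e X p) := by
    filter_upwards [e.open_target.mem_nhds (e.map_source hy)] with p hp
    exact chartField_constOperator hd X hp
  -- Stated for every class `m`, because the Nijenhuis condition is tested on smooth fields even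
  -- when the operator is of class `ω`.
  have hsmooth {m : WithTop ℕ∞} (hm : ∞ ≤ m) (hem : e ∈ maximalAtlas (𝓡 3) m M) (V : Set M)
      (hV : IsOpen V) (hVe : V ⊆ e.source) (X : Field (𝓡 3) (M := M)) (hX : FieldOn m X V) :
      FieldOn m ((constOperator e A).app X) V := by
    rw [fieldOn_iff_chartField hm hem hV hVe] at hX ⊢
    intro y hy
    exact (L.contDiff.contDiffAt.comp (e y) (hX y hy)).congr_of_eventuallyEq (hJ X (hVe hy))
  have hei := maximalAtlas_subset_of_le hn he
  refine ⟨hsmooth hn he, fun V hV hVe X Y hX hY y hy => ?_⟩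
  have hmd {Z : Field (𝓡 3) (M := M)} (hZ : FieldOn ∞ Z V) :
      MDifferentiableAt (𝓡 3) (𝓡 3).tangent (fun x => (⟨x, Z x⟩ : TangentBundle (𝓡 3) M)) y :=
    (hZ.contMDiffAt (hV.mem_nhds hy)).mdifferentiableAt (by simp)
  have hJX := hsmooth le_rfl hei V hV hVe X hX
  have hJY := hsmooth le_rfl hei V hV hVe Y hY
  have hye := hVe hy
  have hX' := (FieldOn.chartField_contDiffAt le_rfl hei hV hX hy hye).differentiableAt (by simp)
  have hY' := (FieldOn.chartField_contDiffAt le_rfl hei hV hY hy hye).differentiableAt (by simp)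
  apply dChart_injective hd hye
  have hz : dChart e y 0 = 0 := map_zero (mfderiv (𝓡 3) (𝓡 3) e y)
  have hfd {F : EuclideanSpace ℝ (Fin 3) → EuclideanSpace ℝ (Fin 3)} {p}
      (hF : DifferentiableAt ℝ F p) : fderiv ℝ (fun p => L (F p)) p = L ∘L fderiv ℝ F p :=
    (L.hasFDerivAt.comp p hF.hasFDerivAt).fderiv
  have hL (v) : A.toEuclideanLin v = L v := rfl
  rw [Operator.nijenhuisTensor, hz, dChart_sub, dChart_constOperator hd hye, dChart_sub,
    dChart_constOperator hd hye, dChart_add, dChart_mlieBracket hei hye (hmd hJX) (hmd hJY),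
    dChart_mlieBracket hei hye (hmd hJX) (hmd hY), dChart_mlieBracket hei hye (hmd hX) (hmd hJY),
    dChart_mlieBracket hei hye (hmd hX) (hmd hY), (hJ X hye).lieBracket_vectorField_eq (hJ Y hye),
    (hJ X hye).lieBracket_vectorField_eq .rfl, Filter.EventuallyEq.lieBracket_vectorField_eq
    (V := chartField e X) (V₁ := chartField e X) .rfl (hJ Y hye)]
  simp only [lieBracket, hfd hX', hfd hY', ContinuousLinearMap.comp_apply, hL, map_sub, map_add]
  abel

/-- If the coordinate differentials of an adapted frame form a chain for a constant matrix, then the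
partial operator extends to the operator with that matrix. -/
theorem extendsNear_of_chain (hn : ∞ ≤ n) (he : e ∈ maximalAtlas (𝓡 3) n M) {x : M}
    (hx : x ∈ e.source) {D : Distribution (𝓡 3) (M := M)} {Jb : PartialOperator D}
    {X : Fin 3 → Field (𝓡 3) (M := M)} (hX : AdaptedFrame n Jb X e.source)
    (hD : ∀ y ∈ e.source, D y ≤ Submodule.span ℝ {X 0 y, X 1 y})
    (hchain : ∀ y ∈ e.source, ∀ k : Fin 2,
      dChart e y (X k.succ y) = A.toEuclideanLin (dChart e y (X k.castSucc y)))
    {φ : Fin 3 → ℂ} {c : Fin 3 → ℝ}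
    (hφ : (!![0, 0, c 0; 1, 0, c 1; 0, 1, c 2] : Matrix (Fin 3) (Fin 3) ℝ).map
      (fun r : ℝ => (r : ℂ)) = frobenius φ)
    (hA : A ^ 3 = c 0 • 1 + c 1 • A + c 2 • A ^ 2)
    {T : OpenPartialHomeomorph M (EuclideanSpace ℝ (Fin 3)) → Operator (𝓡 3) (M := M) →
      (Fin 3 → M → ℂ) → Prop}
    (hT : ∀ J : Operator (𝓡 3) (M := M), MatrixInChart e J (fun _ => A) →
      T e J fun i _ => φ i) : ExtendsNear n Jb T x := by
  have hd := mdifferentiable_of_mem_maximalAtlas hn he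
  have hJX : ∀ y ∈ e.source, ∀ k : Fin 2,
      constOperator e A y (X k.castSucc y) = X k.succ y := fun y hy k => by
    apply dChart_injective hd hy
    rw [dChart_constOperator hd hy, hchain y hy k]
  refine ⟨e, constOperator e A, fun i _ => φ i, X, he, hx, isNijenhuisOn_constOperator hn he, ?_,
    hT _ (matrixInChart_constOperator hd), hX, fun i => ⟨contMDiffOn_const, fun y _ => ⟨0, ?_⟩⟩, ?_⟩
  · intro y hy v
    obtain ⟨h0, h1, hJ0, hJ1⟩ := hX.2 y hy
    obtain ⟨a, b, hab⟩ := Submodule.mem_span_pair.1 (hD y hy v.2)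
    have hv : v = a • ⟨X 0 y, h0⟩ + b • ⟨X 1 y, h1⟩ := Subtype.ext hab.symm
    have e0 : Jb y ⟨X 0 y, h0⟩ = X 1 y := by
      rw [← hJ0, PartialOperator.app, dif_pos h0]
    have e1 : Jb y ⟨X 1 y, h1⟩ = X 2 y := by
      rw [← hJ1, PartialOperator.app, dif_pos h1]
    have f0 := hJX y hy 0
    have f1 := hJX y hy 1
    rw [← hab, map_add, map_smul, map_smul, hv, map_add, map_smul, map_smul, e0, e1]
    exact congrArg₂ (fun s t => a • s + b • t) f0 f1
  · intro k
    rw [mfderiv_const, zero_mul]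
    rfl
  · intro y hy
    refine ⟨_, hφ, fun j => ?_⟩
    fin_cases j
    · simpa [Fin.sum_univ_three] using hJX y hy 0
    · simpa [Fin.sum_univ_three] using hJX y hy 1
    -- In the chart, `X 2` is `A²` applied to `X 0`, so the third column is the cubic relation `hA`.
    · apply dChart_injective hd hy
      have h0 := hchain y hy 0
      have h1 := hchain y hy 1
      simp only [Fin.castSucc_zero, Fin.succ_zero_eq_one, Fin.castSucc_one, Fin.succ_one_eq_two]
        at h0 h1
      have h2 : ∀ v, A.toEuclideanLin (A.toEuclideanLin (A.toEuclideanLin v)) =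
          c 0 • v + c 1 • A.toEuclideanLin v + c 2 • A.toEuclideanLin (A.toEuclideanLin v) := by
        intro v
        have := congrArg (fun B : Matrix (Fin 3) (Fin 3) ℝ => B.toEuclideanLin v) hA
        simpa [pow_succ, Matrix.toLpLin_mul_same] using this
      simp only [Fin.sum_univ_three, dChart_add, dChart_smul]
      change dChart e y (constOperator e A y (X 2 y)) = c 0 • _ + c 1 • _ + c 2 • _
      rw [dChart_constOperator hd hy, h1, h0, h2]

end ConstantMatrix

end PNO

/-! ### Adapted frames and normalizing charts -/

namespace PNO

noncomputable section AdaptedFrames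

open VectorField IsManifold

variable {M : Type*} [TopologicalSpace M] [ChartedSpace (EuclideanSpace ℝ (Fin 3)) M]
  {n : WithTop ℕ∞} {A : Matrix (Fin 3) (Fin 3) ℝ}

/-- Normalizing coordinates give a chart of the manifold. -/
theorem exists_chart_of_isNormalizing [IsManifold (𝓡 3) n M] (hn : ∞ ≤ n)
    {c : OpenPartialHomeomorph M (EuclideanSpace ℝ (Fin 3))} (hc : c ∈ maximalAtlas (𝓡 3) n M)
    {x : M} (hx : x ∈ c.source) {X : Fin 3 → Field (𝓡 3) (M := M)} {U : Set M} (hU : U ∈ 𝓝 x)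
    {G : EuclideanSpace ℝ (Fin 3) → EuclideanSpace ℝ (Fin 3)}
    (hG : IsNormalizing n (fun i => chartField c (X i)) A (c x) G) :
    ∃ e ∈ maximalAtlas (𝓡 3) n M, x ∈ e.source ∧ e.source ⊆ U ∧
      ∀ y ∈ e.source, ∀ k : Fin 2,
        dChart e y (X k.succ y) = A.toEuclideanLin (dChart e y (X k.castSucc y)) := by
  have hn0 : n ≠ 0 := by rintro rfl; simp at hn
  have hn1 : 1 ≤ n := le_trans (by norm_num) (two_le_of_infty_le hn)
  have hd := mdifferentiable_of_mem_maximalAtlas hn hc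
  -- The images of the three frame vectors are independent, hence span, and the inverse function
  -- theorem applies.
  have hsurj : Function.Surjective (fderiv ℝ G (c x)) := by
    have h1 := hG.linearIndependent.span_eq_top_of_card_eq_finrank (by simp)
    refine LinearMap.range_eq_top (f := (fderiv ℝ G (c x)).toLinearMap).1 (eq_top_iff.2 ?_)
    rw [← h1, Submodule.span_le]
    rintro _ ⟨k, rfl⟩
    exact ⟨_, rfl⟩
  have hinj : Function.Injective (fderiv ℝ G (c x)) :=
    LinearMap.injective_iff_surjective (f := (fderiv ℝ G (c x)).toLinearMap).2 hsurj
  let f' := ContinuousLinearEquiv.ofBijective (fderiv ℝ G (c x)) (LinearMap.ker_eq_bot.2 hinj)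
    (LinearMap.range_eq_top.2 hsurj)
  have hf' : HasFDerivAt G (f' : EuclideanSpace ℝ (Fin 3) →L[ℝ] EuclideanSpace ℝ (Fin 3)) (c x) :=
    (hG.contDiffNear.contDiffAt.differentiableAt hn0).hasFDerivAt
  have hS : ∀ᶠ p in 𝓝 (c x), c.symm p ∈ U ∧ ∀ k : Fin 2, ∀ i,
      fderiv ℝ G p (chartField c (X k.succ) p) i =
        ∑ j, A i j * fderiv ℝ G p (chartField c (X k.castSucc) p) j :=
    ((c.tendsto_symm hx).eventually hU).and hG.eventually_chain
  obtain ⟨g, hxg, hgS, hgG, hgd, hgs⟩ := exists_local_diffeomorph hn1 hG.contDiffNear hf' hS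
  have hsrc : ∀ y ∈ (c ≫ₕ g).source, y ∈ c.source ∧ c y ∈ g.source := fun y hy => by
    simpa using hy
  have hgd' : ∀ p ∈ g.source, ContDiffAt ℝ n g p := fun p hp =>
    (hgd p hp).congr_of_eventuallyEq (Filter.Eventually.of_forall hgG)
  refine ⟨c ≫ₕ g, ?_, by simp [hx, hxg], fun y hy => ?_, fun y hy k => ?_⟩
  · refine OpenPartialHomeomorph.mem_maximalAtlas_of_contMDiffOn _ ?_ ?_
    · intro y hy
      obtain ⟨h1, h2⟩ := hsrc y hy
      exact ((hgd' _ h2).contMDiffAt.comp y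
        (contMDiffAt_of_mem_maximalAtlas hc h1)).contMDiffWithinAt
    · intro q hq
      have hq' : q ∈ g.target ∧ g.symm q ∈ c.target := by simpa using hq
      exact (ContMDiffAt.comp q (contMDiffAt_symm_of_mem_maximalAtlas hc hq'.2)
        (hgs q hq'.1).contMDiffAt).contMDiffWithinAt
  · obtain ⟨h1, h2⟩ := hsrc y hy
    have := (hgS h2).1
    rwa [c.left_inv h1] at this
  · obtain ⟨h1, h2⟩ := hsrc y hy
    have hdc (v : TangentSpace (𝓡 3) y) :
        dChart (c ≫ₕ g) y v = fderiv ℝ G (c y) (dChart c y v) := by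
      have e1 : HasMFDerivAt (𝓡 3) (𝓡 3) g (c y) (fderiv ℝ g (c y)) :=
        ((hgd' _ h2).differentiableAt hn0).hasFDerivAt.hasMFDerivAt
      have e2 := (e1.comp y (hd.mdifferentiableAt h1).hasMFDerivAt).mfderiv
      have e3 : (g : EuclideanSpace ℝ (Fin 3) → EuclideanSpace ℝ (Fin 3)) = G := funext hgG
      rw [e3] at e2
      have e4 : ((c ≫ₕ g : OpenPartialHomeomorph M (EuclideanSpace ℝ (Fin 3))) :
          M → EuclideanSpace ℝ (Fin 3)) = G ∘ c := by
        rw [OpenPartialHomeomorph.coe_trans, e3]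
      rw [dChart, e4, e2]
      rfl
    ext i
    have := (hgS h2).2 k i
    rw [chartField_apply _ h1, chartField_apply _ h1] at this
    rw [hdc, hdc, this]
    rfl

variable {D : Distribution (𝓡 3) (M := M)} {Jb : PartialOperator D}

lemma PartialOperator.app_of_mem (X : Field (𝓡 3) (M := M)) {y : M} (h : X y ∈ D y) :
    Jb.app X y = Jb y ⟨X y, h⟩ := dif_pos h

lemma PartialOperator.app_eq_of_eq {X Y Z : Field (𝓡 3) (M := M)} {y : M} {a b : ℝ}
    (hX : X y ∈ D y) (hY : Y y ∈ D y) (hZ : Z y = a • X y + b • Y y) :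
    Jb.app Z y = a • Jb.app X y + b • Jb.app Y y := by
  have h : Z y ∈ D y := by
    rw [hZ]
    exact (D y).add_mem ((D y).smul_mem a hX) ((D y).smul_mem b hY)
  have : (⟨Z y, h⟩ : D y) = a • ⟨X y, hX⟩ + b • ⟨Y y, hY⟩ := Subtype.ext hZ
  rw [app_of_mem X hX, app_of_mem Y hY, app_of_mem Z h, this, map_add, map_smul, map_smul]

variable [IsManifold (𝓡 3) ∞ M]

/-- The bracket relations of an adapted frame of a partial Nijenhuis operator. -/
theorem bracketRelations_of_isPNO (hPNO : IsPNO 2 Jb) {X : Fin 3 → Field (𝓡 3) (M := M)}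
    {U : Set M} (hU : IsOpen U) (hX : AdaptedFrame ∞ Jb X U)
    (hD : ∀ y ∈ U, D y ≤ Submodule.span ℝ {X 0 y, X 1 y})
    {e : OpenPartialHomeomorph M (EuclideanSpace ℝ (Fin 3))} (he : e ∈ maximalAtlas (𝓡 3) ∞ M)
    {y : M} (hyU : y ∈ U) (hy : y ∈ e.source) :
    BracketRelations (𝕜 := ℝ) (fun i => chartField e (X i)) (e y) := by
  have s0 : SectionOn ∞ D (X 0) U := ⟨hX.1.1 0, fun z hz => (hX.2 z hz).1⟩
  have s1 : SectionOn ∞ D (X 1) U := ⟨hX.1.1 1, fun z hz => (hX.2 z hz).2.1⟩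
  have ev0 : Jb.app (X 0) =ᶠ[𝓝 y] X 1 := by
    filter_upwards [hU.mem_nhds hyU] with z hz using (hX.2 z hz).2.2.1
  have ev1 : Jb.app (X 1) =ᶠ[𝓝 y] X 2 := by
    filter_upwards [hU.mem_nhds hyU] with z hz using (hX.2 z hz).2.2.2
  obtain ⟨h0, h1, hJ0, hJ1⟩ := hX.2 y hyU
  obtain ⟨a, b, hab⟩ := Submodule.mem_span_pair.1
    (hD y hyU (hPNO.foliation.involutive U hU _ _ s0 s1 y hyU))
  -- Since `Jb X₀ = X₁`, the first term of the deformed bracket is `[X₁, X₁] = 0`. What remains is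
  -- `[X₀, X₂]` corrected by `Jb [X₀, X₁]`, and the Nijenhuis identity then expresses `[X₁, X₂]`
  -- with the same coefficients `c, d`.
  have hbr : Jb.bracket (X 0) (X 1) y =
      mlieBracket (𝓡 3) (X 0) (X 2) y - (a • X 1 y + b • X 2 y) := by
    rw [PartialOperator.bracket, ev0.mlieBracket_vectorField_eq (W := X 1) (W₁ := X 1) .rfl,
      mlieBracket_self,
      Filter.EventuallyEq.mlieBracket_vectorField_eq (V := X 0) (V₁ := X 0) .rfl ev1,
      PartialOperator.app_eq_of_eq h0 h1 hab.symm, hJ0, hJ1]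
    simp
  obtain ⟨c, d, hcd⟩ := Submodule.mem_span_pair.1
    (hD y hyU (hPNO.bracket_mem U hU _ _ s0 s1 y hyU))
  have hN := hPNO.nijenhuis U hU _ _ s0 s1 y hyU
  rw [ev0.mlieBracket_vectorField_eq ev1, PartialOperator.app_eq_of_eq h0 h1 hcd.symm, hJ0, hJ1,
    sub_eq_zero] at hN
  rw [hbr, eq_sub_iff_add_eq] at hcd
  have hmd (i : Fin 3) :
      MDifferentiableAt (𝓡 3) (𝓡 3).tangent (fun x => (⟨x, X i x⟩ : TangentBundle (𝓡 3) M)) y :=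
    ((hX.1.1 i).contMDiffAt (hU.mem_nhds hyU)).mdifferentiableAt (by simp)
  refine ⟨a, b, c, d, ?_, ?_, ?_⟩
  · rw [← dChart_mlieBracket he hy (hmd 0) (hmd 1), ← hab]
    simp only [dChart_add, dChart_smul, chartField_apply _ hy]
  · rw [← dChart_mlieBracket he hy (hmd 0) (hmd 2), ← hcd]
    simp only [dChart_add, dChart_smul, chartField_apply _ hy]
    module
  · rw [← dChart_mlieBracket he hy (hmd 1) (hmd 2), hN]
    simp only [dChart_add, dChart_smul, chartField_apply _ hy]

/-- In the Kronecker frame `Jb` lowers the index, whereas in an adapted frame it raises it;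
reversing the order of `w` gives the frame. -/
lemma exists_adaptedFrame (hgen : Jb.IsGeneric 2) (x : M) :
    ∃ U : Set M, IsOpen U ∧ x ∈ U ∧ ∃ X : Fin 3 → Field (𝓡 3) (M := M), AdaptedFrame ∞ Jb X U ∧
      ∀ y ∈ U, D y ≤ Submodule.span ℝ {X 0 y, X 1 y} := by
  obtain ⟨U, hU, hx, v, w, hv, hw, hvw⟩ := hgen x
  have hvD : ∀ y ∈ U, ∀ i, v i y ∈ D y := fun y hy i => by
    rw [← (hv.2 y hy).2]
    exact Submodule.subset_span ⟨i, rfl⟩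
  have hrev : ∀ y ∈ U, ∀ i, w (Fin.rev i) y = ![v 1, v 0, w 0] i y := fun y hy i => by
    fin_cases i
    · exact (hvw y hy 1).2.symm
    · exact (hvw y hy 0).2.symm
    · rfl
  refine ⟨U, hU, hx, ![v 1, v 0, w 0], ⟨⟨fun i => ?_, fun y hy => ⟨?_, ?_⟩⟩, fun y hy => ?_⟩,
    fun y hy => ?_⟩
  · fin_cases i
    · exact hv.1 1
    · exact hv.1 0
    · exact hw.1 0
  · have := (hw.2 y hy).1.comp _ Fin.rev_injective
    exact (funext (hrev y hy)) ▸ this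
  · have h1 := (hw.2 y hy).2
    have h2 : (Set.range fun i => ![v 1, v 0, w 0] i y) = Set.range fun i => w i y := by
      rw [← (funext (hrev y hy))]
      exact Fin.rev_surjective.range_comp fun i => w i y
    rw [h2, h1]
  · refine ⟨hvD y hy 1, hvD y hy 0, ?_, (hvw y hy 0).1⟩
    exact (hvw y hy 1).1.trans (hvw y hy 0).2.symm
  · rw [← (hv.2 y hy).2, Submodule.span_le]
    rintro _ ⟨i, rfl⟩
    apply Submodule.subset_span
    fin_cases i
    · exact Or.inr rfl
    · exact Or.inl rfl

end AdaptedFrames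

end PNO

/-! ### Real-analytic adapted frames -/

namespace PNO

noncomputable section AnalyticFrames

open VectorField IsManifold

/-- The determinant of three vectors. -/
def detThree (a b c : EuclideanSpace ℝ (Fin 3)) : ℝ :=
  (Matrix.of ![fun j => a j, fun j => b j, fun j => c j]).det

lemma detThree_eq (a b c : EuclideanSpace ℝ (Fin 3)) : detThree a b c =
    a 0 * b 1 * c 2 - a 0 * b 2 * c 1 - a 1 * b 0 * c 2 + a 1 * b 2 * c 0 + a 2 * b 0 * c 1
      - a 2 * b 1 * c 0 := by
  simp [detThree, Matrix.det_fin_three]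

lemma detThree_ne_zero {v : Fin 3 → EuclideanSpace ℝ (Fin 3)} (hv : LinearIndependent ℝ v) :
    detThree (v 0) (v 1) (v 2) ≠ 0 := by
  have h1 : LinearIndependent ℝ (Matrix.of ![fun j => v 0 j, fun j => v 1 j, fun j => v 2 j]).row := by
    have := hv.map' (EuclideanSpace.equiv (Fin 3) ℝ).toLinearEquiv.toLinearMap
      (LinearEquiv.ker _)
    have hrow : (Matrix.of ![fun j => v 0 j, fun j => v 1 j, fun j => v 2 j]).row =
        (EuclideanSpace.equiv (Fin 3) ℝ).toLinearEquiv.toLinearMap ∘ v := by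
      funext k
      fin_cases k <;> rfl
    rw [hrow]
    exact this
  exact ((Matrix.isUnit_iff_isUnit_det _).1
    (Matrix.linearIndependent_rows_iff_isUnit.1 h1)).ne_zero

lemma contDiffAt_detThree {E : Type*} [NormedAddCommGroup E] [NormedSpace ℝ E] {n : WithTop ℕ∞}
    {a b c : E → EuclideanSpace ℝ (Fin 3)} {p : E} (ha : ContDiffAt ℝ n a p)
    (hb : ContDiffAt ℝ n b p) (hc : ContDiffAt ℝ n c p) :
    ContDiffAt ℝ n (fun p => detThree (a p) (b p) (c p)) p := by
  have ha := contDiffAt_euclidean.1 ha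
  have hb := contDiffAt_euclidean.1 hb
  have hc := contDiffAt_euclidean.1 hc
  have h (i j k : Fin 3) : ContDiffAt ℝ n (fun p => a p i * b p j * c p k) p :=
    ((ha i).mul (hb j)).mul (hc k)
  simp only [detThree_eq]
  exact (((((h 0 1 2).sub (h 0 2 1)).sub (h 1 0 2)).add (h 1 2 0)).add (h 2 0 1)).sub (h 2 1 0)

/-- The combination of `a • x + b • y` and `c • x + d • y` that is proportional to `x`. -/
lemma detThree_combination (x y z : EuclideanSpace ℝ (Fin 3)) (a b c d : ℝ) :
    detThree (a • x + b • y) (c • x + d • y) (c • y + d • z) • (a • x + b • y) -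
      detThree (a • x + b • y) (c • x + d • y) (a • y + b • z) • (c • x + d • y) =
    ((a * d - b * c) ^ 2 * detThree x y z) • x := by
  have h (s t : ℝ) : detThree (a • x + b • y) (c • x + d • y) (s • y + t • z) =
      (a * d - b * c) * t * detThree x y z := by
    simp only [detThree_eq, PiLp.add_apply, PiLp.smul_apply, smul_eq_mul]
    ring
  rw [h, h]
  module

/-- Here `u` is another basis of the plane of `x 0, x 1`, with change of basis determinant `a d - b
c`. The factor `r` is its square times the determinant of `x`, hence nonzero. -/
lemma exists_combination_eq_smul {V : Type*} [AddCommGroup V] [Module ℝ V]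
    (L : V →ₗ[ℝ] EuclideanSpace ℝ (Fin 3)) (hL : Function.Injective L) {x : Fin 3 → V}
    (hx : LinearIndependent ℝ x) {u : Fin 2 → V} (hu : LinearIndependent ℝ u) {a b c d : ℝ}
    (h0 : a • x 0 + b • x 1 = u 0) (h1 : c • x 0 + d • x 1 = u 1) :
    ∃ r : ℝ, r ≠ 0 ∧ detThree (L (u 0)) (L (u 1)) (L (c • x 1 + d • x 2)) • u 0 -
      detThree (L (u 0)) (L (u 1)) (L (a • x 1 + b • x 2)) • u 1 = r • x 0 := by
  refine ⟨(a * d - b * c) ^ 2 * detThree (L (x 0)) (L (x 1)) (L (x 2)),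
    mul_ne_zero (pow_ne_zero 2 fun h => ?_)
      (detThree_ne_zero (v := fun i => L (x i)) (hx.map' L (LinearMap.ker_eq_bot.2 hL))), hL ?_⟩
  · have hu' := Fintype.linearIndependent_iff.1 hu
    have e1 := hu' ![d, -b] (by
      calc _ = (a * d - b * c) • x 0 := by simp [Fin.sum_univ_two, ← h0, ← h1]; module
        _ = 0 := by rw [h, zero_smul]) 1
    have e2 := hu' ![c, -a] (by
      calc _ = -(a * d - b * c) • x 1 := by simp [Fin.sum_univ_two, ← h0, ← h1]; module
        _ = 0 := by rw [h, neg_zero, zero_smul]) 1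
    have hb : b = 0 := by simpa using e1
    have ha : a = 0 := by simpa using e2
    exact hu.ne_zero 0 (by rw [← h0, ha, hb]; simp)
  · rw [← h0, ← h1]
    simp only [map_sub, map_add, map_smul]
    exact detThree_combination _ _ _ _ _ _ _

variable {M : Type*} [TopologicalSpace M] [ChartedSpace (EuclideanSpace ℝ (Fin 3)) M]
  [IsManifold (𝓡 3) ∞ M] {D : Distribution (𝓡 3) (M := M)} {Jb : PartialOperator D}

/-- For an analytic frame `u` of `D`, the vector `s u₀ + t u₁` has image in `D` when `s δ₀ + t δ₁ =
0`, which `s = δ₁`, `t = -δ₀` solves analytically. The resulting `Z` is a nowhere zero multiple of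
the first vector of a smooth adapted frame, and `Z, Jb Z, Jb (Jb Z)` is the required frame. -/
lemma exists_analytic_adaptedFrame (hgen : Jb.IsGeneric 2) (han : Jb.IsAnalytic 2) (x : M) :
    ∃ U : Set M, IsOpen U ∧ x ∈ U ∧ ∃ X : Fin 3 → Field (𝓡 3) (M := M), AdaptedFrame ω Jb X U ∧
      ∀ y ∈ U, D y ≤ Submodule.span ℝ {X 0 y, X 1 y} := by
  have := han.manifold
  obtain ⟨U, hU, hxU, Y, hY, hYD⟩ := exists_adaptedFrame hgen x
  obtain ⟨V, hV, hxV, u, hu⟩ := han.subbundle x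
  let c := chartAt (EuclideanSpace ℝ (Fin 3)) x
  have hc : c ∈ maximalAtlas (𝓡 3) ω M := chart_mem_maximalAtlas x
  have hd := mdifferentiable_of_mem_maximalAtlas le_top hc
  let W := U ∩ V ∩ c.source
  have hW : IsOpen W := (hU.inter hV).inter c.open_source
  have hWc : W ⊆ c.source := fun y hy => hy.2
  have huW : ∀ k, FieldOn ω (u k) W := fun k => (hu.1 k).mono fun y hy => hy.1.2
  have huD : ∀ y ∈ W, ∀ k, u k y ∈ D y := fun y hy k => by
    rw [← (hu.2 y hy.1.2).2]
    exact Submodule.subset_span ⟨k, rfl⟩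
  have hJu : ∀ k, FieldOn ω (Jb.app (u k)) W := fun k =>
    han.operator W hW _ ⟨huW k, fun y hy => huD y hy k⟩
  let δ : Fin 2 → M → ℝ := fun k y =>
    detThree (dChart c y (u 0 y)) (dChart c y (u 1 y)) (dChart c y (Jb.app (u k) y))
  let Z : Field (𝓡 3) (M := M) := fun y => δ 1 y • u 0 y - δ 0 y • u 1 y
  have hZ : FieldOn ω Z W := by
    rw [fieldOn_iff_chartField le_top hc hW hWc]
    intro y hy
    have h1 (k) := (fieldOn_iff_chartField le_top hc hW hWc).1 (huW k) y hy
    have h2 (k) := (fieldOn_iff_chartField le_top hc hW hWc).1 (hJu k) y hy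
    have h3 : chartField c Z = fun p =>
        detThree (chartField c (u 0) p) (chartField c (u 1) p) (chartField c (Jb.app (u 1)) p) •
          chartField c (u 0) p -
        detThree (chartField c (u 0) p) (chartField c (u 1) p) (chartField c (Jb.app (u 0)) p) •
          chartField c (u 1) p := by
      funext p
      simp only [chartField, Z, dChart_sub, dChart_smul, δ]
    rw [h3]
    exact ((contDiffAt_detThree (h1 0) (h1 1) (h2 1)).smul (h1 0)).sub
      ((contDiffAt_detThree (h1 0) (h1 1) (h2 0)).smul (h1 1))
  have hZD : ∀ y ∈ W, Z y ∈ D y := fun y hy =>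
    (D y).sub_mem ((D y).smul_mem _ (huD y hy 0)) ((D y).smul_mem _ (huD y hy 1))
  have hZY : ∀ y ∈ W, ∃ r : ℝ, r ≠ 0 ∧ Z y = r • Y 0 y := by
    intro y hy
    obtain ⟨h0, h1, hJ0, hJ1⟩ := hY.2 y hy.1.1
    obtain ⟨a, b, hab⟩ := Submodule.mem_span_pair.1 (hYD y hy.1.1 (huD y hy 0))
    obtain ⟨a', b', hab'⟩ := Submodule.mem_span_pair.1 (hYD y hy.1.1 (huD y hy 1))
    have := exists_combination_eq_smul (mfderiv (𝓡 3) (𝓡 3) c y).toLinearMap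
      (dChart_injective hd (hWc hy)) (hY.1.2 y hy.1.1).1 (hu.2 y hy.1.2).1 hab hab'
    have e0 := PartialOperator.app_eq_of_eq (Jb := Jb) h0 h1 hab.symm
    have e1 := PartialOperator.app_eq_of_eq (Jb := Jb) h0 h1 hab'.symm
    rw [hJ0, hJ1] at e0 e1
    rw [← e0, ← e1] at this
    exact this
  choose! r hr0 hr using hZY
  have hJZ : ∀ y ∈ W, Jb.app Z y = r y • Y 1 y := fun y hy => by
    obtain ⟨h0, h1, hJ0, hJ1⟩ := hY.2 y hy.1.1
    rw [PartialOperator.app_eq_of_eq (a := r y) (b := 0) h0 h1 (by simp [hr y hy]), hJ0]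
    simp
  have hJZD : ∀ y ∈ W, Jb.app Z y ∈ D y := fun y hy => by
    rw [hJZ y hy]
    exact (D y).smul_mem _ (hY.2 y hy.1.1).2.1
  have hJJZ : ∀ y ∈ W, Jb.app (Jb.app Z) y = r y • Y 2 y := fun y hy => by
    obtain ⟨h0, h1, hJ0, hJ1⟩ := hY.2 y hy.1.1
    rw [PartialOperator.app_eq_of_eq (a := 0) (b := r y) h0 h1 (by simp [hJZ y hy]), hJ1]
    simp
  have hJZs := han.operator W hW Z ⟨hZ, hZD⟩
  have hJJZs := han.operator W hW _ ⟨hJZs, hJZD⟩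
  have hall : ∀ y ∈ W, ∀ i, ![Z, Jb.app Z, Jb.app (Jb.app Z)] i y = r y • Y i y := by
    intro y hy i
    fin_cases i
    · exact hr y hy
    · exact hJZ y hy
    · exact hJJZ y hy
  refine ⟨W, hW, ⟨⟨hxU, hxV⟩, mem_chart_source _ x⟩, ![Z, Jb.app Z, Jb.app (Jb.app Z)],
    ⟨⟨fun i => ?_, fun y hy => ?_⟩, fun y hy => ⟨hZD y hy, hJZD y hy, rfl, rfl⟩⟩, fun y hy => ?_⟩
  · fin_cases i
    · exact hZ
    · exact hJZs
    · exact hJJZs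
  · have hli : LinearIndependent ℝ fun i => ![Z, Jb.app Z, Jb.app (Jb.app Z)] i y := by
      rw [funext (hall y hy)]
      exact (hY.1.2 y hy.1.1).1.units_smul fun _ => Units.mk0 (r y) (hr0 y hy)
    exact ⟨hli, hli.span_eq_top_of_card_eq_finrank
      ((Fintype.card_fin 3).trans (finrank_euclideanSpace_fin (𝕜 := ℝ) (n := 3)).symm)⟩
  · refine (hYD y hy.1.1).trans ?_
    rw [Submodule.span_le]
    have hmem (i : Fin 3) (hi : ![Z, Jb.app Z, Jb.app (Jb.app Z)] i y ∈ Submodule.span ℝ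
        {![Z, Jb.app Z, Jb.app (Jb.app Z)] 0 y, ![Z, Jb.app Z, Jb.app (Jb.app Z)] 1 y}) :
        Y i y ∈ Submodule.span ℝ
        {![Z, Jb.app Z, Jb.app (Jb.app Z)] 0 y, ![Z, Jb.app Z, Jb.app (Jb.app Z)] 1 y} := by
      have := Submodule.smul_mem _ (r y)⁻¹ hi
      rwa [hall y hy i, inv_smul_smul₀ (hr0 y hy)] at this
    rintro _ (rfl | rfl)
    · exact hmem 0 (Submodule.subset_span (Or.inl rfl))
    · exact hmem 1 (Submodule.subset_span (Or.inr rfl))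

end AnalyticFrames

end PNO

/-! ### Extension of partial Nijenhuis operators -/

namespace PNO

noncomputable section Extension

open IsManifold

variable {M : Type*} [TopologicalSpace M] [ChartedSpace (EuclideanSpace ℝ (Fin 3)) M]
  [IsManifold (𝓡 3) ∞ M] {D : Distribution (𝓡 3) (M := M)} {Jb : PartialOperator D}
  {n : WithTop ℕ∞} {A : Matrix (Fin 3) (Fin 3) ℝ}

/-- A normal form theorem for frames of vector fields on `ℝ³` with the bracket relations gives
extensions of partial Nijenhuis operators. -/
theorem extendsNear_of_normalForm [IsManifold (𝓡 3) n M] (hn : ∞ ≤ n) (hPNO : IsPNO 2 Jb) {x : M}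
    (hX : ∃ U : Set M, IsOpen U ∧ x ∈ U ∧ ∃ X : Fin 3 → Field (𝓡 3) (M := M),
      AdaptedFrame n Jb X U ∧ ∀ y ∈ U, D y ≤ Submodule.span ℝ {X 0 y, X 1 y})
    (hA : ∀ {X : Fin 3 → EuclideanSpace ℝ (Fin 3) → EuclideanSpace ℝ (Fin 3)}
      {p₀ : EuclideanSpace ℝ (Fin 3)}, (∀ i, ContDiffNear ℝ n (X i) p₀) →
      LinearIndependent ℝ (fun i => X i p₀) →
      (∀ᶠ p in 𝓝 p₀, BracketRelations (𝕜 := ℝ) X p) → ∃ G, IsNormalizing n X A p₀ G)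
    {φ : Fin 3 → ℂ} {c : Fin 3 → ℝ}
    (hφ : (!![0, 0, c 0; 1, 0, c 1; 0, 1, c 2] : Matrix (Fin 3) (Fin 3) ℝ).map
      (fun r : ℝ => (r : ℂ)) = frobenius φ)
    (hAc : A ^ 3 = c 0 • 1 + c 1 • A + c 2 • A ^ 2)
    {T : OpenPartialHomeomorph M (EuclideanSpace ℝ (Fin 3)) → Operator (𝓡 3) (M := M) →
      (Fin 3 → M → ℂ) → Prop}
    (hT : ∀ e, ∀ J : Operator (𝓡 3) (M := M), MatrixInChart e J (fun _ => A) →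
      T e J fun i _ => φ i) : ExtendsNear n Jb T x := by
  obtain ⟨U, hU, hxU, X, hXU, hD⟩ := hX
  let κ := chartAt (EuclideanSpace ℝ (Fin 3)) x
  have hκ : κ ∈ maximalAtlas (𝓡 3) n M := chart_mem_maximalAtlas x
  have hκi := maximalAtlas_subset_of_le hn hκ
  have hx : x ∈ κ.source := mem_chart_source _ x
  have hXi : AdaptedFrame ∞ Jb X U := ⟨⟨fun i => (hXU.1.1 i).of_le hn, hXU.1.2⟩, hXU.2⟩
  obtain ⟨G, hG⟩ := hA (X := fun i => chartField κ (X i)) (p₀ := κ x)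
    (fun i => FieldOn.chartField_near hn hκ hU (hXU.1.1 i) hxU hx)
    (by
      simp only [chartField_apply _ hx]
      exact (linearIndependent_dChart (mdifferentiable_of_mem_maximalAtlas hn hκ) hx).2
        (hXU.1.2 x hxU).1)
    (by
      filter_upwards [(κ.tendsto_symm hx).eventually (hU.mem_nhds hxU),
        κ.open_target.mem_nhds (κ.map_source hx)] with p hp hpt
      have := bracketRelations_of_isPNO hPNO hU hXi hD hκi hp (κ.map_target hpt)
      rwa [κ.right_inv hpt] at this)
  obtain ⟨e, he, hxe, heU, hchain⟩ :=
    exists_chart_of_isNormalizing hn hκ hx (hU.mem_nhds hxU) hG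
  refine extendsNear_of_chain hn he hxe ⟨⟨fun i => (hXU.1.1 i).mono heU,
    fun y hy => hXU.1.2 y (heU hy)⟩, fun y hy => hXU.2 y (heU hy)⟩ (fun y hy => hD y (heU hy))
    hchain hφ hAc (hT e)

end Extension

end PNO

theorem mainTheorem2 {M : Type*} [TopologicalSpace M]
    [ChartedSpace (EuclideanSpace ℝ (Fin 3)) M] [IsManifold (𝓡 3) ∞ M]
    (D : PNO.Distribution (𝓡 3) (M := M)) (Jb : PNO.PartialOperator D)
    (hPNO : PNO.IsPNO 2 Jb) (hgen : Jb.IsGeneric 2) (x : M) :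
    PNO.ExtendsNear ∞ Jb (PNO.TypeA ∞) x ∧
    PNO.ExtendsNear ∞ Jb (PNO.TypeB ∞) x ∧
    PNO.ExtendsNear ∞ Jb (PNO.TypeC ∞) x ∧
    (Jb.IsAnalytic 2 → PNO.ExtendsNear ω Jb (PNO.TypeD ω) x) := by
  have hX := PNO.exists_adaptedFrame hgen x
  refine ⟨?_, ?_, ?_, fun han => ?_⟩
  -- In each case `φ` lists the eigenvalues and `c` is read off from the characteristic polynomial
  -- `t³ - c₂ t² - c₁ t - c₀`; here it is `t (t - 1) (t - 2)`.
  · refine PNO.extendsNear_of_normalForm le_rfl hPNO hX PNO.exists_isNormalizing_diagonal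
      (φ := ![0, 1, 2]) (c := ![0, -2, 3]) ?_ ?_ fun e J hJ => ?_
    · ext i j
      fin_cases i <;> fin_cases j <;> simp [PNO.frobenius]
      norm_num
    · ext i j
      fin_cases i <;> fin_cases j <;> simp [pow_succ, Matrix.mul_apply, Fin.sum_univ_three] <;>
        norm_num
    · refine ⟨fun _ => 0, fun _ => 1, fun _ => 2, contDiffOn_const, contDiffOn_const,
        contDiffOn_const, fun y _ => by norm_num, fun y _ => by simp, hJ⟩
  · refine PNO.extendsNear_of_normalForm le_rfl hPNO hX PNO.exists_isNormalizing_jordanTwo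
      (φ := ![0, 0, 1]) (c := ![0, 0, 1]) ?_ ?_ fun e J hJ => ?_
    · ext i j
      fin_cases i <;> fin_cases j <;> simp [PNO.frobenius]
    · ext i j
      fin_cases i <;> fin_cases j <;> simp [pow_succ, Matrix.mul_apply, Fin.sum_univ_three]
    · exact ⟨fun _ => 0, fun _ => 1, contDiffOn_const, contDiffOn_const, fun y _ => by norm_num,
        fun y _ => by simp, hJ⟩
  · refine PNO.extendsNear_of_normalForm le_rfl hPNO hX PNO.exists_isNormalizing_jordanThree
      (φ := ![0, 0, 0]) (c := ![0, 0, 0]) ?_ ?_ fun e J hJ => ?_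
    · ext i j
      fin_cases i <;> fin_cases j <;> simp [PNO.frobenius]
    · ext i j
      fin_cases i <;> fin_cases j <;> simp [pow_succ, Matrix.mul_apply, Fin.sum_univ_three]
    · refine ⟨fun _ => 0, contDiffOn_const, fun y _ i => by fin_cases i <;> simp, ?_⟩
      -- For `λ₃ = 0` the exponential entry of type C equals `1`, the entry of the Jordan block.
      simpa using hJ
  · have := han.manifold
    refine PNO.extendsNear_of_normalForm le_top hPNO (PNO.exists_analytic_adaptedFrame hgen han x)
      PNO.exists_isNormalizing_complex
      (φ := ![Complex.I, -Complex.I, 0]) (c := ![0, -1, 0]) ?_ ?_ fun e J hJ => ?_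
    · ext i j
      fin_cases i <;> fin_cases j <;> simp [PNO.frobenius]
    · ext i j
      fin_cases i <;> fin_cases j <;> simp [pow_succ, Matrix.mul_apply, Fin.sum_univ_three]
    · refine ⟨fun _ => Complex.I, fun _ => 0, differentiableOn_const _, contDiffOn_const,
        fun y _ => by simp, fun y _ => by simp, ?_⟩
      simpa using hJ
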